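/- **Theorem (Message speed on the continuous circle).** Let $N,v,r>0$. Two walkers move on the circle $S=\mathbb R/N\mathbb Z$. Walker $j\in\{1,2\}$ has position $X_t(j)$ and direction $D_t(j)\in\{+1,-1\}$ ($+1$ is clockwise); it moves with velocity $vD_t(j)$, and its direction is reversed at the end of each of a sequence of waiting times, where all the waiting times of both walkers are independent and exponentially distributed with mean $1/r$ (directions are right-continuous in $t$). A message is carried by walker $I_t\in\{1,2\}$: $I_t$ changes only at times $t$ at which the two walkers are at the same position, $D_t(I_t)=-1$, and the other walker has direction $+1$; at such a time the message is passed to that other walker. Let $\Phi_t=(X_t,D_t,I_t)$, a process on the space $\Sigma$ of states $\phi=(x,d,i)\in S^2\times\{-1,+1\}^2\times\{1,2\}$, where, if $x(1)=x(2)$ and $d(1)\neq d(2)$, the states with $i=1$ and $i=2$ are identified and represented by the one with $d(i)=+1$. Then $\Phi$ has an invariant probability measure, and every invariant probability measure $\pi$ of $\Phi$ satisfies $$v\int_\Sigma d(i)\,\pi(d\phi)=\frac{v^2}{2v+rN}.$$ Moreover, for every initial state $\Phi_0=\phi\in\Sigma$, the long-term average clockwise speed of the message is $$\lim_{t\to\infty}\frac1t\int_0^t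 v\,D_s(I_s)\,ds=\frac{v^2}{2v+rN}\qquad\text{almost surely.}$$ -/

import Mathlib

open MeasureTheory ProbabilityTheory Filter Topology

noncomputable section

namespace TwoWalkers

/-- The time of the `(k+1)`-st reversal of walker `j`, where `τ (j, l)` is the time that walker `j`
waits between its `l`-th and its `(l+1)`-st reversal. -/
def reversalTime (τ : Fin 2 × ℕ → ℝ) (j : Fin 2) (k : ℕ) : ℝ :=
  ∑ l ∈ Finset.range (k + 1), τ (j, l)

/-- The number of reversals of walker `j` during `[0, t]`. -/
def reversalCount (τ : Fin 2 × ℕ → ℝ) (j : Fin 2) (t : ℝ) : ℕ :=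
  {k : ℕ | reversalTime τ j k ≤ t}.ncard

/-- The direction `D_t(j)` of walker `j` at time `t`, started from the directions `d`;
`1` is clockwise and `-1` is counter-clockwise. -/
def direction (τ : Fin 2 × ℕ → ℝ) (d : Fin 2 → ℤˣ) (t : ℝ) (j : Fin 2) : ℤˣ :=
  (-1) ^ reversalCount τ j t * d j

/-- The position `X_t(j)` of walker `j` at time `t` on the circle `ℝ / Nℤ`, started from the
positions `x`: walker `j` moves with velocity `v * D_t(j)`. -/
def position (N v : ℝ) (τ : Fin 2 × ℕ → ℝ) (x : Fin 2 → AddCircle N) (d : Fin 2 → ℤˣ)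
    (t : ℝ) (j : Fin 2) : AddCircle N :=
  x j + ((∫ s in (0 : ℝ)..t, v * (((direction τ d s j : ℤˣ) : ℤ) : ℝ) : ℝ) : AddCircle N)

/-- Two walkers at positions `x` with directions `d` are at the same place and move in opposite
directions. -/
def Encounter {N : ℝ} (x : Fin 2 → AddCircle N) (d : Fin 2 → ℤˣ) : Prop :=
  x 0 = x 1 ∧ d 0 ≠ d 1

/-- The walker that moves clockwise (used only when the directions differ). -/
def clockwiseWalker (d : Fin 2 → ℤˣ) : Fin 2 := if d 0 = 1 then 0 else 1

/-- The states `(x, d, i)`: positions, directions, and the index of the carrier of the message.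
When the walkers are at the same place and move in opposite directions, the states with `i = 0`
and `i = 1` are to be identified; the representative whose carrier moves clockwise is used. -/
abbrev State (N : ℝ) : Type :=
  {φ : (Fin 2 → AddCircle N) × (Fin 2 → ℤˣ) × Fin 2 // Encounter φ.1 φ.2.1 → φ.2.1 φ.2.2 = 1}

/-- The positions of the two walkers. -/
def State.pos {N : ℝ} (φ : State N) : Fin 2 → AddCircle N := φ.1.1

/-- The directions of the two walkers. -/
def State.dir {N : ℝ} (φ : State N) : Fin 2 → ℤˣ := φ.1.2.1

/-- The index of the walker that carries the message. -/
def State.carrier {N : ℝ} (φ : State N) : Fin 2 := φ.1.2.2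

/-- The direction `d(i)` of the message, as a real number. -/
def State.messageDir {N : ℝ} (φ : State N) : ℝ := ((φ.dir φ.carrier : ℤˣ) : ℤ)

/-- The times `s ∈ [0, t]` at which the two walkers, started from `φ`, encounter each other while
moving in opposite directions. -/
def encounterTimes {N : ℝ} (v : ℝ) (τ : Fin 2 × ℕ → ℝ) (φ : State N) (t : ℝ) : Set ℝ :=
  {s | 0 ≤ s ∧ s ≤ t ∧
    Encounter (position N v τ φ.pos φ.dir s) (direction τ φ.dir s)}

open Classical in
/-- The carrier `I_t` of the message. At an encounter of walkers moving in opposite directions the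
message goes to the walker that moves clockwise (it stays if that one already has it), and the
carrier does not change between encounters. So the carrier at time `t` is the walker that moved
clockwise at the last encounter up to time `t`, or the initial carrier if there was none. -/
def carrierAt {N : ℝ} (v : ℝ) (τ : Fin 2 × ℕ → ℝ) (φ : State N) (t : ℝ) : Fin 2 :=
  if h : ∃ s, IsGreatest (encounterTimes v τ φ t) s then
    clockwiseWalker (direction τ φ.dir h.choose)
  else φ.carrier

theorem apply_clockwiseWalker {d : Fin 2 → ℤˣ} (h : d 0 ≠ d 1) : d (clockwiseWalker d) = 1 := by
  unfold clockwiseWalker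
  rcases Int.units_eq_one_or (d 0) with h0 | h0 <;> rcases Int.units_eq_one_or (d 1) with h1 | h1 <;>
    simp_all

theorem carrierAt_of_isGreatest {N v : ℝ} {τ : Fin 2 × ℕ → ℝ} {φ : State N} {t s : ℝ}
    (h : IsGreatest (encounterTimes v τ φ t) s) :
    carrierAt v τ φ t = clockwiseWalker (direction τ φ.dir s) := by
  have h' : ∃ s, IsGreatest (encounterTimes v τ φ t) s := ⟨s, h⟩
  rw [carrierAt, dif_pos h', h'.choose_spec.unique h]

/-- At an encounter, the message is with the walker that moves clockwise. -/
theorem direction_carrierAt {N v : ℝ} {τ : Fin 2 × ℕ → ℝ} {φ : State N} {t : ℝ} (ht : 0 ≤ t)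
    (h : Encounter (position N v τ φ.pos φ.dir t) (direction τ φ.dir t)) :
    direction τ φ.dir t (carrierAt v τ φ t) = 1 := by
  have hg : IsGreatest (encounterTimes v τ φ t) t := ⟨⟨ht, le_rfl, h⟩, fun s hs => hs.2.1⟩
  rw [carrierAt_of_isGreatest hg, apply_clockwiseWalker h.2]

/-- The carrier does not change during a period without encounters. -/
theorem carrierAt_eq {N v : ℝ} {τ : Fin 2 × ℕ → ℝ} {φ : State N} {s t : ℝ} (hst : s ≤ t)
    (h : ∀ u, 0 ≤ u → s < u → u ≤ t →
      ¬ Encounter (position N v τ φ.pos φ.dir u) (direction τ φ.dir u)) :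
    carrierAt v τ φ t = carrierAt v τ φ s := by
  have : encounterTimes v τ φ t = encounterTimes v τ φ s := by
    ext u
    refine ⟨fun hu => ⟨hu.1, ?_, hu.2.2⟩, fun hu => ⟨hu.1, hu.2.1.trans hst, hu.2.2⟩⟩
    by_contra hlt
    exact h u hu.1 (not_le.1 hlt) hu.2.1 hu.2.2
  by_cases hs : ∃ w, IsGreatest (encounterTimes v τ φ s) w
  · obtain ⟨w, hw⟩ := hs
    rw [carrierAt_of_isGreatest hw, carrierAt_of_isGreatest (this ▸ hw)]
  · rw [carrierAt, carrierAt, dif_neg hs, dif_neg (this ▸ hs)]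

/-- The state `Φ_t = (X_t, D_t, I_t)` at time `t ≥ 0` of the process started from `φ`, as a function
of the waiting times `τ` (a negative time is read as `0`). -/
def process {N : ℝ} (v : ℝ) (τ : Fin 2 × ℕ → ℝ) (φ : State N) (t : ℝ) : State N :=
  ⟨(position N v τ φ.pos φ.dir (max t 0), direction τ φ.dir (max t 0),
      carrierAt v τ φ (max t 0)),
    direction_carrierAt (le_max_right t 0)⟩

/-- The probability measure `π` is invariant for the process driven by the random waiting times
`τ`: `∫ P_φ(Φ_t ∈ A) π(dφ) = π(A)` for all `t ≥ 0` and measurable `A`. -/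
structure IsInvariantLaw {Ω : Type*} [MeasurableSpace Ω] (P : Measure Ω)
    (τ : Fin 2 × ℕ → Ω → ℝ) {N : ℝ} (v : ℝ) (π : Measure (State N)) : Prop where
  isProbabilityMeasure : IsProbabilityMeasure π
  invariant : ∀ t : ℝ, 0 ≤ t → ∀ A : Set (State N), MeasurableSet A →
    ∫⁻ φ, P {ω | process v (fun p => τ p ω) φ t ∈ A} ∂π = π A

end TwoWalkers

end

/-!
The long-term average follows from an explicit solution of a Poisson equation. Let `c` be
`meanDir N v r`, that is `v / (2 * v + r * N)`. There is a bounded function `potential` on the states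
such that the generator of the process maps it to `messageDir - c`. It depends on the relative
position only through a quadratic polynomial and a linear function, so that its drift under free
motion (`integral_potentialDrift_flow`) can be compared with its expected change at the reversals
(`potentialDrift_eq`); the comparison is possible for this value of `c` only. Summing the changes
between reversals and at reversals (`sub_eq_sum_jumps`) shows that
`∫ s in 0..t, (messageDir - c)` is a bounded term plus, for each walker, the sum of a function over
the reversals minus its compensator (`integral_messageDir_sub`). The compensated terms that belong to
different waiting times of a walker are orthogonal with bounded second moments, because an exponential
waiting time has a constant hazard rate (`integral_expMeasure_compensator`), and so a law of large
numbers (`ae_tendsto_sum_div_zero`) shows that they are negligible compared with `t`.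

The average under an arbitrary invariant measure is then forced: started from it, the time averages
of `messageDir` have a constant expectation, and they are bounded and converge to `c` almost surely
(`integral_messageDir_of_map_eq`).

For the existence of an invariant measure the relative coordinate of the walkers is lifted to the
line. For walkers `i` at `x` and `i + 1` at `x + y`, where `y` ranges over `(-N, N]`, the message is
with `i` if and only if `y < 0`, and when the walkers move in the directions `-1` and `1` the lift `y`
grows at speed `2 * v`. With `x` uniform, a multiple of the triangular density `N - |y|` together with
a uniform density on `(0, N]` for `y` (`relativeLaw`) is stationary: the effect of the reversals is
carried by the asymmetry of the uniform part, and it cancels the effect of the shift of the triangular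
part (`triangle_average_eq`, `forward_stationaryMeasure`). A stationary solution of the forward
equation is invariant, because the deviation of the law at time `t` solves a linear Volterra equation
(`map_jumpProcess_of_isStationary`). The forward equation itself comes from summing over the reversals
(`integral_jumpProcess`).

Measurability is not evident from the definition of `process`, where the carrier is found through
the last encounter. It is obtained from `jumpProcess`, which is built recursively along the reversals
and agrees with `process` for almost all waiting times (`process_eq_jumpProcess`). If an encounter and
a reversal happen at the same time, the carrier after the reversal is not determined by the state
reached by free motion. The class `CarrierFree` of functions on the states is insensitive to this,
and no further argument about such coincidences is needed.
-/

set_option linter.unusedSectionVars false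

noncomputable section

namespace TwoWalkers

open scoped ENNReal

/-! ### Free motion on the state space -/

instance : MeasurableSingletonClass ℤˣ where
  measurableSet_singleton u :=
    ⟨{(u : ℤ)}, MeasurableSet.singleton _, by ext x; simp [Units.ext_iff]⟩

/-- A direction, read as a real number `1` or `-1`. -/
def sgn (e : ℤˣ) : ℝ := ((e : ℤ) : ℝ)

@[simp] theorem sgn_one : sgn 1 = 1 := by simp [sgn]

@[simp] theorem sgn_neg_one : sgn (-1) = -1 := by simp [sgn]

theorem sgn_neg (e : ℤˣ) : sgn (-e) = -sgn e := by simp [sgn]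

theorem abs_sgn (e : ℤˣ) : |sgn e| = 1 := by
  rcases Int.units_eq_one_or e with rfl | rfl <;> simp

theorem State.messageDir_eq {N : ℝ} (φ : State N) : φ.messageDir = sgn (φ.dir φ.carrier) := rfl

theorem clockwiseWalker_eq {d : Fin 2 → ℤˣ} {j : Fin 2} (h : d 0 ≠ d 1) (hj : d j = 1) :
    clockwiseWalker d = j := by
  have := apply_clockwiseWalker h
  by_contra hne
  apply h
  generalize clockwiseWalker d = c at *
  fin_cases c <;> fin_cases j <;> simp_all

theorem apply_clockwiseWalker_add_one {d : Fin 2 → ℤˣ} (h : d 0 ≠ d 1) :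
    d (clockwiseWalker d + 1) = -1 := by
  have := apply_clockwiseWalker h
  generalize clockwiseWalker d = c at *
  rcases Int.units_eq_one_or (d (c + 1)) with h1 | h1
  · exfalso; apply h; fin_cases c <;> simp_all
  · exact h1

section Circle

variable {N : ℝ} [hN : Fact (0 < N)]

/-- The representative in `[0, N)` of a point of the circle. -/
def rep (y : AddCircle N) : ℝ := (AddCircle.equivIco N 0 y : ℝ)

theorem rep_nonneg (y : AddCircle N) : 0 ≤ rep y := (AddCircle.equivIco N 0 y).2.1

theorem rep_lt (y : AddCircle N) : rep y < N :=
  (AddCircle.equivIco N 0 y).2.2.trans_eq (zero_add N)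

@[simp] theorem coe_rep (y : AddCircle N) : ((rep y : ℝ) : AddCircle N) = y :=
  AddCircle.coe_equivIco

theorem rep_coe {a : ℝ} (h0 : 0 ≤ a) (h1 : a < N) : rep (a : AddCircle N) = a :=
  AddCircle.equivIco_coe_of_mem ⟨h0, by simpa using h1⟩

@[simp] theorem rep_zero : rep (0 : AddCircle N) = 0 := by
  simpa using rep_coe (N := N) le_rfl hN.out

theorem measurable_rep : Measurable (rep : AddCircle N → ℝ) :=
  measurable_subtype_coe.comp (AddCircle.measurableEquivIco N 0).measurable

/-- Two lifts of the same point of the circle differ by at least `N`. -/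
theorem add_le_of_coe_eq {a b : ℝ} (hab : a < b) (h : (a : AddCircle N) = b) : a + N ≤ b := by
  have h0 : ((b - a : ℝ) : AddCircle N) = 0 := by rw [AddCircle.coe_sub, h, sub_self]
  obtain ⟨n, hn⟩ := (AddCircle.coe_eq_zero_iff N).1 h0
  have hN := hN.out
  have hn' : (n : ℝ) * N = b - a := by simpa using hn
  have : 0 < n := by
    have : (0 : ℝ) < n := by
      by_contra hc
      have : (n : ℝ) * N ≤ 0 := mul_nonpos_of_nonpos_of_nonneg (not_lt.1 hc) hN.le
      linarith
    exact_mod_cast this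
  have : (1 : ℝ) ≤ n := by exact_mod_cast this
  nlinarith

theorem rep_coe_le {a : ℝ} (ha : 0 ≤ a) : rep (a : AddCircle N) ≤ a := by
  by_contra h
  have := add_le_of_coe_eq (N := N) (not_le.1 h) (coe_rep _).symm
  linarith [rep_lt (a : AddCircle N)]

open Classical in
/-- The state with the given positions and directions in which the message is carried by `i`, unless
the walkers are at an encounter, where it is carried by the walker that moves clockwise. -/
def mkState (x : Fin 2 → AddCircle N) (d : Fin 2 → ℤˣ) (i : Fin 2) : State N :=
  ⟨(x, d, if Encounter x d then clockwiseWalker d else i), fun h => by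
    simp only [if_pos h]; exact apply_clockwiseWalker h.2⟩

@[simp] theorem mkState_pos (x : Fin 2 → AddCircle N) (d : Fin 2 → ℤˣ) (i : Fin 2) :
    (mkState x d i).pos = x := rfl

@[simp] theorem mkState_dir (x : Fin 2 → AddCircle N) (d : Fin 2 → ℤˣ) (i : Fin 2) :
    (mkState x d i).dir = d := rfl

theorem mkState_carrier_of_encounter {x : Fin 2 → AddCircle N} {d : Fin 2 → ℤˣ} (i : Fin 2)
    (h : Encounter x d) : (mkState x d i).carrier = clockwiseWalker d := if_pos h

theorem mkState_carrier_of_not {x : Fin 2 → AddCircle N} {d : Fin 2 → ℤˣ} (i : Fin 2)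
    (h : ¬ Encounter x d) : (mkState x d i).carrier = i := if_neg h

theorem State.ext' {φ ψ : State N} (h1 : φ.pos = ψ.pos) (h2 : φ.dir = ψ.dir)
    (h3 : φ.carrier = ψ.carrier) : φ = ψ :=
  Subtype.ext (Prod.ext h1 (Prod.ext h2 h3))

theorem State.carrier_eq_of_encounter {φ : State N} (h : Encounter φ.pos φ.dir) :
    φ.carrier = clockwiseWalker φ.dir := (clockwiseWalker_eq h.2 (φ.2 h)).symm

@[simp] theorem mkState_self (φ : State N) : mkState φ.pos φ.dir φ.carrier = φ := by
  refine State.ext' rfl rfl ?_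
  by_cases h : Encounter φ.pos φ.dir
  · rw [mkState_carrier_of_encounter _ h, State.carrier_eq_of_encounter h]
  · rw [mkState_carrier_of_not _ h]

theorem mkState_congr {x : Fin 2 → AddCircle N} {d : Fin 2 → ℤˣ} {i j : Fin 2}
    (h : ¬ Encounter x d → i = j) : mkState x d i = mkState x d j := by
  by_cases hE : Encounter x d
  · exact State.ext' rfl rfl (by
      rw [mkState_carrier_of_encounter _ hE, mkState_carrier_of_encounter _ hE])
  · rw [h hE]

/-- The positions after walkers at `x` have moved for time `u` in the directions `d`. -/
def moved (v : ℝ) (x : Fin 2 → AddCircle N) (d : Fin 2 → ℤˣ) (u : ℝ) : Fin 2 → AddCircle N :=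
  fun j => x j + ((u * (v * sgn (d j)) : ℝ) : AddCircle N)

@[simp] theorem moved_zero (v : ℝ) (x : Fin 2 → AddCircle N) (d : Fin 2 → ℤˣ) :
    moved v x d 0 = x := by
  ext j; simp [moved]

theorem moved_moved (v : ℝ) (x : Fin 2 → AddCircle N) (d : Fin 2 → ℤˣ) (a b : ℝ) :
    moved v (moved v x d a) d b = moved v x d (a + b) := by
  ext j; simp only [moved, add_mul, AddCircle.coe_add]; abel

/-- The time until walkers that move in opposite directions meet (`0` if they are at the same
place). -/
def hit (v : ℝ) (x : Fin 2 → AddCircle N) (d : Fin 2 → ℤˣ) : ℝ :=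
  rep (x (clockwiseWalker d + 1) - x (clockwiseWalker d)) / (2 * v)

/-- Coincidence of two values, stated symmetrically in the two walkers. -/
theorem eq_iff_of_add_one {α : Type*} (x : Fin 2 → α) (c : Fin 2) :
    x 0 = x 1 ↔ x (c + 1) = x c := by
  fin_cases c <;> simp [eq_comm]

theorem moved_eq_iff {v : ℝ} {x : Fin 2 → AddCircle N} {d : Fin 2 → ℤˣ} (hd : d 0 ≠ d 1) (u : ℝ) :
    moved v x d u 0 = moved v x d u 1 ↔
      ((2 * v * u : ℝ) : AddCircle N) = x (clockwiseWalker d + 1) - x (clockwiseWalker d) := by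
  rw [eq_iff_of_add_one _ (clockwiseWalker d)]
  simp only [moved, apply_clockwiseWalker hd, apply_clockwiseWalker_add_one hd, sgn_one,
    sgn_neg_one]
  have : (2 * v * u : ℝ) = u * (v * 1) - u * (v * -1) := by ring
  rw [this, AddCircle.coe_sub]
  constructor
  · intro h; rw [sub_eq_sub_iff_add_eq_add, add_comm, ← h, add_comm]
  · intro h; rw [sub_eq_sub_iff_add_eq_add] at h; rw [← h, add_comm]

theorem encounter_moved_iff {v : ℝ} {x : Fin 2 → AddCircle N} {d : Fin 2 → ℤˣ} (hd : d 0 ≠ d 1)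
    (u : ℝ) : Encounter (moved v x d u) d ↔
      ((2 * v * u : ℝ) : AddCircle N) = x (clockwiseWalker d + 1) - x (clockwiseWalker d) := by
  rw [← moved_eq_iff hd, Encounter, and_iff_left hd]

theorem hit_nonneg {v : ℝ} (hv : 0 < v) (x : Fin 2 → AddCircle N) (d : Fin 2 → ℤˣ) :
    0 ≤ hit v x d := div_nonneg (rep_nonneg _) (by positivity)

theorem encounter_moved_hit {v : ℝ} (hv : 0 < v) (x : Fin 2 → AddCircle N) {d : Fin 2 → ℤˣ}
    (hd : d 0 ≠ d 1) : Encounter (moved v x d (hit v x d)) d := by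
  rw [encounter_moved_iff hd, hit, mul_div_cancel₀ _ (by positivity), coe_rep]

theorem hit_le_of_encounter {v : ℝ} (hv : 0 < v) {x : Fin 2 → AddCircle N} {d : Fin 2 → ℤˣ} {u : ℝ}
    (hu : 0 ≤ u) (h : Encounter (moved v x d u) d) : hit v x d ≤ u := by
  have h1 := (encounter_moved_iff h.2 u).1 h
  rw [hit, ← h1, div_le_iff₀ (by positivity), mul_comm]
  exact rep_coe_le (by positivity)

/-- Consecutive encounters during free motion are separated by at least `N / (2 v)`. -/
theorem encounter_gap {v : ℝ} (hv : 0 < v) {x : Fin 2 → AddCircle N} {d : Fin 2 → ℤˣ} {a b : ℝ}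
    (hab : a < b) (ha : Encounter (moved v x d a) d) (hb : Encounter (moved v x d b) d) :
    a + N / (2 * v) ≤ b := by
  have h := add_le_of_coe_eq (N := N) (mul_lt_mul_of_pos_left hab (by positivity : 0 < 2 * v))
    (((encounter_moved_iff ha.2 a).1 ha).trans ((encounter_moved_iff hb.2 b).1 hb).symm)
  have : a + N / (2 * v) = (2 * v * a + N) / (2 * v) := by field_simp
  rw [this, div_le_iff₀ (by positivity)]
  linarith

/-- Free motion for time `u`, after which the directions become `d'`. Encounters at times in
`[0, u)` pass the message; one at time `u` itself counts only if the new directions differ. -/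
def step (v u : ℝ) (φ : State N) (d' : Fin 2 → ℤˣ) : State N :=
  mkState (moved v φ.pos φ.dir u) d'
    (if φ.dir 0 ≠ φ.dir 1 ∧ hit v φ.pos φ.dir < u then clockwiseWalker φ.dir else φ.carrier)

/-- Free motion for time `u`. -/
def flow (v u : ℝ) (φ : State N) : State N := step v u φ φ.dir

/-- The state after a reversal of walker `j`. -/
def flip (j : Fin 2) (φ : State N) : State N :=
  mkState φ.pos (Function.update φ.dir j (-φ.dir j)) φ.carrier

@[simp] theorem flow_pos (v u : ℝ) (φ : State N) : (flow v u φ).pos = moved v φ.pos φ.dir u := rfl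

@[simp] theorem flow_dir (v u : ℝ) (φ : State N) : (flow v u φ).dir = φ.dir := rfl

theorem flow_zero {v : ℝ} (hv : 0 < v) (φ : State N) : flow v 0 φ = φ := by
  rw [flow, step, if_neg fun h => (hit_nonneg hv φ.pos φ.dir).not_gt h.2, moved_zero, mkState_self]

/-- For the free motion an encounter at the final time passes the message too, so that the strict
inequality in `step` can be weakened. -/
theorem flow_carrier {v u : ℝ} (hv : 0 < v) (hu : 0 ≤ u) (φ : State N) : (flow v u φ).carrier =
    if φ.dir 0 ≠ φ.dir 1 ∧ hit v φ.pos φ.dir ≤ u then clockwiseWalker φ.dir else φ.carrier := by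
  by_cases hE : Encounter (moved v φ.pos φ.dir u) φ.dir
  · rw [flow, step, mkState_carrier_of_encounter _ hE, if_pos ⟨hE.2, hit_le_of_encounter hv hu hE⟩]
  · rw [flow, step, mkState_carrier_of_not _ hE]
    refine if_congr (and_congr_right fun hd => ⟨le_of_lt, fun h => h.lt_of_ne fun h' => hE ?_⟩) rfl rfl
    rw [← h']; exact encounter_moved_hit hv _ hd

theorem flow_flow {v a b : ℝ} (hv : 0 < v) (ha : 0 ≤ a) (hb : 0 ≤ b) (φ : State N) :
    flow v b (flow v a φ) = flow v (a + b) φ := by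
  refine State.ext' (by simp [moved_moved]) rfl ?_
  rw [flow_carrier hv hb, flow_carrier hv (add_nonneg ha hb), flow_carrier hv ha]
  simp only [flow_pos, flow_dir]
  by_cases hd : φ.dir 0 ≠ φ.dir 1
  · by_cases h1 : hit v φ.pos φ.dir ≤ a
    · simp [hd, h1, h1.trans (le_add_of_nonneg_right hb)]
    · have : hit v (moved v φ.pos φ.dir a) φ.dir ≤ b ↔ hit v φ.pos φ.dir ≤ a + b := by
        constructor
        · intro h
          have := encounter_moved_hit hv (moved v φ.pos φ.dir a) hd
          rw [moved_moved] at this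
          exact (hit_le_of_encounter hv (add_nonneg ha (hit_nonneg hv _ _)) this).trans (by linarith)
        · intro h
          have := encounter_moved_hit hv φ.pos hd
          have e : hit v φ.pos φ.dir = a + (hit v φ.pos φ.dir - a) := by ring
          rw [e, ← moved_moved] at this
          linarith [hit_le_of_encounter hv (by linarith) this]
      simp [hd, h1, this]
  · simp [hd]

/-! ### Measurability of the free motion -/

theorem measurable_pos : Measurable (State.pos : State N → _) :=
  measurable_fst.comp measurable_subtype_coe

theorem measurable_dir : Measurable (State.dir : State N → _) :=
  measurable_fst.comp (measurable_snd.comp measurable_subtype_coe)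

theorem measurable_carrier : Measurable (State.carrier : State N → _) :=
  measurable_snd.comp (measurable_snd.comp measurable_subtype_coe)

variable {α : Type*} [MeasurableSpace α]

theorem measurableSet_encounter {x : α → Fin 2 → AddCircle N} {d : α → Fin 2 → ℤˣ}
    (hx : Measurable x) (hd : Measurable d) : MeasurableSet {a | Encounter (x a) (d a)} :=
  (measurableSet_eq_fun ((measurable_pi_apply 0).comp hx) ((measurable_pi_apply 1).comp hx)).inter
    (measurableSet_eq_fun ((measurable_pi_apply 0).comp hd) ((measurable_pi_apply 1).comp hd)).compl

theorem measurable_clockwiseWalker : Measurable clockwiseWalker := measurable_of_countable _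

theorem measurable_sgn : Measurable sgn := measurable_of_countable _

theorem measurable_mkState {x : α → Fin 2 → AddCircle N} {d : α → Fin 2 → ℤˣ} {i : α → Fin 2}
    (hx : Measurable x) (hd : Measurable d) (hi : Measurable i) :
    Measurable fun a => mkState (x a) (d a) (i a) := by
  refine Measurable.subtype_mk (hx.prodMk (hd.prodMk ?_))
  exact Measurable.ite (measurableSet_encounter hx hd) (measurable_clockwiseWalker.comp hd) hi

theorem measurable_moved {v : ℝ} {x : α → Fin 2 → AddCircle N} {d : α → Fin 2 → ℤˣ} {u : α → ℝ}
    (hx : Measurable x) (hd : Measurable d) (hu : Measurable u) :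
    Measurable fun a => moved v (x a) (d a) (u a) := by
  refine measurable_pi_lambda _ fun j => ((measurable_pi_apply j).comp hx).add ?_
  refine AddCircle.measurable_mk'.comp (hu.mul (measurable_const.mul ?_))
  exact measurable_sgn.comp ((measurable_pi_apply j).comp hd)

theorem measurable_apply_index {β : Type*} [MeasurableSpace β] {x : α → Fin 2 → β} {i : α → Fin 2}
    (hx : Measurable x) (hi : Measurable i) : Measurable fun a => x a (i a) := by
  have : Measurable fun p : Fin 2 × (Fin 2 → β) => p.2 p.1 :=
    measurable_from_prod_countable_right fun j => measurable_pi_apply j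
  exact this.comp (hi.prodMk hx)

theorem measurable_hit {v : ℝ} {x : α → Fin 2 → AddCircle N} {d : α → Fin 2 → ℤˣ}
    (hx : Measurable x) (hd : Measurable d) : Measurable fun a => hit v (x a) (d a) := by
  have hc := measurable_clockwiseWalker.comp hd
  refine (measurable_rep.comp (Measurable.sub ?_ (measurable_apply_index hx hc))).div_const _
  exact measurable_apply_index hx ((measurable_of_countable fun c : Fin 2 => c + 1).comp hc)

theorem measurable_step {v : ℝ} {u : α → ℝ} {φ : α → State N} {d : α → Fin 2 → ℤˣ}
    (hu : Measurable u) (hφ : Measurable φ) (hd : Measurable d) :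
    Measurable fun a => step v (u a) (φ a) (d a) := by
  have hx := measurable_pos.comp hφ
  have hd' := measurable_dir.comp hφ
  refine measurable_mkState (measurable_moved hx hd' hu) hd (Measurable.ite ?_
    (measurable_clockwiseWalker.comp hd') (measurable_carrier.comp hφ))
  exact (measurableSet_eq_fun ((measurable_pi_apply 0).comp hd')
    ((measurable_pi_apply 1).comp hd')).compl.inter (measurableSet_lt (measurable_hit hx hd') hu)

theorem measurable_flow {v : ℝ} {u : α → ℝ} {φ : α → State N}
    (hu : Measurable u) (hφ : Measurable φ) : Measurable fun a => flow v (u a) (φ a) :=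
  measurable_step hu hφ (measurable_dir.comp hφ)

theorem measurable_flip (j : Fin 2) : Measurable (flip j : State N → State N) :=
  measurable_mkState measurable_pos
    ((measurable_of_countable fun d : Fin 2 → ℤˣ => Function.update d j (-d j)).comp measurable_dir)
    measurable_carrier

theorem measurable_messageDir : Measurable (State.messageDir : State N → ℝ) :=
  measurable_sgn.comp (measurable_apply_index measurable_dir measurable_carrier)

end Circle

/-! ### Paths of the process -/

/-- The time of the `n`-th reversal of walker `j`, with `0` for `n = 0`. -/
def arrival (τ : Fin 2 × ℕ → ℝ) (j : Fin 2) (n : ℕ) : ℝ := ∑ l ∈ Finset.range n, τ (j, l)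

theorem reversalTime_eq (τ : Fin 2 × ℕ → ℝ) (j : Fin 2) (k : ℕ) :
    reversalTime τ j k = arrival τ j (k + 1) := rfl

@[simp] theorem arrival_zero (τ : Fin 2 × ℕ → ℝ) (j : Fin 2) : arrival τ j 0 = 0 := by
  simp [arrival]

theorem arrival_succ (τ : Fin 2 × ℕ → ℝ) (j : Fin 2) (n : ℕ) :
    arrival τ j (n + 1) = arrival τ j n + τ (j, n) := Finset.sum_range_succ _ _

theorem measurable_arrival (j : Fin 2) (n : ℕ) : Measurable fun τ => arrival τ j n :=
  Finset.measurable_sum _ fun l _ => measurable_pi_apply (j, l)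

theorem ncard_succ_le_eq {f : ℕ → ℝ} {t : ℝ} {n : ℕ} (hf : StrictMono f) (h1 : f n ≤ t)
    (h2 : t < f (n + 1)) : {k : ℕ | f (k + 1) ≤ t}.ncard = n := by
  have : {k : ℕ | f (k + 1) ≤ t} = Set.Iio n := by
    ext k
    simp only [Set.mem_ofPred_eq, Set.mem_Iio]
    constructor
    · intro hk
      exact Nat.lt_of_succ_lt_succ (hf.lt_iff_lt.1 (hk.trans_lt h2))
    · intro hk
      exact (hf.monotone hk).trans h1
  rw [this, Set.ncard_eq_toFinset_card', Set.toFinset_Iio, Nat.card_Iio]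

theorem exists_le_lt_succ {f : ℕ → ℝ} {t : ℝ} (h0 : f 0 ≤ t) (hex : ∃ m, t < f m) :
    ∃ n, f n ≤ t ∧ t < f (n + 1) := by
  classical
  obtain ⟨m, hm⟩ : ∃ m, Nat.find hex = m + 1 := by
    refine Nat.exists_eq_succ_of_ne_zero fun h => ?_
    have := Nat.find_spec hex
    rw [h] at this
    linarith
  have h2 := Nat.find_spec hex
  rw [hm] at h2
  exact ⟨m, not_lt.1 (Nat.find_min hex (by omega)), h2⟩

/-- Waiting times are admissible if they are positive and each walker reverses finitely often in
bounded time. -/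
structure Good (τ : Fin 2 × ℕ → ℝ) : Prop where
  pos : ∀ p, 0 < τ p
  div : ∀ j, Tendsto (arrival τ j) atTop atTop

section Counting

variable {τ : Fin 2 × ℕ → ℝ} {j : Fin 2} {n : ℕ} {t : ℝ}

theorem Good.strictMono (h : Good τ) (j : Fin 2) : StrictMono (arrival τ j) :=
  strictMono_nat_of_lt_succ fun n => by rw [arrival_succ]; linarith [h.pos (j, n)]

theorem Good.arrival_nonneg (h : Good τ) (j : Fin 2) (n : ℕ) : 0 ≤ arrival τ j n := by
  simpa using (h.strictMono j).monotone (Nat.zero_le n)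

theorem Good.count_eq (h : Good τ) (h1 : arrival τ j n ≤ t) (h2 : t < arrival τ j (n + 1)) :
    reversalCount τ j t = n := ncard_succ_le_eq (h.strictMono j) h1 h2

theorem Good.count_spec (h : Good τ) (j : Fin 2) (ht : 0 ≤ t) :
    arrival τ j (reversalCount τ j t) ≤ t ∧ t < arrival τ j (reversalCount τ j t + 1) := by
  obtain ⟨n, h1, h2⟩ := exists_le_lt_succ (f := arrival τ j) (by simpa using ht)
    ((h.div j).eventually_gt_atTop t).exists
  rw [h.count_eq h1 h2]
  exact ⟨h1, h2⟩

theorem Good.le_count_iff (h : Good τ) (ht : 0 ≤ t) :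
    n ≤ reversalCount τ j t ↔ arrival τ j n ≤ t := by
  have hs := h.count_spec j ht
  constructor
  · intro hn; exact ((h.strictMono j).monotone hn).trans hs.1
  · intro hn; exact Nat.lt_succ_iff.1 ((h.strictMono j).lt_iff_lt.1 (hn.trans_lt hs.2))

theorem Good.count_mono (h : Good τ) {s : ℝ} (hs : 0 ≤ s) (hst : s ≤ t) :
    reversalCount τ j s ≤ reversalCount τ j t :=
  (h.le_count_iff (hs.trans hst)).2 ((h.count_spec j hs).1.trans hst)

theorem Good.count_zero (h : Good τ) (j : Fin 2) : reversalCount τ j 0 = 0 :=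
  h.count_eq (by simp) (by simpa [arrival_succ] using h.pos (j, 0))

end Counting

theorem measurable_ncard {α : Type*} [MeasurableSpace α] {S : α → Set ℕ}
    (hS : ∀ k, MeasurableSet {a | k ∈ S a}) : Measurable fun a => (S a).ncard := by
  have h1 : ∀ a, ((S a).encard : ENNReal) = ∑' k, (S a).indicator 1 k := fun a => by
    rw [← tsum_subtype]; simp
  have h2 : Measurable fun a => ((S a).encard : ENNReal) := by
    simp_rw [h1]
    refine Measurable.tsum fun k => ?_
    have : (fun a => (S a).indicator (1 : ℕ → ENNReal) k) = {a | k ∈ S a}.indicator 1 := by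
      ext a; by_cases h : k ∈ S a <;> simp [h]
    rw [this]
    exact measurable_one.indicator (hS k)
  have h3 : ∀ a, (S a).ncard = ⌊((S a).encard : ENNReal).toReal⌋₊ := fun a => by
    rw [Set.ncard]
    cases h : (S a).encard with
    | top => simp
    | coe n => simp
  simp_rw [h3]
  exact Nat.measurable_floor.comp h2.ennreal_toReal

theorem measurable_reversalCount (j : Fin 2) :
    Measurable fun p : (Fin 2 × ℕ → ℝ) × ℝ => reversalCount p.1 j p.2 :=
  measurable_ncard fun k =>
    measurableSet_le ((measurable_arrival j (k + 1)).comp measurable_fst) measurable_snd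

theorem measurable_neg_one_pow_mul :
    Measurable fun p : ℕ × ℤˣ => (-1 : ℤˣ) ^ p.1 * p.2 := measurable_of_countable _

theorem measurable_direction {α : Type*} [MeasurableSpace α] {τ : α → Fin 2 × ℕ → ℝ}
    {d : α → Fin 2 → ℤˣ} {t : α → ℝ} (hτ : Measurable τ) (hd : Measurable d) (ht : Measurable t) :
    Measurable fun a => direction (τ a) (d a) (t a) := by
  refine measurable_pi_lambda _ fun j => ?_
  have h1 : Measurable fun a => reversalCount (τ a) j (t a) :=
    Measurable.comp (f := fun a => (τ a, t a)) (measurable_reversalCount j) (hτ.prodMk ht)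
  have h2 : Measurable fun a => d a j := (measurable_pi_apply j).comp hd
  exact Measurable.comp (f := fun a => (reversalCount (τ a) j (t a), d a j))
    measurable_neg_one_pow_mul (h1.prodMk h2)

theorem direction_congr {τ τ' : Fin 2 × ℕ → ℝ} {d : Fin 2 → ℤˣ} {s t : ℝ}
    (h : ∀ j, reversalCount τ j s = reversalCount τ' j t) : direction τ d s = direction τ' d t := by
  ext j; simp [direction, h]

theorem intervalIntegrable_velocity (v : ℝ) (τ : Fin 2 × ℕ → ℝ) (d : Fin 2 → ℤˣ) (j : Fin 2)
    (a b : ℝ) : IntervalIntegrable (fun s => v * sgn (direction τ d s j)) volume a b := by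
  refine (intervalIntegrable_const (c := |v|)).mono_fun ?_ (Eventually.of_forall fun s => ?_)
  · exact (measurable_const.mul (measurable_sgn.comp ((measurable_pi_apply j).comp
      (measurable_direction measurable_const measurable_const measurable_id)))).aestronglyMeasurable
  · simp [abs_sgn]

/-- A bounded set of reals with separated points attains its supremum. It provides the last encounter
that `carrierAt` refers to. -/
theorem exists_isGreatest_of_gap {S : Set ℝ} {ε : ℝ} (hε : 0 < ε) (hne : S.Nonempty)
    (hb : BddAbove S) (hgap : ∀ a ∈ S, ∀ b ∈ S, a < b → a + ε ≤ b) : ∃ s, IsGreatest S s := by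
  obtain ⟨w, hw, hlt⟩ := exists_lt_of_lt_csSup hne (sub_lt_self (sSup S) hε)
  refine ⟨w, hw, fun b hb' => not_lt.1 fun hwb => ?_⟩
  linarith [hgap w hw b hb' hwb, le_csSup hb hb']

section Path

variable {N v : ℝ} [hN : Fact (0 < N)] {τ τ' : Fin 2 × ℕ → ℝ} {φ : State N} {a b t : ℝ}

theorem process_pos (ht : 0 ≤ t) : (process v τ φ t).pos = position N v τ φ.pos φ.dir t := by
  simp [process, State.pos, max_eq_left ht]

theorem process_dir (ht : 0 ≤ t) : (process v τ φ t).dir = direction τ φ.dir t := by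
  simp [process, State.dir, max_eq_left ht]

theorem process_carrier (ht : 0 ≤ t) : (process v τ φ t).carrier = carrierAt v τ φ t := by
  simp [process, State.carrier, max_eq_left ht]

theorem position_eq_moved {x : Fin 2 → AddCircle N} {d : Fin 2 → ℤˣ} (hab : a ≤ b)
    (h : ∀ s, a ≤ s → s < b → direction τ d s = direction τ d a) :
    position N v τ x d b = moved v (position N v τ x d a) (direction τ d a) (b - a) := by
  ext j
  have h1 := intervalIntegral.integral_add_adjacent_intervals
    (intervalIntegrable_velocity v τ d j 0 a) (intervalIntegrable_velocity v τ d j a b)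
  have h2 : ∫ s in a..b, v * sgn (direction τ d s j) = (b - a) * (v * sgn (direction τ d a j)) := by
    rw [← smul_eq_mul, ← intervalIntegral.integral_const]
    refine intervalIntegral.integral_congr_ae ?_
    filter_upwards [Measure.ae_ne volume b] with s hs hmem
    rw [Set.uIoc_of_le hab] at hmem
    rw [h s hmem.1.le (hmem.2.lt_of_ne hs)]
  change x j + ((∫ s in (0 : ℝ)..b, v * sgn (direction τ d s j) : ℝ) : AddCircle N) =
    x j + ((∫ s in (0 : ℝ)..a, v * sgn (direction τ d s j) : ℝ) : AddCircle N) + _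
  rw [← h1, h2, AddCircle.coe_add, add_assoc]

/-- While the directions stay constant the process moves freely, and a change of the directions at
the end of the period does not affect encounters before. -/
theorem process_eq_step (hv : 0 < v) (ha : 0 ≤ a) (hab : a ≤ b)
    (h : ∀ s, a ≤ s → s < b → direction τ φ.dir s = direction τ φ.dir a) :
    process v τ φ b = step v (b - a) (process v τ φ a) (direction τ φ.dir b) := by
  have hb := ha.trans hab
  have hpos : ∀ s, a ≤ s → s ≤ b → position N v τ φ.pos φ.dir s =
      moved v (position N v τ φ.pos φ.dir a) (direction τ φ.dir a) (s - a) :=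
    fun s h1 h2 => position_eq_moved h1 fun u hu1 hu2 => h u hu1 (hu2.trans_le h2)
  have henc : ∀ s, a ≤ s → s < b →
      (Encounter (position N v τ φ.pos φ.dir s) (direction τ φ.dir s) ↔
      Encounter (moved v (position N v τ φ.pos φ.dir a) (direction τ φ.dir a) (s - a))
        (direction τ φ.dir a)) := fun s h1 h2 => by rw [hpos s h1 h2.le, h s h1 h2]
  refine State.ext' ?_ ?_ ?_
  · rw [process_pos hb, step, mkState_pos, process_pos ha, process_dir ha, hpos b hab le_rfl]
  · rw [process_dir hb, step, mkState_dir]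
  rw [process_carrier hb, step, process_pos ha, process_dir ha, process_carrier ha,
    ← hpos b hab le_rfl]
  by_cases hE : Encounter (position N v τ φ.pos φ.dir b) (direction τ φ.dir b)
  · rw [mkState_carrier_of_encounter _ hE]
    exact (clockwiseWalker_eq hE.2 (direction_carrierAt hb hE)).symm
  rw [mkState_carrier_of_not _ hE]
  split_ifs with hc
  · -- the last encounter before `b` takes place in `[a, b)`
    obtain ⟨hd, hlt⟩ := hc
    set x := position N v τ φ.pos φ.dir a
    set d := direction τ φ.dir a
    obtain ⟨s, hs⟩ : ∃ s, IsGreatest {s | a ≤ s ∧ s < b ∧ Encounter (moved v x d (s - a)) d} s := by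
      refine exists_isGreatest_of_gap (ε := N / (2 * v)) (div_pos hN.out (by positivity))
        ⟨a + hit v x d, ?_, ?_, ?_⟩ ⟨b, fun s hs => hs.2.1.le⟩ fun s hs s' hs' hlt => ?_
      · linarith [hit_nonneg hv x d]
      · linarith
      · rw [add_sub_cancel_left]; exact encounter_moved_hit hv x hd
      · linarith [encounter_gap hv (by linarith) hs.2.2 hs'.2.2]
    have hg : IsGreatest (encounterTimes v τ φ b) s := by
      refine ⟨⟨ha.trans hs.1.1, hs.1.2.1.le, (henc s hs.1.1 hs.1.2.1).2 hs.1.2.2⟩, fun u hu => ?_⟩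
      rcases hu.2.1.lt_or_eq with hub | rfl
      · by_cases hau : a ≤ u
        · exact hs.2 ⟨hau, hub, (henc u hau hub).1 hu.2.2⟩
        · exact (not_le.1 hau).le.trans hs.1.1
      · exact absurd hu.2.2 hE
    rw [carrierAt_of_isGreatest hg, h s hs.1.1 hs.1.2.1]
  · refine carrierAt_eq hab fun u hu0 hu1 hu2 hu3 => ?_
    rcases hu2.lt_or_eq with hub | rfl
    · have := (henc u hu1.le hub).1 hu3
      exact hc ⟨this.2, (hit_le_of_encounter hv (by linarith) this).trans_lt (by linarith)⟩
    · exact hE hu3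

theorem process_eq_flow (hv : 0 < v) (ha : 0 ≤ a) (hab : a ≤ b)
    (h : ∀ s, a ≤ s → s ≤ b → direction τ φ.dir s = direction τ φ.dir a) :
    process v τ φ b = flow v (b - a) (process v τ φ a) := by
  rw [process_eq_step hv ha hab fun s h1 h2 => h s h1 h2.le, flow, process_dir ha, h b hab le_rfl]

/-- The process up to time `t` depends only on the directions up to time `t`. -/
theorem process_congr (ht : 0 ≤ t)
    (h : ∀ s, 0 ≤ s → s ≤ t → direction τ φ.dir s = direction τ' φ.dir s) :
    process v τ φ t = process v τ' φ t := by
  have hpos : ∀ s, 0 ≤ s → s ≤ t →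
      position N v τ φ.pos φ.dir s = position N v τ' φ.pos φ.dir s := fun s h1 h2 => by
    ext j
    simp only [position]
    congr 2
    refine intervalIntegral.integral_congr fun u hu => ?_
    rw [Set.uIcc_of_le h1] at hu
    simp only [h u hu.1 (hu.2.trans h2)]
  have henc : encounterTimes v τ φ t = encounterTimes v τ' φ t := by
    ext s
    refine and_congr_right fun h1 => and_congr_right fun h2 => ?_
    rw [hpos s h1 h2, h s h1 h2]
  refine State.ext' ?_ ?_ ?_
  · rw [process_pos ht, process_pos ht, hpos t ht le_rfl]
  · rw [process_dir ht, process_dir ht, h t ht le_rfl]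
  · rw [process_carrier ht, process_carrier ht]
    by_cases hg : ∃ w, IsGreatest (encounterTimes v τ φ t) w
    · obtain ⟨w, hw⟩ := hg
      rw [carrierAt_of_isGreatest hw, carrierAt_of_isGreatest (henc ▸ hw),
        h w hw.1.1 hw.1.2.1]
    · rw [carrierAt, carrierAt, dif_neg hg, dif_neg (henc ▸ hg)]

theorem process_zero (hτ : Good τ) : process v τ φ 0 = φ := by
  have hd : direction τ φ.dir 0 = φ.dir := by ext j; simp [direction, hτ.count_zero]
  have hx : position N v τ φ.pos φ.dir 0 = φ.pos := by ext j; simp [position]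
  refine State.ext' ?_ ?_ ?_
  · rw [process_pos le_rfl, hx]
  · rw [process_dir le_rfl, hd]
  · rw [process_carrier le_rfl]
    by_cases h : Encounter φ.pos φ.dir
    · rw [State.carrier_eq_of_encounter h]
      have := direction_carrierAt (N := N) (v := v) (τ := τ) (φ := φ) le_rfl (by rwa [hd, hx])
      rw [hd] at this
      exact (clockwiseWalker_eq h.2 this).symm
    · have : ¬ ∃ s, IsGreatest (encounterTimes v τ φ 0) s := by
        rintro ⟨s, hs⟩
        have h0 : s = 0 := le_antisymm hs.1.2.1 hs.1.1
        have := hs.1.2.2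
        rw [h0, hd, hx] at this
        exact h this
      rw [carrierAt, dif_neg this]

end Path

/-! ### A jointly measurable version of the process -/

/-- The times at which some walker reverses, in increasing order and preceded by `0`. -/
def epoch (τ : Fin 2 × ℕ → ℝ) : ℕ → ℝ
  | 0 => 0
  | m + 1 => min (arrival τ 0 (reversalCount τ 0 (epoch τ m) + 1))
      (arrival τ 1 (reversalCount τ 1 (epoch τ m) + 1))

/-- The states at the times `epoch`. -/
def epochState {N : ℝ} [Fact (0 < N)] (v : ℝ) (τ : Fin 2 × ℕ → ℝ) (φ : State N) : ℕ → State N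
  | 0 => φ
  | m + 1 => step v (epoch τ (m + 1) - epoch τ m) (epochState v τ φ m)
      (direction τ φ.dir (epoch τ (m + 1)))

/-- The number of times `epoch` in `(0, t]`. -/
def epochIndex (τ : Fin 2 × ℕ → ℝ) (t : ℝ) : ℕ := {m | epoch τ (m + 1) ≤ t}.ncard

/-- The process, assembled from its states at the reversals. It agrees with `process` for admissible
waiting times, and it is measurable in all its arguments by construction. -/
def jumpProcess {N : ℝ} [Fact (0 < N)] (v : ℝ) (τ : Fin 2 × ℕ → ℝ) (φ : State N) (t : ℝ) :
    State N :=
  step v (t - epoch τ (epochIndex τ t)) (epochState v τ φ (epochIndex τ t)) (direction τ φ.dir t)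

theorem measurable_epoch (m : ℕ) : Measurable fun τ => epoch τ m := by
  induction m with
  | zero => exact measurable_const
  | succ m ih =>
    have h : ∀ j : Fin 2, Measurable fun τ => arrival τ j (reversalCount τ j (epoch τ m) + 1) := by
      intro j
      have h1 : Measurable fun p : ℕ × (Fin 2 × ℕ → ℝ) => arrival p.2 j (p.1 + 1) :=
        measurable_from_prod_countable_right fun n => measurable_arrival j (n + 1)
      have h2 : Measurable fun τ => reversalCount τ j (epoch τ m) :=
        Measurable.comp (f := fun τ => (τ, epoch τ m)) (measurable_reversalCount j)
          (measurable_id.prodMk ih)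
      exact Measurable.comp (f := fun τ => (reversalCount τ j (epoch τ m), τ)) h1
        (h2.prodMk measurable_id)
    exact (h 0).min (h 1)

theorem measurable_epochIndex : Measurable fun p : (Fin 2 × ℕ → ℝ) × ℝ => epochIndex p.1 p.2 :=
  measurable_ncard fun m =>
    measurableSet_le ((measurable_epoch (m + 1)).comp measurable_fst) measurable_snd

section

variable {N v : ℝ} [hN : Fact (0 < N)] {τ : Fin 2 × ℕ → ℝ} {φ : State N} {t : ℝ}

theorem measurable_epochState (m : ℕ) :
    Measurable fun p : (Fin 2 × ℕ → ℝ) × State N => epochState v p.1 p.2 m := by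
  induction m with
  | zero => exact measurable_snd
  | succ m ih =>
    have h1 : Measurable fun p : (Fin 2 × ℕ → ℝ) × State N => epoch p.1 (m + 1) :=
      (measurable_epoch (m + 1)).comp measurable_fst
    have h2 : Measurable fun p : (Fin 2 × ℕ → ℝ) × State N => epoch p.1 m :=
      (measurable_epoch m).comp measurable_fst
    exact measurable_step (h1.sub h2) ih
      (measurable_direction measurable_fst (measurable_dir.comp measurable_snd) h1)

theorem measurable_jumpProcess {α : Type*} [MeasurableSpace α] {T : α → Fin 2 × ℕ → ℝ}
    {Φ : α → State N} {u : α → ℝ} (hT : Measurable T) (hΦ : Measurable Φ) (hu : Measurable u) :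
    Measurable fun a => jumpProcess v (T a) (Φ a) (u a) := by
  have hi : Measurable fun a => epochIndex (T a) (u a) :=
    Measurable.comp (f := fun a => (T a, u a)) measurable_epochIndex (hT.prodMk hu)
  have h1 : Measurable fun p : ℕ × α => epoch (T p.2) p.1 :=
    measurable_from_prod_countable_right fun m =>
      Measurable.comp (f := T) (measurable_epoch m) hT
  have h2 : Measurable fun p : ℕ × α => epochState v (T p.2) (Φ p.2) p.1 :=
    measurable_from_prod_countable_right fun m =>
      Measurable.comp (f := fun a => (T a, Φ a)) (measurable_epochState m) (hT.prodMk hΦ)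
  have hp : Measurable fun a => (epochIndex (T a) (u a), a) := hi.prodMk measurable_id
  refine measurable_step (hu.sub ?_) ?_ (measurable_direction hT (measurable_dir.comp hΦ) hu)
  · exact Measurable.comp (f := fun a => (epochIndex (T a) (u a), a)) h1 hp
  · exact Measurable.comp (f := fun a => (epochIndex (T a) (u a), a)) h2 hp

theorem Good.epoch_lt (h : Good τ) (m : ℕ) : 0 ≤ epoch τ m ∧ epoch τ m < epoch τ (m + 1) := by
  have key : ∀ m, 0 ≤ epoch τ m → epoch τ m < epoch τ (m + 1) := fun m h0 =>
    lt_min (h.count_spec 0 h0).2 (h.count_spec 1 h0).2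
  have h0 : 0 ≤ epoch τ m := by
    induction m with
    | zero => exact le_rfl
    | succ m ih => exact ih.trans (key m ih).le
  exact ⟨h0, key m h0⟩

/-- Each `epoch` is at least one new reversal, so that the epochs exhaust the half-line. -/
theorem Good.le_count_epoch (h : Good τ) (m : ℕ) :
    m ≤ reversalCount τ 0 (epoch τ m) + reversalCount τ 1 (epoch τ m) := by
  induction m with
  | zero => exact Nat.zero_le _
  | succ m ih =>
    have hm := h.epoch_lt m
    have h1 := fun j => h.count_mono (j := j) hm.1 hm.2.le
    have hm' := (h.epoch_lt (m + 1)).1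
    rcases min_choice (arrival τ 0 (reversalCount τ 0 (epoch τ m) + 1))
      (arrival τ 1 (reversalCount τ 1 (epoch τ m) + 1)) with hc | hc
    · have := (h.le_count_iff hm').2 hc.ge
      have := h1 1
      omega
    · have := (h.le_count_iff hm').2 hc.ge
      have := h1 0
      omega

theorem Good.epochIndex_spec (h : Good τ) (ht : 0 ≤ t) :
    epoch τ (epochIndex τ t) ≤ t ∧ t < epoch τ (epochIndex τ t + 1) := by
  obtain ⟨n, h1, h2⟩ := exists_le_lt_succ (f := epoch τ) (t := t) ht (by
    by_contra! hc
    have h1 := h.le_count_epoch (reversalCount τ 0 t + reversalCount τ 1 t + 1)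
    have h2 := fun j => h.count_mono (j := j) (h.epoch_lt _).1
      (hc (reversalCount τ 0 t + reversalCount τ 1 t + 1))
    have := h2 0
    have := h2 1
    omega)
  have : epochIndex τ t = n :=
    ncard_succ_le_eq (strictMono_nat_of_lt_succ fun m => (h.epoch_lt m).2) h1 h2
  rw [this]
  exact ⟨h1, h2⟩

theorem Good.direction_eq_epoch (h : Good τ) {m : ℕ} {s : ℝ} (h1 : epoch τ m ≤ s)
    (h2 : s < epoch τ (m + 1)) (d : Fin 2 → ℤˣ) :
    direction τ d s = direction τ d (epoch τ m) := by
  refine direction_congr fun j => h.count_eq ((h.count_spec j (h.epoch_lt m).1).1.trans h1) ?_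
  refine h2.trans_le ?_
  fin_cases j
  · exact min_le_left _ _
  · exact min_le_right _ _

theorem process_epoch (hv : 0 < v) (h : Good τ) (m : ℕ) :
    process v τ φ (epoch τ m) = epochState v τ φ m := by
  induction m with
  | zero => exact process_zero h
  | succ m ih =>
    rw [epochState, ← ih]
    exact process_eq_step hv (h.epoch_lt m).1 (h.epoch_lt m).2.le
      fun s h1 h2 => h.direction_eq_epoch h1 h2 _

theorem process_eq_jumpProcess (hv : 0 < v) (h : Good τ) (ht : 0 ≤ t) :
    process v τ φ t = jumpProcess v τ φ t := by
  have hs := h.epochIndex_spec ht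
  rw [jumpProcess, ← process_epoch hv h]
  exact process_eq_step hv (h.epoch_lt _).1 hs.1
    fun s h1 h2 => h.direction_eq_epoch h1 (h2.trans hs.2) _

end

/-! ### The law of the waiting times -/

section Exponential

variable {r : ℝ}

theorem lintegral_expMeasure {f : ℝ → ℝ≥0∞} (hf : Measurable f) :
    ∫⁻ w, f w ∂(expMeasure r) =
      ∫⁻ w in Set.Ici 0, ENNReal.ofReal (r * Real.exp (-(r * w))) * f w := by
  have h : expMeasure r = volume.withDensity (exponentialPDF r) := rfl
  rw [h, lintegral_withDensity_eq_lintegral_mul _ (f := exponentialPDF r)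
    (measurable_exponentialPDFReal r).ennreal_ofReal hf, ← lintegral_indicator measurableSet_Ici]
  refine lintegral_congr fun w => ?_
  by_cases hw : 0 ≤ w
  · simp [exponentialPDF_eq, hw]
  · simp [exponentialPDF_eq, hw]

instance : NullSingletonClass (expMeasure r) :=
  inferInstanceAs (NullSingletonClass (volume.withDensity (exponentialPDF r)))

theorem expMeasure_Ici (hr : 0 < r) {u : ℝ} (hu : 0 ≤ u) :
    expMeasure r (Set.Ici u) = ENNReal.ofReal (Real.exp (-(r * u))) := by
  have := isProbabilityMeasure_expMeasure hr
  rw [measure_congr Ioi_ae_eq_Ici.symm, ← Set.compl_Iic, prob_compl_eq_one_sub measurableSet_Iic,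
    ← ofReal_cdf, cdf_expMeasure_eq hr, if_pos hu, ← ENNReal.ofReal_one,
    ← ENNReal.ofReal_sub _ (by simp [hr.le, hu, mul_nonneg])]
  simp

theorem ae_pos_expMeasure (hr : 0 < r) : ∀ᵐ w ∂(expMeasure r), 0 < w := by
  have := isProbabilityMeasure_expMeasure hr
  have h : expMeasure r (Set.Ioi 0) = 1 := by
    rw [measure_congr Ioi_ae_eq_Ici, expMeasure_Ici hr le_rfl]; simp
  exact (prob_compl_eq_zero_iff measurableSet_Ioi).2 h

/-- The compensator identity for an exponential waiting time, which has constant hazard rate `r`. -/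
theorem lintegral_expMeasure_compensator (hr : 0 < r) {f : ℝ → ℝ≥0∞} (hf : Measurable f) :
    ∫⁻ w, f w ∂(expMeasure r) =
      ∫⁻ w, (ENNReal.ofReal r * ∫⁻ u in Set.Ioc 0 w, f u) ∂(expMeasure r) := by
  have := isProbabilityMeasure_expMeasure hr
  have hm : Measurable fun p : ℝ × ℝ => (Set.Ioc 0 p.1).indicator f p.2 := by
    have hS : MeasurableSet {p : ℝ × ℝ | p.2 ∈ Set.Ioc 0 p.1} :=
      (measurableSet_lt measurable_const measurable_snd).inter
        (measurableSet_le measurable_snd measurable_fst)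
    exact (hf.comp measurable_snd).indicator hS
  have h1 : ∫⁻ w, (∫⁻ u in Set.Ioc 0 w, f u) ∂(expMeasure r) =
      ∫⁻ u in Set.Ioi 0, ENNReal.ofReal (Real.exp (-(r * u))) * f u := by
    simp_rw [← lintegral_indicator measurableSet_Ioc]
    rw [lintegral_lintegral_swap hm.aemeasurable, ← lintegral_indicator measurableSet_Ioi]
    refine lintegral_congr fun u => ?_
    by_cases hu : 0 < u
    · have : ∀ w, (Set.Ioc 0 w).indicator f u = (Set.Ici u).indicator (fun _ => f u) w := fun w => by
        by_cases hw : u ≤ w <;> simp [hu, hw]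
      simp_rw [this]
      rw [lintegral_indicator_const measurableSet_Ici, expMeasure_Ici hr hu.le,
        Set.indicator_of_mem (Set.mem_Ioi.2 hu), mul_comm]
    · simp [hu]
  rw [lintegral_const_mul, h1, ← lintegral_const_mul' _ _ ENNReal.ofReal_ne_top,
    lintegral_expMeasure hf, ← setLIntegral_congr (Ioi_ae_eq_Ici (μ := volume) (a := (0 : ℝ)))]
  · refine lintegral_congr fun u => ?_
    rw [ENNReal.ofReal_mul hr.le, mul_assoc]
  · simp_rw [← lintegral_indicator measurableSet_Ioc]
    exact hm.lintegral_prod_right'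

theorem lintegral_id_expMeasure (hr : 0 < r) :
    ∫⁻ w, ENNReal.ofReal w ∂(expMeasure r) = ENNReal.ofReal r⁻¹ := by
  have := isProbabilityMeasure_expMeasure hr
  have h := lintegral_expMeasure_compensator hr (f := fun _ => 1) measurable_const
  simp only [lintegral_const, measure_univ, mul_one, one_mul, Measure.restrict_apply,
    MeasurableSet.univ, Set.univ_inter, Real.volume_Ioc, sub_zero] at h
  rw [lintegral_const_mul _ ENNReal.measurable_ofReal] at h
  rw [ENNReal.ofReal_inv_of_pos hr]
  exact (ENNReal.eq_inv_of_mul_eq_one_left (by rw [mul_comm]; exact h.symm))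

theorem integrable_id_expMeasure (hr : 0 < r) : Integrable (fun w : ℝ => w) (expMeasure r) := by
  refine ⟨measurable_id.aestronglyMeasurable, ?_⟩
  rw [hasFiniteIntegral_iff_ofReal ((ae_pos_expMeasure hr).mono fun w hw => hw.le),
    lintegral_id_expMeasure hr]
  exact ENNReal.ofReal_lt_top

theorem integral_id_expMeasure (hr : 0 < r) : ∫ w, w ∂(expMeasure r) = r⁻¹ := by
  rw [integral_eq_lintegral_of_nonneg_ae ((ae_pos_expMeasure hr).mono fun w hw => hw.le)
    measurable_id.aestronglyMeasurable, lintegral_id_expMeasure hr,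
    ENNReal.toReal_ofReal (inv_nonneg.2 hr.le)]

theorem integrable_sq_expMeasure (hr : 0 < r) : Integrable (fun w : ℝ => w ^ 2) (expMeasure r) := by
  have h := lintegral_expMeasure_compensator hr (f := ENNReal.ofReal) ENNReal.measurable_ofReal
  have h2 : ∀ᵐ w ∂(expMeasure r), ENNReal.ofReal r * ∫⁻ u in Set.Ioc 0 w, ENNReal.ofReal u =
      ENNReal.ofReal (r / 2) * ENNReal.ofReal (w ^ 2) := by
    filter_upwards [ae_pos_expMeasure hr] with w hw
    rw [← ofReal_integral_eq_lintegral_ofReal, ← intervalIntegral.integral_of_le hw.le, integral_id,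
      ← ENNReal.ofReal_mul hr.le, ← ENNReal.ofReal_mul (by positivity)]
    · congr 1; ring
    · exact (intervalIntegral.intervalIntegrable_id).1
    · exact (ae_restrict_mem measurableSet_Ioc).mono fun u hu => hu.1.le
  rw [lintegral_congr_ae h2, lintegral_id_expMeasure hr, lintegral_const_mul _ (by fun_prop)] at h
  refine ⟨(measurable_id.pow_const 2).aestronglyMeasurable, ?_⟩
  rw [hasFiniteIntegral_iff_ofReal (Eventually.of_forall fun w => sq_nonneg w)]
  refine lt_top_iff_ne_top.2 fun htop => ?_
  rw [htop, ENNReal.mul_top (by simpa using hr)] at h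
  exact ENNReal.ofReal_ne_top h

theorem abs_integral_Ioc_le {f : ℝ → ℝ} {C w : ℝ} (hC : ∀ u, |f u| ≤ C) (hw : 0 ≤ w) :
    |∫ u in (0 : ℝ)..w, f u| ≤ C * w := by
  have := intervalIntegral.norm_integral_le_of_norm_le_const (f := f) (a := 0) (b := w) (C := C)
    fun u _ => hC u
  simpa [abs_of_nonneg hw] using this

theorem intervalIntegrable_of_bounded {f : ℝ → ℝ} (hf : Measurable f) {C : ℝ}
    (hC : ∀ u, |f u| ≤ C) (a b : ℝ) : IntervalIntegrable f volume a b :=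
  (intervalIntegrable_const (c := C)).mono_fun hf.aestronglyMeasurable
    (Eventually.of_forall fun u => (hC u).trans (le_abs_self C))

theorem measurable_integral_Ioc {f : ℝ → ℝ} (hf : Measurable f) {C : ℝ} (hC : ∀ u, |f u| ≤ C) :
    Measurable fun w => ∫ u in (0 : ℝ)..w, f u :=
  (intervalIntegral.continuous_primitive (intervalIntegrable_of_bounded hf hC) 0).measurable

theorem integrable_compensator (hr : 0 < r) {f : ℝ → ℝ} (hf : Measurable f) {C : ℝ}
    (hC : ∀ u, |f u| ≤ C) :
    Integrable (fun w => ∫ u in (0 : ℝ)..w, f u) (expMeasure r) := by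
  refine ((integrable_id_expMeasure hr).const_mul C).mono'
    (measurable_integral_Ioc hf hC).aestronglyMeasurable ?_
  filter_upwards [ae_pos_expMeasure hr] with w hw using abs_integral_Ioc_le hC hw.le

theorem integral_expMeasure_compensator (hr : 0 < r) {f : ℝ → ℝ} (hf : Measurable f) {C : ℝ}
    (hC : ∀ u, |f u| ≤ C) :
    ∫ w, (f w - r * ∫ u in (0 : ℝ)..w, f u) ∂(expMeasure r) = 0 := by
  have := isProbabilityMeasure_expMeasure hr
  have hint : ∀ {g : ℝ → ℝ}, Measurable g → ∀ {K : ℝ}, (∀ u, |g u| ≤ K) →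
      Integrable g (expMeasure r) := fun {g} hg {K} hK =>
    (integrable_const K).mono' hg.aestronglyMeasurable (Eventually.of_forall hK)
  have hsplit : ∀ {g : ℝ → ℝ}, Measurable g → ∀ {K : ℝ}, (∀ u, |g u| ≤ K) →
      ∫ w, (g w - r * ∫ u in (0 : ℝ)..w, g u) ∂(expMeasure r) =
        ∫ w, g w ∂(expMeasure r) - ∫ w, (r * ∫ u in (0 : ℝ)..w, g u) ∂(expMeasure r) :=
    fun {g} hg {K} hK => integral_sub (hint hg hK) ((integrable_compensator hr hg hK).const_mul r)
  -- for nonnegative functions this is the identity between lower integrals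
  have hpos : ∀ g : ℝ → ℝ, Measurable g → ∀ K : ℝ, (∀ u, |g u| ≤ K) → (∀ u, 0 ≤ g u) →
      ∫ w, (g w - r * ∫ u in (0 : ℝ)..w, g u) ∂(expMeasure r) = 0 := by
    intro g hg K hK h0
    rw [hsplit hg hK, sub_eq_zero, integral_eq_lintegral_of_nonneg_ae (Eventually.of_forall h0)
      hg.aestronglyMeasurable, integral_eq_lintegral_of_nonneg_ae,
      lintegral_expMeasure_compensator hr hg.ennreal_ofReal]
    · congr 1
      refine lintegral_congr_ae ?_
      filter_upwards [ae_pos_expMeasure hr] with w hw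
      rw [ENNReal.ofReal_mul hr.le, intervalIntegral.integral_of_le hw.le,
        ofReal_integral_eq_lintegral_ofReal]
      · exact (intervalIntegrable_of_bounded hg hK 0 w).1
      · exact Eventually.of_forall h0
    · filter_upwards [ae_pos_expMeasure hr] with w hw
      exact mul_nonneg hr.le (intervalIntegral.integral_nonneg hw.le fun u _ => h0 u)
    · exact ((measurable_integral_Ioc hg hK).const_mul r).aestronglyMeasurable
  have h1 := hpos (fun u => f u + C) (hf.add_const C) (C + |C|)
    (fun u => (abs_add_le _ _).trans (add_le_add_left (hC u) _))
    (fun u => by linarith [(abs_le.1 (hC u)).1])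
  have h2 := hpos (fun _ => C) measurable_const |C| (fun u => le_rfl)
    (fun u => (abs_nonneg _).trans (hC u))
  have h3 := integral_sub
    ((hint (hf.add_const C) (K := C + |C|)
      (fun u => (abs_add_le _ _).trans (add_le_add_left (hC u) _))).sub
      ((integrable_compensator hr (hf.add_const C) (C := C + |C|)
        (fun u => (abs_add_le _ _).trans (add_le_add_left (hC u) _))).const_mul r))
    ((hint measurable_const (fun _ : ℝ => le_refl |C|)).sub
      ((integrable_compensator hr measurable_const (fun _ : ℝ => le_refl |C|)).const_mul r))
  simp only [Pi.sub_apply] at h3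
  rw [h1, h2, sub_zero] at h3
  refine Eq.trans (integral_congr_ae (Eventually.of_forall fun w => ?_)) h3
  simp only
  rw [intervalIntegral.integral_add (intervalIntegrable_of_bounded hf hC 0 w)
    intervalIntegrable_const]
  ring

end Exponential

theorem measurable_update_prod {ι : Type*} [DecidableEq ι] (p : ι) :
    Measurable fun q : (ι → ℝ) × ℝ => Function.update q.1 p q.2 := by
  refine measurable_pi_lambda _ fun i => ?_
  by_cases h : i = p
  · subst h; simpa using measurable_snd (α := ι → ℝ) (β := ℝ)
  · simp only [Function.update_of_ne h]
    exact (measurable_pi_apply i).comp measurable_fst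

/-- Resampling one coordinate of a product measure does not change the measure. -/
theorem map_update_infinitePi {ι : Type*} [DecidableEq ι] (m : ι → Measure ℝ)
    [∀ i, IsProbabilityMeasure (m i)] (p : ι) :
    ((Measure.infinitePi m).prod (m p)).map (fun q => Function.update q.1 p q.2) =
      Measure.infinitePi m := by
  refine Measure.eq_infinitePi m fun s t ht => ?_
  rw [Measure.map_apply (measurable_update_prod p)
    (MeasurableSet.pi s.countable_toSet fun i _ => ht i)]
  by_cases hp : p ∈ s
  · have : (fun q : (ι → ℝ) × ℝ => Function.update q.1 p q.2) ⁻¹' (s : Set ι).pi t =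
        ((s.erase p : Finset ι) : Set ι).pi t ×ˢ t p := by
      ext q
      simp only [Set.mem_preimage, Set.mem_pi, Set.mem_prod, Finset.mem_coe, Finset.mem_erase]
      constructor
      · exact fun h => ⟨fun i hi => by simpa [Function.update_of_ne hi.1] using h i hi.2,
          by simpa using h p hp⟩
      · intro h i hi
        by_cases hip : i = p
        · subst hip; simpa using h.2
        · simpa [Function.update_of_ne hip] using h.1 i ⟨hip, hi⟩
    rw [this, Measure.prod_prod, Measure.infinitePi_pi _ fun i _ => ht i, Finset.prod_erase_mul _ _ hp]
  · have : (fun q : (ι → ℝ) × ℝ => Function.update q.1 p q.2) ⁻¹' (s : Set ι).pi t =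
        (s : Set ι).pi t ×ˢ Set.univ := by
      ext q
      simp only [Set.mem_preimage, Set.mem_pi, Set.mem_prod, Finset.mem_coe, Set.mem_univ, and_true]
      refine forall₂_congr fun i hi => ?_
      rw [Function.update_of_ne fun h => hp (by rwa [h] at hi)]
    rw [this, Measure.prod_prod, Measure.infinitePi_pi _ fun i _ => ht i, measure_univ, mul_one]

/-- The joint law of the waiting times: independent and exponential with rate `r`. -/
def waitingLaw (r : ℝ) : Measure (Fin 2 × ℕ → ℝ) := Measure.infinitePi fun _ => expMeasure r

section Waiting

variable {r : ℝ} [hr : Fact (0 < r)]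

instance : IsProbabilityMeasure (expMeasure r) := isProbabilityMeasure_expMeasure hr.out

instance : IsProbabilityMeasure (waitingLaw r) :=
  inferInstanceAs (IsProbabilityMeasure (Measure.infinitePi fun _ => expMeasure r))

theorem map_update_waitingLaw (p : Fin 2 × ℕ) :
    ((waitingLaw r).prod (expMeasure r)).map (fun q => Function.update q.1 p q.2) = waitingLaw r :=
  map_update_infinitePi (fun _ => expMeasure r) p

theorem lintegral_waitingLaw_update (p : Fin 2 × ℕ) {f : (Fin 2 × ℕ → ℝ) → ℝ≥0∞}
    (hf : Measurable f) : ∫⁻ τ, f τ ∂(waitingLaw r) =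
      ∫⁻ τ, ∫⁻ w, f (Function.update τ p w) ∂(expMeasure r) ∂(waitingLaw r) := by
  conv_lhs => rw [← map_update_waitingLaw p]
  rw [lintegral_map hf (measurable_update_prod p),
    lintegral_prod (fun q : (Fin 2 × ℕ → ℝ) × ℝ => f (Function.update q.1 p q.2))
      (hf.comp (measurable_update_prod p)).aemeasurable]

theorem integral_waitingLaw_update (p : Fin 2 × ℕ) {f : (Fin 2 × ℕ → ℝ) → ℝ}
    (hf : Measurable f) (hi : Integrable f (waitingLaw r)) : ∫ τ, f τ ∂(waitingLaw r) =
      ∫ τ, ∫ w, f (Function.update τ p w) ∂(expMeasure r) ∂(waitingLaw r) := by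
  conv_lhs => rw [← map_update_waitingLaw p]
  rw [← map_update_waitingLaw p] at hi
  rw [integral_map (measurable_update_prod p).aemeasurable hf.aestronglyMeasurable,
    integral_prod (fun q : (Fin 2 × ℕ → ℝ) × ℝ => f (Function.update q.1 p q.2)) ((integrable_map_measure hf.aestronglyMeasurable
      (measurable_update_prod p).aemeasurable).1 hi)]

/-- An event has full probability if it does so for every value of all waiting times but one. -/
theorem ae_waitingLaw_of_update (p : Fin 2 × ℕ) {q : (Fin 2 × ℕ → ℝ) → Prop}
    (hq : MeasurableSet {τ | q τ})
    (h : ∀ τ, ∀ᵐ w ∂(expMeasure r), q (Function.update τ p w)) : ∀ᵐ τ ∂(waitingLaw r), q τ := by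
  rw [← map_update_waitingLaw p, ae_map_iff (measurable_update_prod p).aemeasurable hq,
    Measure.ae_prod_iff_ae_ae (p := fun z : (Fin 2 × ℕ → ℝ) × ℝ => q (Function.update z.1 p z.2))
      (measurable_update_prod p hq)]
  exact Eventually.of_forall h

theorem ae_waitingLaw_apply (p : Fin 2 × ℕ) {q : ℝ → Prop} (h : ∀ᵐ w ∂(expMeasure r), q w) :
    ∀ᵐ τ ∂(waitingLaw r), q (τ p) :=
  (measurePreserving_eval_infinitePi (fun _ => expMeasure r) p).quasiMeasurePreserving.ae h

theorem ae_tendsto_arrival_div (j : Fin 2) : ∀ᵐ τ ∂(waitingLaw r),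
    Tendsto (fun n : ℕ => arrival τ j n / n) atTop (𝓝 r⁻¹) := by
  have hmp := fun k => measurePreserving_eval_infinitePi (fun _ : Fin 2 × ℕ => expMeasure r) (j, k)
  have hind : iIndepFun (fun p (τ : Fin 2 × ℕ → ℝ) => τ p) (waitingLaw r) :=
    iIndepFun_infinitePi (P := fun _ : Fin 2 × ℕ => expMeasure r) (X := fun _ x => x)
      fun _ => measurable_id
  have h := strong_law_ae_real (μ := waitingLaw r) (fun k τ => τ (j, k))
    ((hmp 0).integrable_comp_of_integrable (integrable_id_expMeasure hr.out))
    (fun k l hkl => hind.indepFun (by simpa using hkl))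
    (fun k => ⟨(measurable_pi_apply _).aemeasurable, (measurable_pi_apply _).aemeasurable,
      (hmp k).map_eq.trans (hmp 0).map_eq.symm⟩)
  have hmean : ∫ τ, τ (j, 0) ∂(waitingLaw r) = r⁻¹ := by
    have h1 := integral_map (μ := waitingLaw r) (φ := fun τ => τ (j, 0)) (f := fun w : ℝ => w)
      (measurable_pi_apply _).aemeasurable measurable_id.aestronglyMeasurable
    rw [← h1, ← integral_id_expMeasure hr.out]
    exact congrArg (fun m => ∫ w, w ∂m) (hmp 0).map_eq
  rw [hmean] at h
  exact h

theorem ae_good : ∀ᵐ τ ∂(waitingLaw r), Good τ := by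
  have h1 : ∀ᵐ τ ∂(waitingLaw r), ∀ p, 0 < τ p :=
    ae_all_iff.2 fun p => ae_waitingLaw_apply p (ae_pos_expMeasure hr.out)
  have h2 : ∀ᵐ τ ∂(waitingLaw r), ∀ j, Tendsto (fun n : ℕ => arrival τ j n / n) atTop (𝓝 r⁻¹) :=
    ae_all_iff.2 ae_tendsto_arrival_div
  filter_upwards [h1, h2] with τ h1 h2
  refine ⟨h1, fun j => ?_⟩
  refine ((h2 j).pos_mul_atTop (inv_pos.2 hr.out) tendsto_natCast_atTop_atTop).congr' ?_
  filter_upwards [eventually_gt_atTop 0] with n hn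
  have : (n : ℝ) ≠ 0 := by positivity
  field_simp

theorem arrival_update_self (τ : Fin 2 × ℕ → ℝ) (j : Fin 2) {k n : ℕ} (hn : n ≤ k) (w : ℝ) :
    arrival (Function.update τ (j, k) w) j n = arrival τ j n := by
  refine Finset.sum_congr rfl fun l hl => Function.update_of_ne ?_ _ _
  have := Finset.mem_range.1 hl
  simp only [ne_eq, Prod.mk.injEq, true_and]
  omega

theorem arrival_update_of_ne (τ : Fin 2 × ℕ → ℝ) {i j : Fin 2} (hij : i ≠ j) (k n : ℕ) (w : ℝ) :
    arrival (Function.update τ (j, k) w) i n = arrival τ i n := by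
  refine Finset.sum_congr rfl fun l _ => Function.update_of_ne ?_ _ _
  simp [hij]

/-- Almost surely the walkers never reverse at the same time. -/
theorem ae_ne_arrival : ∀ᵐ τ ∂(waitingLaw r), ∀ k l, arrival τ 0 (k + 1) ≠ arrival τ 1 (l + 1) := by
  refine ae_all_iff.2 fun k => ae_all_iff.2 fun l => ae_waitingLaw_of_update (0, k)
    (measurableSet_eq_fun (measurable_arrival 0 _) (measurable_arrival 1 _)).compl fun τ => ?_
  filter_upwards [Measure.ae_ne (expMeasure r) (arrival τ 1 (l + 1) - arrival τ 0 k)] with w hw h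
  rw [arrival_succ, arrival_update_self _ _ le_rfl, arrival_update_of_ne _ (by simp),
    Function.update_self] at h
  exact hw (by linarith)

end Waiting

/-! ### Jumps of the process and their compensator -/

theorem Fin.eq_add_one_of_ne {i j : Fin 2} (h : i ≠ j) : i = j + 1 := by
  fin_cases i <;> fin_cases j <;> simp_all

theorem sum_fin_two_add_one {M : Type*} [AddCommMonoid M] (f : Fin 2 → M) (j : Fin 2) :
    ∑ i, f i = f j + f (j + 1) := by
  fin_cases j <;> simp [add_comm]

section Updates

variable {τ : Fin 2 × ℕ → ℝ} {j : Fin 2} {k : ℕ}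

theorem Good.update (h : Good τ) {w : ℝ} (hw : 0 < w) : Good (Function.update τ (j, k) w) := by
  refine ⟨fun p => ?_, fun i => ?_⟩
  · by_cases hp : p = (j, k)
    · subst hp; simpa using hw
    · rw [Function.update_of_ne hp]; exact h.pos p
  · by_cases hi : i = j
    · subst hi
      refine tendsto_atTop_mono' atTop ?_
        (tendsto_atTop_add_const_right atTop (w - τ (i, k)) (h.div i))
      filter_upwards [eventually_gt_atTop k] with n hn
      have hk : k ∈ Finset.range n := Finset.mem_range.2 hn
      rw [arrival, arrival, ← Finset.add_sum_erase _ _ hk, ← Finset.add_sum_erase _ (fun l =>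
        Function.update τ (i, k) w (i, l)) hk, Function.update_self]
      have : ∑ l ∈ (Finset.range n).erase k, Function.update τ (i, k) w (i, l) =
          ∑ l ∈ (Finset.range n).erase k, τ (i, l) := by
        refine Finset.sum_congr rfl fun l hl => Function.update_of_ne ?_ _ _
        have := Finset.ne_of_mem_erase hl
        simpa using this
      rw [this]
      linarith
    · refine (h.div i).congr fun n => (arrival_update_of_ne τ hi k n w).symm

theorem count_update_of_ne {i : Fin 2} (hij : i ≠ j) (w s : ℝ) :
    reversalCount (Function.update τ (j, k) w) i s = reversalCount τ i s := by
  simp only [reversalCount, reversalTime_eq, arrival_update_of_ne τ hij]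

theorem Good.count_update (h : Good τ) {w s : ℝ} (hw : 0 < w) (hs : 0 ≤ s)
    (h1 : s < arrival τ j (k + 1)) (h2 : s < arrival τ j k + w) (i : Fin 2) :
    reversalCount (Function.update τ (j, k) w) i s = reversalCount τ i s := by
  by_cases hi : i = j
  · subst hi
    have hc := h.count_spec i hs
    have hk : reversalCount τ i s ≤ k :=
      Nat.lt_succ_iff.1 ((h.strictMono i).lt_iff_lt.1 (hc.1.trans_lt h1))
    refine (h.update hw).count_eq ?_ ?_
    · rw [arrival_update_self τ i hk]; exact hc.1
    · rcases hk.lt_or_eq with hk | hk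
      · rw [arrival_update_self τ i hk]; exact hc.2
      · rw [hk, arrival_succ, arrival_update_self τ i le_rfl, Function.update_self]; exact h2
  · exact count_update_of_ne hi w s

end Updates

section Circle

variable {N v : ℝ} [hN : Fact (0 < N)] {τ : Fin 2 × ℕ → ℝ} {φ : State N} {j : Fin 2} {k : ℕ}

/-- The state at time `u` after the `k`-th reversal of walker `j`, if that walker does not reverse
again until then. At the end of the waiting time `τ (j, k)` it is the left limit of the process. It
does not depend on `τ (j, k)`, which is replaced by `u + 1`; any value above `u` would give the same. -/
def preJump (v : ℝ) (τ : Fin 2 × ℕ → ℝ) (φ : State N) (j : Fin 2) (k : ℕ) (u : ℝ) : State N :=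
  jumpProcess v (Function.update τ (j, k) (u + 1)) φ (arrival τ j k + u)

theorem preJump_update (w u : ℝ) :
    preJump v (Function.update τ (j, k) w) φ j k u = preJump v τ φ j k u := by
  rw [preJump, preJump, Function.update_idem, arrival_update_self _ _ le_rfl]

theorem measurable_preJump {α : Type*} [MeasurableSpace α] {T : α → Fin 2 × ℕ → ℝ}
    {Φ : α → State N} {u : α → ℝ} (hT : Measurable T) (hΦ : Measurable Φ) (hu : Measurable u) :
    Measurable fun a => preJump v (T a) (Φ a) j k (u a) := by
  refine measurable_jumpProcess ?_ hΦ ?_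
  · exact Measurable.comp (f := fun a => (T a, u a + 1)) (measurable_update_prod (j, k))
      (hT.prodMk (hu.add_const 1))
  · exact ((measurable_arrival j k).comp hT).add hu

theorem preJump_eq (hv : 0 < v) (h : Good τ) {u : ℝ} (hu : 0 ≤ u) (hu' : u < τ (j, k)) :
    preJump v τ φ j k u = jumpProcess v τ φ (arrival τ j k + u) := by
  have h0 : 0 ≤ arrival τ j k + u := add_nonneg (h.arrival_nonneg j k) hu
  rw [preJump, ← process_eq_jumpProcess hv (h.update (by linarith)) h0,
    ← process_eq_jumpProcess hv h h0]
  refine process_congr h0 fun s hs hs' => direction_congr fun i =>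
    h.count_update (by linarith) hs ?_ (by linarith) i
  rw [arrival_succ]; linarith

/-- The `(k+1)`-st reversal of walker `j`, seen from a time `a` such that no walker reverses
between. -/
theorem process_jump (hv : 0 < v) (h : Good τ) {a : ℝ} (ha : 0 ≤ a)
    (haT : a < arrival τ j (k + 1)) (hj : reversalCount τ j a = k)
    (hi : ∀ i, i ≠ j → reversalCount τ i a = reversalCount τ i (arrival τ j (k + 1))) :
    process v τ φ (arrival τ j (k + 1)) = step v (arrival τ j (k + 1) - a) (process v τ φ a)
        (Function.update (process v τ φ a).dir j (-(process v τ φ a).dir j)) ∧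
    preJump v τ φ j k (τ (j, k)) = flow v (arrival τ j (k + 1) - a) (process v τ φ a) := by
  have hT := h.arrival_nonneg j (k + 1)
  have hAk : arrival τ j k ≤ a := hj ▸ (h.count_spec j ha).1
  have hjT : reversalCount τ j (arrival τ j (k + 1)) = k + 1 :=
    h.count_eq le_rfl (h.strictMono j (Nat.lt_succ_self _))
  have hi' : ∀ i, i ≠ j → ∀ s, a ≤ s → s ≤ arrival τ j (k + 1) →
      reversalCount τ i s = reversalCount τ i a := fun i hij s h1 h2 =>
    le_antisymm ((h.count_mono (ha.trans h1) h2).trans (hi i hij).ge) (h.count_mono ha h1)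
  have hdir : direction τ φ.dir (arrival τ j (k + 1)) =
      Function.update (direction τ φ.dir a) j (-direction τ φ.dir a j) := by
    ext i
    by_cases hij : i = j
    · subst hij; simp [direction, hjT, hj, pow_succ]
    · rw [Function.update_of_ne hij]; simp [direction, hi i hij]
  constructor
  · rw [process_eq_step hv ha haT.le fun s h1 h2 => direction_congr fun i => ?_, process_dir ha, hdir]
    by_cases hij : i = j
    · subst hij
      rw [hj]; exact h.count_eq (hAk.trans h1) h2
    · exact hi' i hij s h1 h2.le
  · have hw : 0 < τ (j, k) + 1 := by linarith [h.pos (j, k)]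
    have hg : Good (Function.update τ (j, k) (τ (j, k) + 1)) := h.update hw
    have hlt : arrival τ j (k + 1) < arrival τ j k + (τ (j, k) + 1) := by
      rw [arrival_succ]; linarith
    rw [preJump, ← arrival_succ, ← process_eq_jumpProcess hv hg hT]
    have hcount : ∀ s, a ≤ s → s ≤ arrival τ j (k + 1) → ∀ i,
        reversalCount (Function.update τ (j, k) (τ (j, k) + 1)) i s = reversalCount τ i a := by
      intro s h1 h2 i
      by_cases hij : i = j
      · subst hij
        rw [hj]
        refine hg.count_eq ?_ ?_
        · rw [arrival_update_self _ _ le_rfl]; exact hAk.trans h1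
        · rw [arrival_succ, arrival_update_self _ _ le_rfl, Function.update_self]
          exact h2.trans_lt hlt
      · rw [count_update_of_ne hij, hi' i hij s h1 h2]
    rw [process_eq_flow hv ha haT.le fun s h1 h2 => direction_congr fun i =>
      (hcount s h1 h2 i).trans (hcount a le_rfl haT.le i).symm]
    congr 1
    exact process_congr ha fun s hs hs' => direction_congr fun i =>
      h.count_update hw hs (hs'.trans_lt haT) ((hs'.trans_lt haT).trans hlt) i

/-- A function on the states that does not see the carrier when the walkers are at the same
place. If the walkers meet at the very moment at which one of them reverses, the carrier after the
reversal is not a function of the state at the end of the free motion; the functions in this class do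
not notice (`CarrierFree.step`). -/
def CarrierFree {β : Type*} (K : State N → β) : Prop :=
  ∀ φ ψ : State N, φ.pos = ψ.pos → φ.dir = ψ.dir → φ.pos 0 = φ.pos 1 → K φ = K ψ

theorem CarrierFree.step {β : Type*} {K : State N → β} (hK : CarrierFree K) (u : ℝ) (ψ : State N) :
    K (step v u ψ (Function.update ψ.dir j (-ψ.dir j))) = K (flip j (flow v u ψ)) := by
  by_cases hx : moved v ψ.pos ψ.dir u 0 = moved v ψ.pos ψ.dir u 1
  · exact hK _ _ rfl rfl hx
  · congr 1
    have : ¬ Encounter (moved v ψ.pos ψ.dir u) ψ.dir := fun h => hx h.1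
    rw [flip, flow_pos, flow_dir, flow, TwoWalkers.step, TwoWalkers.step,
      mkState_carrier_of_not _ this]

theorem CarrierFree.flow {β : Type*} {K : State N → β} (hK : CarrierFree K) (u : ℝ) :
    CarrierFree fun ψ => K (flow v u ψ) := by
  intro φ ψ hx hd h0
  by_cases hne : φ.dir 0 = φ.dir 1
  · refine hK _ _ (by simp [hx, hd]) (by simp [hd]) ?_
    simp [moved, hne, h0]
  · have h1 : Encounter φ.pos φ.dir := ⟨h0, hne⟩
    have : φ = ψ := State.ext' hx hd (by
      rw [State.carrier_eq_of_encounter h1, State.carrier_eq_of_encounter (hx ▸ hd ▸ h1), hd])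
    rw [this]

theorem CarrierFree.flip {β : Type*} {K : State N → β} (hK : CarrierFree K) (j : Fin 2) :
    CarrierFree fun ψ => K (flip j ψ) := by
  intro φ ψ hx hd h0
  exact hK _ _ hx (by simp [TwoWalkers.flip, hd]) h0

/-- A function of time that is constant between the reversals is the sum of its jumps: `J j k` is the
jump at the `(k+1)`-st reversal of walker `j`, and only the times up to `T` matter. -/
theorem sub_eq_sum_jumps (h : Good τ) (hne : ∀ k l, arrival τ 0 (k + 1) ≠ arrival τ 1 (l + 1))
    {y : ℝ → ℝ} {J : Fin 2 → ℕ → ℝ} {T : ℝ}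
    (h1 : ∀ a b, 0 ≤ a → a ≤ b → b ≤ T → (∀ i, reversalCount τ i a = reversalCount τ i b) →
      y b = y a)
    (h2 : ∀ j k a, 0 ≤ a → a < arrival τ j (k + 1) → arrival τ j (k + 1) ≤ T →
      reversalCount τ j a = k →
      (∀ i, i ≠ j → reversalCount τ i a = reversalCount τ i (arrival τ j (k + 1))) →
      y (arrival τ j (k + 1)) - y a = J j k) {t : ℝ} (ht : 0 ≤ t) (htT : t ≤ T) :
    y t - y 0 = ∑ j, ∑ k ∈ Finset.range (reversalCount τ j t), J j k := by
  induction hn : reversalCount τ 0 t + reversalCount τ 1 t using Nat.strong_induction_on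
    generalizing t with
  | _ n ih =>
  by_cases hz : ∀ i, reversalCount τ i t = 0
  · rw [h1 0 t le_rfl ht htT fun i => by rw [h.count_zero, hz]]
    simp [hz]
  -- the walker that reverses last
  obtain ⟨j, hj, hlast⟩ : ∃ j, reversalCount τ j t ≠ 0 ∧
      arrival τ (j + 1) (reversalCount τ (j + 1) t) < arrival τ j (reversalCount τ j t) := by
    by_cases h0 : reversalCount τ 0 t = 0
    · have h0' : reversalCount τ 1 t ≠ 0 := fun h' => hz fun i => by fin_cases i <;> assumption
      refine ⟨1, h0', ?_⟩
      change arrival τ 0 (reversalCount τ 0 t) < _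
      rw [h0, arrival_zero]
      simpa using h.strictMono 1 (Nat.pos_of_ne_zero h0')
    by_cases h0' : reversalCount τ 1 t = 0
    · refine ⟨0, h0, ?_⟩
      change arrival τ 1 (reversalCount τ 1 t) < _
      rw [h0', arrival_zero]
      simpa using h.strictMono 0 (Nat.pos_of_ne_zero h0)
    obtain ⟨k, hk⟩ := Nat.exists_eq_succ_of_ne_zero h0
    obtain ⟨l, hl⟩ := Nat.exists_eq_succ_of_ne_zero h0'
    rcases lt_or_gt_of_ne (hne k l) with hlt | hlt
    · exact ⟨1, h0', by change arrival τ 0 (reversalCount τ 0 t) < _; rwa [hk, hl]⟩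
    · exact ⟨0, h0, by change arrival τ 1 (reversalCount τ 1 t) < _; rwa [hk, hl]⟩
  obtain ⟨k, hk⟩ := Nat.exists_eq_succ_of_ne_zero hj
  have htj := h.count_spec j ht
  have hti := h.count_spec (j + 1) ht
  rw [hk, Nat.succ_eq_add_one] at hlast htj
  have hij : ∀ i, i ≠ j → i = j + 1 := fun i => Fin.eq_add_one_of_ne
  set s := arrival τ j (k + 1)
  have hs0 : 0 ≤ s := h.arrival_nonneg j (k + 1)
  set a := max (arrival τ j k) (arrival τ (j + 1) (reversalCount τ (j + 1) t)) with ha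
  have ha0 : 0 ≤ a := (h.arrival_nonneg j k).trans (le_max_left _ _)
  have has : a < s := max_lt (h.strictMono j (Nat.lt_succ_self k)) hlast
  have hat : a ≤ t := has.le.trans htj.1
  have hja : reversalCount τ j a = k := h.count_eq (le_max_left _ _) has
  have hia : reversalCount τ (j + 1) a = reversalCount τ (j + 1) t :=
    h.count_eq (le_max_right _ _) (hat.trans_lt hti.2)
  have his : reversalCount τ (j + 1) s = reversalCount τ (j + 1) t :=
    h.count_eq hlast.le (htj.1.trans_lt hti.2)
  have hjs : reversalCount τ j s = k + 1 := h.count_eq le_rfl (h.strictMono j (Nat.lt_succ_self _))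
  have e1 := h1 s t hs0 htj.1 htT fun i => by
    by_cases hi : i = j
    · rw [hi, hjs, hk]
    · rw [hij i hi, his]
  have e2 := h2 j k a ha0 has (htj.1.trans htT) hja fun i hi => by rw [hij i hi, hia, his]
  have hsum := sum_fin_two_add_one (fun i => reversalCount τ i t) j
  have hsum' := sum_fin_two_add_one (fun i => reversalCount τ i a) j
  simp only [Fin.sum_univ_two] at hsum hsum'
  have e3 := ih _ (by omega) ha0 (hat.trans htT) rfl
  rw [sum_fin_two_add_one _ j] at e3 ⊢
  rw [hja, hia] at e3
  rw [hk, Nat.succ_eq_add_one, Finset.sum_range_succ]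
  linarith

end Circle

/-! ### Expectations of sums over the jumps -/

section Compensation

variable {N v r : ℝ} [hN : Fact (0 < N)] [hr : Fact (0 < r)]

theorem setLIntegral_Ioc_add {f : ℝ → ℝ≥0∞} (hf : Measurable f) (a w : ℝ) :
    ∫⁻ s in Set.Ioc a (a + w), f s = ∫⁻ u in Set.Ioc 0 w, f (a + u) := by
  have h := (measurePreserving_add_left (volume : Measure ℝ) a).setLIntegral_comp_preimage
    (s := Set.Ioc a (a + w)) measurableSet_Ioc hf
  rw [← h]
  simp

/-- At rate `r`, the next reversal of a walker samples the path that precedes it. This is the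
compensator identity of the exponential law, applied to one waiting time with the others fixed. -/
theorem lintegral_preJump (hv : 0 < v) (φ : State N) (j : Fin 2) (k : ℕ) {H : ℝ × State N → ℝ≥0∞}
    (hH : Measurable H) :
    ∫⁻ τ, H (arrival τ j (k + 1), preJump v τ φ j k (τ (j, k))) ∂(waitingLaw r) =
      ∫⁻ τ, (ENNReal.ofReal r * ∫⁻ s in Set.Ioc (arrival τ j k) (arrival τ j (k + 1)),
        H (s, jumpProcess v τ φ s)) ∂(waitingLaw r) := by
  set F : (Fin 2 × ℕ → ℝ) → ℝ → ℝ≥0∞ := fun τ u => H (arrival τ j k + u, preJump v τ φ j k u)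
  have hF : Measurable fun p : (Fin 2 × ℕ → ℝ) × ℝ => F p.1 p.2 :=
    hH.comp ((((measurable_arrival j k).comp measurable_fst).add measurable_snd).prodMk
      (measurable_preJump measurable_fst measurable_const measurable_snd))
  have hFu : ∀ τ w u, F (Function.update τ (j, k) w) u = F τ u := fun τ w u => by
    simp only [F, preJump_update, arrival_update_self τ j le_rfl]
  have hFτ : ∀ τ, Measurable (F τ) := fun τ => hF.comp (measurable_const.prodMk measurable_id)
  have hev : Measurable fun τ : Fin 2 × ℕ → ℝ => τ (j, k) := measurable_pi_apply _
  set G : (Fin 2 × ℕ → ℝ) → ℝ≥0∞ := fun τ =>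
    ENNReal.ofReal r * ∫⁻ u in Set.Ioc 0 (τ (j, k)), F τ u
  have hG : Measurable G := by
    refine Measurable.const_mul ?_ _
    simp_rw [← lintegral_indicator measurableSet_Ioc]
    have hS : MeasurableSet {p : (Fin 2 × ℕ → ℝ) × ℝ | p.2 ∈ Set.Ioc 0 (p.1 (j, k))} :=
      (measurableSet_lt measurable_const measurable_snd).inter
        (measurableSet_le measurable_snd (hev.comp measurable_fst))
    exact (hF.indicator hS).lintegral_prod_right'
  calc ∫⁻ τ, H (arrival τ j (k + 1), preJump v τ φ j k (τ (j, k))) ∂(waitingLaw r)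
      = ∫⁻ τ, F τ (τ (j, k)) ∂(waitingLaw r) := by simp only [F, arrival_succ]
    _ = ∫⁻ τ, ∫⁻ w, F τ w ∂(expMeasure r) ∂(waitingLaw r) := by
        rw [lintegral_waitingLaw_update (j, k) (f := fun τ => F τ (τ (j, k)))
          (hF.comp (measurable_id.prodMk hev))]
        simp only [hFu, Function.update_self]
    _ = ∫⁻ τ, ∫⁻ w, G (Function.update τ (j, k) w) ∂(expMeasure r) ∂(waitingLaw r) := by
        refine lintegral_congr fun τ => ?_
        rw [lintegral_expMeasure_compensator hr.out (hFτ τ)]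
        simp only [G, hFu, Function.update_self]
    _ = ∫⁻ τ, G τ ∂(waitingLaw r) := (lintegral_waitingLaw_update (j, k) hG).symm
    _ = _ := by
        refine lintegral_congr_ae ?_
        filter_upwards [ae_good] with τ hτ
        simp only [G]
        rw [arrival_succ, setLIntegral_Ioc_add (f := fun s => H (s, jumpProcess v τ φ s))
          (hH.comp (measurable_id.prodMk
            (measurable_jumpProcess measurable_const measurable_const measurable_id)))]
        congr 1
        refine setLIntegral_congr_fun_ae measurableSet_Ioc ?_
        filter_upwards [Measure.ae_ne volume (τ (j, k))] with u hu hmem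
        simp only [F]
        rw [preJump_eq hv hτ hmem.1.le (hmem.2.lt_of_ne hu)]

theorem lintegral_tsum_preJump (hv : 0 < v) (φ : State N) (j : Fin 2) {H : ℝ × State N → ℝ≥0∞}
    (hH : Measurable H) :
    ∫⁻ τ, ∑' k, H (arrival τ j (k + 1), preJump v τ φ j k (τ (j, k))) ∂(waitingLaw r) =
      ENNReal.ofReal r *
        ∫⁻ τ, (∫⁻ s in Set.Ioi 0, H (s, jumpProcess v τ φ s)) ∂(waitingLaw r) := by
  have hm : Measurable fun p : (Fin 2 × ℕ → ℝ) × ℝ => H (p.2, jumpProcess v p.1 φ p.2) :=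
    hH.comp (measurable_snd.prodMk
      (measurable_jumpProcess measurable_fst measurable_const measurable_snd))
  have hmk : ∀ k, Measurable fun τ : Fin 2 × ℕ → ℝ =>
      ∫⁻ s in Set.Ioc (arrival τ j k) (arrival τ j (k + 1)), H (s, jumpProcess v τ φ s) := fun k => by
    simp_rw [← lintegral_indicator measurableSet_Ioc]
    have hS : MeasurableSet {p : (Fin 2 × ℕ → ℝ) × ℝ |
        p.2 ∈ Set.Ioc (arrival p.1 j k) (arrival p.1 j (k + 1))} :=
      (measurableSet_lt ((measurable_arrival j k).comp measurable_fst) measurable_snd).inter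
        (measurableSet_le measurable_snd ((measurable_arrival j (k + 1)).comp measurable_fst))
    exact (hm.indicator hS).lintegral_prod_right'
  rw [lintegral_tsum fun k => ?_]
  · simp_rw [lintegral_preJump hv φ j _ hH, lintegral_const_mul _ (hmk _)]
    rw [ENNReal.tsum_mul_left, ← lintegral_tsum fun k => (hmk k).aemeasurable]
    congr 1
    refine lintegral_congr_ae ?_
    filter_upwards [ae_good] with τ hτ
    rw [← lintegral_iUnion (fun k => measurableSet_Ioc)
      (by simpa using (hτ.strictMono j).monotone.pairwise_disjoint_on_Ioc_succ)]
    have := iUnion_Ioc_map_succ_eq_Ioi (f := arrival τ j) (fun k => (hτ.arrival_nonneg j k).trans_eq' (by simp))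
      (not_bddAbove_of_tendsto_atTop (hτ.div j))
    simp only [Nat.succ_eq_succ, Nat.succ_eq_add_one, Nat.bot_eq_zero, arrival_zero] at this
    rw [this]
  · exact (hH.comp ((measurable_arrival j (k + 1)).prodMk (measurable_preJump measurable_id
      measurable_const (measurable_pi_apply _)))).aemeasurable

/-- The sum of `H` over the reversals of walker `j` in `(0, t]`, evaluated at the time of the
reversal and the state before it. -/
def jumpSum (v : ℝ) (H : ℝ × State N → ℝ) (φ : State N) (j : Fin 2) (t : ℝ) (τ : Fin 2 × ℕ → ℝ) :
    ℝ :=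
  ∑ k ∈ Finset.range (reversalCount τ j t), H (arrival τ j (k + 1), preJump v τ φ j k (τ (j, k)))

/-- The integral of `H` along the process. -/
def timeIntegral (v : ℝ) (H : ℝ × State N → ℝ) (φ : State N) (t : ℝ) (τ : Fin 2 × ℕ → ℝ) : ℝ :=
  ∫ s in (0 : ℝ)..t, H (s, jumpProcess v τ φ s)

theorem abs_timeIntegral_le {H : ℝ × State N → ℝ} {C t : ℝ} (hC : ∀ p, |H p| ≤ C) (ht : 0 ≤ t)
    (φ : State N) (τ : Fin 2 × ℕ → ℝ) : |timeIntegral v H φ t τ| ≤ C * t :=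
  abs_integral_Ioc_le (fun _ => hC _) ht

theorem measurable_along {H : ℝ × State N → ℝ} (hH : Measurable H) (φ : State N)
    (τ : Fin 2 × ℕ → ℝ) : Measurable fun s => H (s, jumpProcess v τ φ s) :=
  hH.comp (measurable_id.prodMk
    (measurable_jumpProcess measurable_const measurable_const measurable_id))

theorem measurable_timeIntegral {α : Type*} [MeasurableSpace α] {H : ℝ × State N → ℝ}
    (hH : Measurable H) {t : ℝ} (ht : 0 ≤ t) {T : α → Fin 2 × ℕ → ℝ} {Φ : α → State N}
    (hT : Measurable T) (hΦ : Measurable Φ) :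
    Measurable fun a => timeIntegral v H (Φ a) t (T a) := by
  simp only [timeIntegral, intervalIntegral.integral_of_le ht]
  have hm : Measurable fun p : α × ℝ => H (p.2, jumpProcess v (T p.1) (Φ p.1) p.2) :=
    hH.comp (measurable_snd.prodMk (measurable_jumpProcess (hT.comp measurable_fst)
      (hΦ.comp measurable_fst) measurable_snd))
  exact (hm.stronglyMeasurable.integral_prod_right' (ν := volume.restrict (Set.Ioc 0 t))).measurable

theorem integrable_timeIntegral {H : ℝ × State N → ℝ} (hH : Measurable H) {C t : ℝ}
    (hC : ∀ p, |H p| ≤ C) (ht : 0 ≤ t) (φ : State N) :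
    Integrable (timeIntegral v H φ t) (waitingLaw r) :=
  (integrable_const (C * t)).mono'
    (measurable_timeIntegral hH ht measurable_id measurable_const).aestronglyMeasurable
    (Eventually.of_forall fun τ => abs_timeIntegral_le hC ht φ τ)

theorem integral_jumpSum_of_nonneg (hv : 0 < v) (φ : State N) (j : Fin 2) {H : ℝ × State N → ℝ}
    (hH : Measurable H) {C : ℝ} (hC : ∀ p, |H p| ≤ C) (h0 : ∀ p, 0 ≤ H p) {t : ℝ} (ht : 0 ≤ t) :
    Integrable (jumpSum v H φ j t) (waitingLaw r) ∧
      ∫ τ, jumpSum v H φ j t τ ∂(waitingLaw r) =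
        r * ∫ τ, timeIntegral v H φ t τ ∂(waitingLaw r) := by
  set K : ℝ × State N → ℝ≥0∞ := {p | p.1 ≤ t}.indicator fun p => ENNReal.ofReal (H p)
  have hK : Measurable K :=
    hH.ennreal_ofReal.indicator (measurableSet_le measurable_fst measurable_const)
  have hKm : Measurable fun τ => ∑' k, K (arrival τ j (k + 1), preJump v τ φ j k (τ (j, k))) :=
    Measurable.tsum fun k => hK.comp ((measurable_arrival j (k + 1)).prodMk
      (measurable_preJump measurable_id measurable_const (measurable_pi_apply _)))
  have hsum : ∀ᵐ τ ∂(waitingLaw r), ENNReal.ofReal (jumpSum v H φ j t τ) =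
      ∑' k, K (arrival τ j (k + 1), preJump v τ φ j k (τ (j, k))) := by
    filter_upwards [ae_good] with τ hτ
    have hiff : ∀ k, arrival τ j (k + 1) ≤ t ↔ k ∈ Finset.range (reversalCount τ j t) := fun k => by
      rw [← hτ.le_count_iff ht, Finset.mem_range, Nat.succ_le_iff]
    rw [tsum_eq_sum (s := Finset.range (reversalCount τ j t)), jumpSum,
      ENNReal.ofReal_sum_of_nonneg fun k _ => h0 _]
    · refine Finset.sum_congr rfl fun k hk => ?_
      simp only [K]
      rw [Set.indicator_of_mem]
      exact (hiff k).2 hk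
    · intro k hk
      simp only [K]
      rw [Set.indicator_of_notMem]
      exact fun h => hk ((hiff k).1 h)
  have htime : ∀ τ, ∫⁻ s in Set.Ioi 0, K (s, jumpProcess v τ φ s) =
      ENNReal.ofReal (timeIntegral v H φ t τ) := fun τ => by
    rw [timeIntegral, intervalIntegral.integral_of_le ht, ofReal_integral_eq_lintegral_ofReal]
    · rw [← lintegral_indicator measurableSet_Ioi, ← lintegral_indicator measurableSet_Ioc]
      refine lintegral_congr fun s => ?_
      by_cases h1 : 0 < s <;> by_cases h2 : s ≤ t <;> simp [K, h1, h2]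
    · exact (intervalIntegrable_of_bounded (measurable_along hH φ τ) (fun _ => hC _) 0 t).1
    · exact Eventually.of_forall fun s => h0 _
  have hnn : ∀ τ, 0 ≤ jumpSum v H φ j t τ := fun τ => Finset.sum_nonneg fun k _ => h0 _
  have htn : ∀ τ, 0 ≤ timeIntegral v H φ t τ := fun τ =>
    intervalIntegral.integral_nonneg ht fun s _ => h0 _
  have hint := integrable_timeIntegral (v := v) (r := r) hH hC ht φ
  have hmeas : AEStronglyMeasurable (jumpSum v H φ j t) (waitingLaw r) := by
    refine hKm.ennreal_toReal.aestronglyMeasurable.congr ?_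
    filter_upwards [hsum] with τ h
    rw [← h, ENNReal.toReal_ofReal (hnn τ)]
  have hmain : ∫⁻ τ, ENNReal.ofReal (jumpSum v H φ j t τ) ∂(waitingLaw r) =
      ENNReal.ofReal r * ENNReal.ofReal (∫ τ, timeIntegral v H φ t τ ∂(waitingLaw r)) := by
    rw [lintegral_congr_ae hsum, lintegral_tsum_preJump hv φ j hK,
      ofReal_integral_eq_lintegral_ofReal hint (Eventually.of_forall htn)]
    simp_rw [htime]
  constructor
  · refine ⟨hmeas, ?_⟩
    rw [hasFiniteIntegral_iff_ofReal (Eventually.of_forall hnn), hmain]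
    exact ENNReal.mul_lt_top ENNReal.ofReal_lt_top ENNReal.ofReal_lt_top
  · rw [integral_eq_lintegral_of_nonneg_ae (Eventually.of_forall hnn) hmeas, hmain,
      ← ENNReal.ofReal_mul hr.out.le, ENNReal.toReal_ofReal]
    exact mul_nonneg hr.out.le (integral_nonneg htn)

/-- The expected sum of `H` over the reversals of a walker up to time `t` is `r` times the expected
time integral of `H` along the process. -/
theorem integral_jumpSum (hv : 0 < v) (φ : State N) (j : Fin 2) {H : ℝ × State N → ℝ}
    (hH : Measurable H) {C : ℝ} (hC : ∀ p, |H p| ≤ C) {t : ℝ} (ht : 0 ≤ t) :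
    Integrable (jumpSum v H φ j t) (waitingLaw r) ∧
      ∫ τ, jumpSum v H φ j t τ ∂(waitingLaw r) =
        r * ∫ τ, timeIntegral v H φ t τ ∂(waitingLaw r) := by
  have hC0 : ∀ p, |H p + C| ≤ C + |C| := fun p => (abs_add_le _ _).trans (by linarith [hC p])
  have hm := hH.add_const C
  obtain ⟨i1, e1⟩ := integral_jumpSum_of_nonneg (r := r) hv φ j hm hC0
    (fun p => by linarith [(abs_le.1 (hC p)).1]) ht
  obtain ⟨i2, e2⟩ := integral_jumpSum_of_nonneg (r := r) hv φ j (H := fun _ => C)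
    measurable_const (fun p => le_rfl) (fun p => (abs_nonneg _).trans (hC p)) ht
  have hJ : jumpSum v H φ j t = fun τ => jumpSum v (fun p => H p + C) φ j t τ -
      jumpSum v (fun _ => C) φ j t τ := by
    ext τ; simp [jumpSum, Finset.sum_add_distrib]
  have hT : timeIntegral v H φ t = fun τ => timeIntegral v (fun p => H p + C) φ t τ -
      timeIntegral v (fun _ => C) φ t τ := by
    ext τ
    simp only [timeIntegral]
    rw [intervalIntegral.integral_add (intervalIntegrable_of_bounded (measurable_along hH φ τ)
      (fun _ => hC _) 0 t) intervalIntegrable_const]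
    ring
  rw [hJ, hT]
  refine ⟨i1.sub i2, ?_⟩
  rw [integral_sub i1 i2, integral_sub (integrable_timeIntegral hm hC0 ht φ)
    (integrable_timeIntegral measurable_const (fun _ => le_rfl) ht φ), e1, e2, mul_sub]

end Compensation

/-! ### The forward equation and its uniqueness -/

section Forward

variable {N v r : ℝ} [hN : Fact (0 < N)] [hr : Fact (0 < r)]

theorem Good.count_const {τ : Fin 2 × ℕ → ℝ} (h : Good τ) {a b s : ℝ} (ha : 0 ≤ a) (has : a ≤ s)
    (hsb : s ≤ b) {i : Fin 2} (hab : reversalCount τ i a = reversalCount τ i b) :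
    reversalCount τ i s = reversalCount τ i a :=
  le_antisymm ((h.count_mono (ha.trans has) hsb).trans hab.ge) (h.count_mono ha has)

theorem process_eq_flow_of_count (hv : 0 < v) {τ : Fin 2 × ℕ → ℝ} (h : Good τ) {φ : State N}
    {a b : ℝ} (ha : 0 ≤ a) (hab : a ≤ b) (hc : ∀ i, reversalCount τ i a = reversalCount τ i b) :
    process v τ φ b = flow v (b - a) (process v τ φ a) :=
  process_eq_flow hv ha hab fun _ h1 h2 => direction_congr fun i => h.count_const ha h1 h2 (hc i)

/-- The change of `k` at time `t`, under free motion after time `s`, that a reversal of walker `j`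
at time `s` brings about. -/
def jumpEffect (v : ℝ) (k : State N → ℝ) (t : ℝ) (j : Fin 2) : ℝ × State N → ℝ := fun p =>
  k (flow v (t - p.1) (flip j p.2)) - k (flow v (t - p.1) p.2)

theorem measurable_jumpEffect {k : State N → ℝ} (hk : Measurable k) (t : ℝ) (j : Fin 2) :
    Measurable (jumpEffect v k t j) := by
  have h1 : Measurable fun p : ℝ × State N => t - p.1 := measurable_const.sub measurable_fst
  exact (hk.comp (measurable_flow h1 ((measurable_flip j).comp measurable_snd))).sub
    (hk.comp (measurable_flow h1 measurable_snd))

theorem abs_jumpEffect_le {k : State N → ℝ} {C : ℝ} (hC : ∀ φ, |k φ| ≤ C) (t : ℝ) (j : Fin 2)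
    (p : ℝ × State N) : |jumpEffect v k t j p| ≤ 2 * C :=
  (abs_sub _ _).trans (by linarith [hC (flow v (t - p.1) (flip j p.2)), hC (flow v (t - p.1) p.2)])

/-- Under free motion up to time `t`, the prediction of `k` at time `t` changes only at reversals. -/
theorem sub_flow_eq_sum_jumpSum (hv : 0 < v) {τ : Fin 2 × ℕ → ℝ} (h : Good τ)
    (hne : ∀ k l, arrival τ 0 (k + 1) ≠ arrival τ 1 (l + 1)) (φ : State N) {k : State N → ℝ}
    (hk : CarrierFree k) {t : ℝ} (ht : 0 ≤ t) :
    k (jumpProcess v τ φ t) - k (flow v t φ) = ∑ j, jumpSum v (jumpEffect v k t j) φ j t τ := by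
  have key := sub_eq_sum_jumps (T := t) h hne (y := fun s => k (flow v (t - s) (process v τ φ s)))
    (J := fun j n => jumpEffect v k t j (arrival τ j (n + 1), preJump v τ φ j n (τ (j, n))))
    ?_ ?_ ht le_rfl
  · simp only [sub_self, sub_zero, flow_zero hv, process_zero h] at key
    rw [← process_eq_jumpProcess hv h ht, key]
    rfl
  · intro a b ha hab hb hc
    rw [process_eq_flow_of_count hv h ha hab hc, flow_flow hv (by linarith) (by linarith)]
    congr 2; ring
  · intro j n a ha haT hT hj hi
    obtain ⟨e1, e2⟩ := process_jump (φ := φ) hv h ha haT hj hi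
    simp only [jumpEffect]
    rw [e1, e2, (hk.flow (t - arrival τ j (n + 1))).step,
      flow_flow hv (by linarith) (by linarith) (process v τ φ a)]
    congr 3; ring

/-- The sum of the effects of the reversals of both walkers. -/
def totalEffect (v : ℝ) (k : State N → ℝ) (t : ℝ) : ℝ × State N → ℝ := fun p =>
  ∑ j, jumpEffect v k t j p

theorem measurable_totalEffect {k : State N → ℝ} (hk : Measurable k) (t : ℝ) :
    Measurable (totalEffect v k t) :=
  Finset.measurable_sum _ fun j _ => measurable_jumpEffect hk t j

theorem abs_totalEffect_le {k : State N → ℝ} {C : ℝ} (hC : ∀ φ, |k φ| ≤ C) (t : ℝ)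
    (p : ℝ × State N) : |totalEffect v k t p| ≤ 4 * C := by
  rw [totalEffect, Fin.sum_univ_two]
  exact (abs_add_le _ _).trans
    (by linarith [abs_jumpEffect_le (v := v) hC t 0 p, abs_jumpEffect_le (v := v) hC t 1 p])

theorem CarrierFree.totalEffect {k : State N → ℝ} (hk : CarrierFree k) (t s : ℝ) :
    CarrierFree fun φ => totalEffect v k t (s, φ) := by
  intro φ ψ h1 h2 h3
  refine Finset.sum_congr rfl fun j _ => ?_
  have e1 := ((hk.flow (v := v) (t - s)).flip j) φ ψ h1 h2 h3
  have e2 := (hk.flow (v := v) (t - s)) φ ψ h1 h2 h3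
  simp only [jumpEffect]
  exact congrArg₂ _ e1 e2

/-- Decomposition of the law of the process at time `t` according to the reversals: between
reversals the walkers move freely, and reversals occur at rate `r`. -/
theorem integral_jumpProcess (hv : 0 < v) (φ : State N) {k : State N → ℝ} (hk : Measurable k)
    (hfree : CarrierFree k) {C : ℝ} (hC : ∀ φ, |k φ| ≤ C) {t : ℝ} (ht : 0 ≤ t) :
    ∫ τ, k (jumpProcess v τ φ t) ∂(waitingLaw r) = k (flow v t φ) +
      r * ∫ τ, timeIntegral v (totalEffect v k t) φ t τ ∂(waitingLaw r) := by
  have hJ := fun j => integral_jumpSum (r := r) hv φ j (measurable_jumpEffect hk t j)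
    (abs_jumpEffect_le (v := v) hC t j) ht
  have hT := fun j => integrable_timeIntegral (v := v) (r := r) (measurable_jumpEffect hk t j)
    (abs_jumpEffect_le (v := v) hC t j) ht φ
  have h1 : (fun τ => k (jumpProcess v τ φ t)) =ᵐ[waitingLaw r]
      fun τ => k (flow v t φ) + ∑ j, jumpSum v (jumpEffect v k t j) φ j t τ := by
    filter_upwards [ae_good, ae_ne_arrival] with τ h hne
    rw [← sub_flow_eq_sum_jumpSum hv h hne φ hfree ht]; ring
  have h2 : timeIntegral v (totalEffect v k t) φ t =
      fun τ => ∑ j, timeIntegral v (jumpEffect v k t j) φ t τ := by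
    ext τ
    simp only [timeIntegral, totalEffect]
    exact intervalIntegral.integral_finsetSum fun j _ => intervalIntegrable_of_bounded
      (measurable_along (measurable_jumpEffect hk t j) φ τ) (fun _ => abs_jumpEffect_le hC t j _) 0 t
  rw [integral_congr_ae h1, integral_add (integrable_const _)
    (integrable_finsetSum _ fun j _ => (hJ j).1), integral_finsetSum _ fun j _ => (hJ j).1, h2,
    integral_finsetSum _ fun j _ => hT j, Finset.mul_sum, integral_const]
  simp only [probReal_univ, one_smul, (hJ _).2]

/-- `π` satisfies the forward equation of the process as a constant path of measures. -/
def IsStationary (v r : ℝ) (π : Measure (State N)) : Prop :=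
  ∀ (k : State N → ℝ) (C : ℝ) (t : ℝ), Measurable k → (∀ φ, |k φ| ≤ C) → 0 ≤ t →
    ∫ φ, k φ ∂π = ∫ φ, k (flow v t φ) ∂π +
      r * ∫ s in (0 : ℝ)..t, ∫ φ, totalEffect v k t (s, φ) ∂π

theorem integrable_of_bounded {α : Type*} [MeasurableSpace α] {m : Measure α} [IsFiniteMeasure m]
    {f : α → ℝ} (hf : Measurable f) {C : ℝ} (hC : ∀ a, |f a| ≤ C) : Integrable f m :=
  (integrable_const C).mono' hf.aestronglyMeasurable (Eventually.of_forall hC)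

theorem abs_integral_le {α : Type*} [MeasurableSpace α] {m : Measure α} [IsProbabilityMeasure m]
    {f : α → ℝ} {C : ℝ} (hC : ∀ a, |f a| ≤ C) : |∫ a, f a ∂m| ≤ C := by
  simpa using norm_integral_le_of_norm_le_const (μ := m) (f := f) (C := C)
    (Eventually.of_forall hC)

theorem measurable_jumpProcess_prod (t : ℝ) :
    Measurable fun q : State N × (Fin 2 × ℕ → ℝ) => jumpProcess v q.2 q.1 t :=
  measurable_jumpProcess measurable_snd measurable_fst measurable_const

theorem integral_integral_swap_of_bounded {α : Type*} [MeasurableSpace α] {m : Measure α}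
    [IsFiniteMeasure m] {f : α → ℝ → ℝ} (hf : Measurable fun p : α × ℝ => f p.1 p.2) {C : ℝ}
    (hC : ∀ a s, |f a s| ≤ C) {t : ℝ} (ht : 0 ≤ t) :
    ∫ a, (∫ s in (0 : ℝ)..t, f a s) ∂m = ∫ s in (0 : ℝ)..t, ∫ a, f a s ∂m := by
  simp only [intervalIntegral.integral_of_le ht]
  exact integral_integral_swap (integrable_of_bounded hf fun p => hC p.1 p.2)

/-- The deviation of the law at time `t` from a stationary solution solves a linear Volterra
equation, in which the deviation at time `s ≤ t` is tested against `totalEffect v k t (s, ·)`. -/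
theorem deviation_eq (hv : 0 < v) {π : Measure (State N)} [IsProbabilityMeasure π]
    (hπ : IsStationary v r π) {k : State N → ℝ} (hk : Measurable k)
    (hfree : CarrierFree k) {C : ℝ} (hC : ∀ φ, |k φ| ≤ C) {t : ℝ} (ht : 0 ≤ t) :
    ∫ q, k (jumpProcess v q.2 q.1 t) ∂(π.prod (waitingLaw r)) - ∫ φ, k φ ∂π =
      r * ∫ s in (0 : ℝ)..t,
        (∫ q, totalEffect v k t (s, jumpProcess v q.2 q.1 s) ∂(π.prod (waitingLaw r)) -
          ∫ φ, totalEffect v k t (s, φ) ∂π) := by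
  have hE := measurable_totalEffect (v := v) hk t
  have hEC := abs_totalEffect_le (v := v) hC t
  have hmE : Measurable fun p : (State N × (Fin 2 × ℕ → ℝ)) × ℝ =>
      totalEffect v k t (p.2, jumpProcess v p.1.2 p.1.1 p.2) :=
    hE.comp (measurable_snd.prodMk (measurable_jumpProcess (measurable_snd.comp measurable_fst)
      (measurable_fst.comp measurable_fst) measurable_snd))
  have hswap := integral_integral_swap_of_bounded (m := π.prod (waitingLaw r)) (C := 4 * C)
    (f := fun (q : State N × (Fin 2 × ℕ → ℝ)) s => totalEffect v k t (s, jumpProcess v q.2 q.1 s))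
    hmE (fun q s => hEC (s, jumpProcess v q.2 q.1 s)) ht
  have e1 : ∫ q, k (jumpProcess v q.2 q.1 t) ∂(π.prod (waitingLaw r)) = ∫ φ, k (flow v t φ) ∂π +
      r * ∫ s in (0 : ℝ)..t,
        ∫ q, totalEffect v k t (s, jumpProcess v q.2 q.1 s) ∂(π.prod (waitingLaw r)) := by
    rw [integral_prod (fun q : State N × (Fin 2 × ℕ → ℝ) => k (jumpProcess v q.2 q.1 t))
      (integrable_of_bounded (hk.comp (measurable_jumpProcess_prod t)) fun _ => hC _)]
    simp_rw [integral_jumpProcess hv _ hk hfree hC ht]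
    have hmT : Measurable fun q : State N × (Fin 2 × ℕ → ℝ) =>
        timeIntegral v (totalEffect v k t) q.1 t q.2 :=
      measurable_timeIntegral hE ht measurable_snd measurable_fst
    have hbT : ∀ q : State N × (Fin 2 × ℕ → ℝ),
        |timeIntegral v (totalEffect v k t) q.1 t q.2| ≤ 4 * C * t :=
      fun q => abs_timeIntegral_le hEC ht _ _
    have hmI : Measurable fun φ => ∫ τ, timeIntegral v (totalEffect v k t) φ t τ ∂(waitingLaw r) :=
      hmT.stronglyMeasurable.integral_prod_right'.measurable
    rw [integral_add (f := fun φ => k (flow v t φ)) (integrable_of_bounded (hk.comp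
      (measurable_flow measurable_const measurable_id)) fun _ => hC _) ((integrable_of_bounded hmI fun φ =>
      abs_integral_le fun τ => hbT (φ, τ)).const_mul r), integral_const_mul,
      ← integral_prod _ (integrable_of_bounded hmT hbT)]
    congr 2
  rw [e1, hπ k C t hk hC ht, intervalIntegral.integral_sub]
  · ring
  · exact intervalIntegrable_of_bounded
      (hmE.comp measurable_swap).stronglyMeasurable.integral_prod_right'.measurable
      (fun s => abs_integral_le fun q => hEC _) 0 t
  · exact intervalIntegrable_of_bounded hE.stronglyMeasurable.integral_prod_right'.measurable
      (fun s => abs_integral_le fun q => hEC _) 0 t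

/-- Iterating the Volterra equation bounds the deviation by the terms of an exponential series. -/
theorem abs_deviation_le (hv : 0 < v) {π : Measure (State N)} [IsProbabilityMeasure π]
    (hπ : IsStationary v r π) (n : ℕ) : ∀ {k : State N → ℝ}, Measurable k → CarrierFree k →
    ∀ {C : ℝ}, (∀ φ, |k φ| ≤ C) → ∀ {t : ℝ}, 0 ≤ t →
    |∫ q, k (jumpProcess v q.2 q.1 t) ∂(π.prod (waitingLaw r)) - ∫ φ, k φ ∂π| ≤
      2 * C * ((4 * r * t) ^ n / n.factorial) := by
  induction n with
  | zero =>
    intro k hk hfree C hC t ht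
    have h1 : |∫ q, k (jumpProcess v q.2 q.1 t) ∂(π.prod (waitingLaw r))| ≤ C :=
      abs_integral_le fun q => hC _
    have h2 : |∫ φ, k φ ∂π| ≤ C := abs_integral_le hC
    simpa [two_mul] using (abs_sub _ _).trans (add_le_add h1 h2)
  | succ n ih =>
    intro k hk hfree C hC t ht
    have hr := hr.out
    rw [deviation_eq hv hπ hk hfree hC ht, abs_mul, abs_of_pos hr]
    have hb : ∀ s ∈ Set.Ioc 0 t,
        |∫ q, totalEffect v k t (s, jumpProcess v q.2 q.1 s) ∂(π.prod (waitingLaw r)) -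
          ∫ φ, totalEffect v k t (s, φ) ∂π| ≤
        2 * (4 * C) * ((4 * r) ^ n / n.factorial) * s ^ n := fun s hs => by
      refine (ih (k := fun φ => totalEffect v k t (s, φ))
        ((measurable_totalEffect hk t).comp (measurable_const.prodMk measurable_id))
        (hfree.totalEffect t s) (fun φ => abs_totalEffect_le hC t _) hs.1.le).trans_eq ?_
      rw [mul_pow]; ring
    have hi := intervalIntegral.norm_integral_le_of_norm_le
      (g := fun s => 2 * (4 * C) * ((4 * r) ^ n / n.factorial) * s ^ n)
      (f := fun s => ∫ q, totalEffect v k t (s, jumpProcess v q.2 q.1 s) ∂(π.prod (waitingLaw r)) -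
        ∫ φ, totalEffect v k t (s, φ) ∂π) (μ := volume) ht
      (Eventually.of_forall hb) (Continuous.intervalIntegrable (by fun_prop) 0 t)
    rw [intervalIntegral.integral_const_mul, integral_pow] at hi
    refine (mul_le_mul_of_nonneg_left hi hr.le).trans_eq ?_
    rw [Nat.factorial_succ, mul_pow (4 * r) t]
    push_cast
    field_simp
    ring

theorem integral_jumpProcess_of_isStationary (hv : 0 < v) {π : Measure (State N)}
    [IsProbabilityMeasure π] (hπ : IsStationary v r π) {k : State N → ℝ} (hk : Measurable k)
    (hfree : CarrierFree k) {C : ℝ} (hC : ∀ φ, |k φ| ≤ C) {t : ℝ} (ht : 0 ≤ t) :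
    ∫ q, k (jumpProcess v q.2 q.1 t) ∂(π.prod (waitingLaw r)) = ∫ φ, k φ ∂π := by
  have h1 : Tendsto (fun n : ℕ => 2 * C * ((4 * r * t) ^ n / n.factorial)) atTop (𝓝 (2 * C * 0)) :=
    (FloorSemiring.tendsto_pow_div_factorial_atTop (4 * r * t)).const_mul _
  rw [mul_zero] at h1
  have h2 := ge_of_tendsto' h1 fun n => abs_deviation_le hv hπ n hk hfree hC ht
  exact sub_eq_zero.1 (abs_eq_zero.1 (le_antisymm h2 (abs_nonneg _)))

/-- The states in which the walkers are at the same place and move in the same direction. -/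
def together (N : ℝ) : Set (State N) := {φ | φ.pos 0 = φ.pos 1 ∧ φ.dir 0 = φ.dir 1}

theorem measurableSet_together : MeasurableSet (together N) :=
  (measurableSet_eq_fun (f := fun φ : State N => φ.pos 0) (g := fun φ => φ.pos 1)
    ((measurable_pi_apply 0).comp measurable_pos) ((measurable_pi_apply 1).comp measurable_pos)).inter
  (measurableSet_eq_fun (f := fun φ : State N => φ.dir 0) (g := fun φ => φ.dir 1)
    ((measurable_pi_apply 0).comp measurable_dir) ((measurable_pi_apply 1).comp measurable_dir))

/-- A stationary solution of the forward equation is invariant, if it does not charge the only states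
that carrier-free functions do not separate. -/
theorem map_jumpProcess_of_isStationary (hv : 0 < v) {π : Measure (State N)}
    [IsProbabilityMeasure π] (hπ : IsStationary v r π) (h0 : π (together N) = 0) {t : ℝ}
    (ht : 0 ≤ t) :
    (π.prod (waitingLaw r)).map (fun q => jumpProcess v q.2 q.1 t) = π := by
  have hm := measurable_jumpProcess_prod (N := N) (v := v) t
  have : IsProbabilityMeasure ((π.prod (waitingLaw r)).map fun q => jumpProcess v q.2 q.1 t) :=
    Measure.isProbabilityMeasure_map hm.aemeasurable
  have key : ∀ A : Set (State N), MeasurableSet A → CarrierFree (A.indicator (1 : State N → ℝ)) →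
      (π.prod (waitingLaw r)).map (fun q => jumpProcess v q.2 q.1 t) A = π A := fun A hA hfree => by
    have h := integral_jumpProcess_of_isStationary hv hπ (measurable_one.indicator hA) hfree (C := 1)
      (fun φ => by by_cases h : φ ∈ A <;> simp [h]) ht
    rw [← integral_map hm.aemeasurable
      (measurable_one.indicator hA).aestronglyMeasurable, integral_indicator_one hA,
      integral_indicator_one hA] at h
    exact (measureReal_eq_measureReal_iff).1 h
  have h0' : (π.prod (waitingLaw r)).map (fun q => jumpProcess v q.2 q.1 t) (together N) = 0 := by
    rw [key _ measurableSet_together, h0]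
    intro φ ψ h1 h2 h3
    have h4 : φ ∈ together N ↔ ψ ∈ together N := by simp [together, h1, h2]
    by_cases h : ψ ∈ together N
    · simp [h, h4.2 h]
    · simp [h, mt h4.1 h]
  ext A hA
  -- outside `together` the carrier is determined whenever the walkers are at the same place
  have hfree : CarrierFree ((A \ together N).indicator (1 : State N → ℝ)) := by
    intro φ ψ h1 h2 h3
    by_cases hd : φ.dir 0 = φ.dir 1
    · have e1 : φ ∈ together N := ⟨h3, hd⟩
      have e2 : ψ ∈ together N := ⟨h1 ▸ h3, h2 ▸ hd⟩
      simp [e1, e2]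
    · have hE : Encounter φ.pos φ.dir := ⟨h3, hd⟩
      have : φ = ψ := State.ext' h1 h2 (by
        rw [State.carrier_eq_of_encounter hE, State.carrier_eq_of_encounter (h1 ▸ h2 ▸ hE), h2])
      rw [this]
  rw [← measure_sdiff_null h0', ← measure_sdiff_null (s := A) h0]
  exact key _ (hA.diff measurableSet_together) hfree

end Forward

/-! ### An invariant measure -/

section Line

/-- A shift of `ψ` by `2 v t` changes its integral against the weight with uniform part `1` on
`(0, N]` and triangular part `r / (2 v) * (N - |y|)` by the accumulated asymmetry of the uniform part.
The uniform part of a function that is periodic on the half-line is shift invariant, and the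
triangular part is a second difference of a double primitive, so that its derivative in the shift is
a second difference of a primitive. -/
theorem triangle_average_eq {ψ : ℝ → ℝ} (hψ : Measurable ψ) {C : ℝ} (hC : ∀ y, |ψ y| ≤ C) {N : ℝ}
    (hper : ∀ y, 0 ≤ y → ψ (y + N) = ψ y) {v r t : ℝ} (hv : 0 < v) (ht : 0 ≤ t) :
    (∫ y in (0 : ℝ)..N, ψ y) + r / (2 * v) * (∫ w in (0 : ℝ)..N, ∫ x in (0 : ℝ)..N, ψ (w - x)) =
      (∫ y in (0 : ℝ)..N, ψ (y + 2 * v * t)) +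
        r / (2 * v) * (∫ w in (0 : ℝ)..N, ∫ x in (0 : ℝ)..N, ψ (w - x + 2 * v * t)) +
      r * ∫ s in (0 : ℝ)..t,
        ∫ y in (0 : ℝ)..N, (ψ (-y + 2 * v * (t - s)) - ψ (y + 2 * v * (t - s))) := by
  have hi : ∀ a b, IntervalIntegrable ψ volume a b := intervalIntegrable_of_bounded hψ hC
  set Ψ : ℝ → ℝ := fun x => ∫ y in (0 : ℝ)..x, ψ y
  have hΨ : Continuous Ψ := intervalIntegral.continuous_primitive hi 0
  have hsub : ∀ a b, ∫ y in a..b, ψ y = Ψ b - Ψ a := fun a b =>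
    (intervalIntegral.integral_interval_sub_left (hi 0 b) (hi 0 a)).symm
  set Θ : ℝ → ℝ := fun x => ∫ y in (0 : ℝ)..x, Ψ y
  have hΘ : ∀ x, HasDerivAt Θ (Ψ x) x := fun x =>
    intervalIntegral.integral_hasDerivAt_right (hΨ.intervalIntegrable _ _)
      (hΨ.stronglyMeasurableAtFilter _ _) hΨ.continuousAt
  have hΘsub : ∀ a b, ∫ y in a..b, Ψ y = Θ b - Θ a := fun a b =>
    (intervalIntegral.integral_interval_sub_left (hΨ.intervalIntegrable 0 b)
      (hΨ.intervalIntegrable 0 a)).symm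
  -- the constant term
  have hconst : ∀ e, 0 ≤ e → ∫ y in (0 : ℝ)..N, ψ (y + e) = Ψ N := fun e he => by
    rw [intervalIntegral.integral_comp_add_right, zero_add]
    have h1 : ∫ y in (0 : ℝ)..e, ψ (y + N) = ∫ y in (0 : ℝ)..e, ψ y :=
      intervalIntegral.integral_congr fun y hy => hper y (by rw [Set.uIcc_of_le he] at hy; exact hy.1)
    rw [intervalIntegral.integral_comp_add_right, zero_add, hsub, hsub] at h1
    rw [hsub, add_comm N e]
    have h0 : Ψ 0 = 0 := intervalIntegral.integral_same
    linarith
  -- the quadratic term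
  set G : ℝ → ℝ := fun e => Θ (e + N) - 2 * Θ e + Θ (e - N)
  have hG : ∀ e, ∫ w in (0 : ℝ)..N, ∫ x in (0 : ℝ)..N, ψ (w - x + e) = G e := fun e => by
    have h1 : ∀ w, ∫ x in (0 : ℝ)..N, ψ (w - x + e) = Ψ (w + e) - Ψ (w + (e - N)) := fun w => by
      have : ∀ x, w - x + e = (w + e) - x := fun x => by ring
      simp_rw [this]
      rw [intervalIntegral.integral_comp_sub_left, hsub]
      congr 2 <;> ring
    simp_rw [h1]
    rw [intervalIntegral.integral_sub (Continuous.intervalIntegrable (by fun_prop) _ _)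
      (Continuous.intervalIntegrable (by fun_prop) _ _), intervalIntegral.integral_comp_add_right,
      intervalIntegral.integral_comp_add_right, hΘsub, hΘsub]
    have e1 : N + (e - N) = e := by ring
    simp only [G, zero_add, e1, add_comm N e]
    ring
  have hG' : ∀ e, ∫ y in (0 : ℝ)..N, (ψ (-y + e) - ψ (y + e)) =
      -(Ψ (e + N) - 2 * Ψ e + Ψ (e - N)) := fun e => by
    rw [intervalIntegral.integral_sub (f := fun y => ψ (-y + e)) (g := fun y => ψ (y + e))
      (intervalIntegrable_of_bounded (hψ.comp (by fun_prop)) (fun _ => hC _) _ _)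
      (intervalIntegrable_of_bounded (hψ.comp (by fun_prop)) (fun _ => hC _) _ _),
      intervalIntegral.integral_comp_add_right]
    have : ∀ y, -y + e = e - y := fun y => by ring
    simp_rw [this]
    rw [intervalIntegral.integral_comp_sub_left, hsub, hsub]
    simp only [zero_add, sub_zero, add_comm N e]
    ring
  have hderiv : ∀ s, HasDerivAt (fun s => G (2 * v * (t - s)))
      ((Ψ (2 * v * (t - s) + N) - 2 * Ψ (2 * v * (t - s)) + Ψ (2 * v * (t - s) - N)) *
        (2 * v * -1)) s := fun s => by
    have h1 : HasDerivAt (fun s : ℝ => 2 * v * (t - s)) (2 * v * -1) s :=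
      ((hasDerivAt_id s).const_sub t).const_mul (2 * v)
    have h2 : ∀ e, HasDerivAt G (Ψ (e + N) - 2 * Ψ e + Ψ (e - N)) e := fun e =>
      (((hΘ (e + N)).comp_add_const e N).sub ((hΘ e).const_mul 2)).add
        ((hΘ (e - N)).comp_sub_const e N)
    exact (h2 _).comp s h1
  have hFTC := intervalIntegral.integral_eq_sub_of_hasDerivAt (a := 0) (b := t)
    (fun s _ => hderiv s) (Continuous.intervalIntegrable (by fun_prop) _ _)
  rw [intervalIntegral.integral_mul_const] at hFTC
  have h0 := hG 0
  have h00 := hconst 0 le_rfl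
  simp only [add_zero] at h0 h00
  rw [hconst _ (by positivity), hG, h0]
  simp_rw [hG']
  rw [intervalIntegral.integral_neg]
  simp only [sub_self, mul_zero, sub_zero] at hFTC
  have hv' : v ≠ 0 := hv.ne'
  field_simp
  linear_combination 2 * v * h00 - r * hFTC

end Line

section Stationary

variable {N v r : ℝ} [hN : Fact (0 < N)] [hr : Fact (0 < r)]

/-- Walker `i` is at `x` with direction `a`, and the other walker is at `x + y` with direction `b`.
The message is with walker `i` if `y < 0` and with the other one if `0 ≤ y`. When walker `i` moves
counter-clockwise and the other one clockwise, `y` increases at speed `2 v`, and the message is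
passed from walker `i` to the other one when `y` passes `0`. -/
def pairState (i : Fin 2) (a b : ℤˣ) (x : AddCircle N) (y : ℝ) : State N :=
  mkState (fun l => if l = i then x else x + (y : AddCircle N)) (fun l => if l = i then a else b)
    (if y < 0 then i else i + 1)

theorem measurable_pairState {α : Type*} [MeasurableSpace α] (i : Fin 2) (a b : ℤˣ)
    {x : α → AddCircle N} {y : α → ℝ} (hx : Measurable x) (hy : Measurable y) :
    Measurable fun q => pairState i a b (x q) (y q) := by
  refine measurable_mkState (measurable_pi_lambda _ fun l => ?_) measurable_const
    (Measurable.ite (measurableSet_lt hy measurable_const) measurable_const measurable_const)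
  by_cases h : l = i
  · simpa only [h, if_true] using hx
  · simp only [h, if_false]
    exact hx.add (AddCircle.measurable_mk'.comp hy)

theorem clockwiseWalker_pair (i : Fin 2) :
    clockwiseWalker (fun l => if l = i then (-1 : ℤˣ) else 1) = i + 1 := by
  fin_cases i <;> rfl

theorem pair_dir_ne (i : Fin 2) {a b : ℤˣ} (h : a ≠ b) :
    (if (0 : Fin 2) = i then a else b) ≠ (if (1 : Fin 2) = i then a else b) := by
  fin_cases i
  · simpa using h
  · simpa using h.symm

theorem not_encounter_pair (i : Fin 2) (e : ℤˣ) (x : Fin 2 → AddCircle N) :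
    ¬ Encounter x (fun l => if l = i then e else e) := fun h => h.2 (by simp)

theorem pairState_carrier_of_eq (i : Fin 2) (e : ℤˣ) (x : AddCircle N) (y : ℝ) :
    (pairState i e e x y).carrier = if y < 0 then i else i + 1 :=
  mkState_carrier_of_not _ (not_encounter_pair i e _)

theorem coe_ne_zero_of_mem {y : ℝ} (h1 : -N < y) (h2 : y < 0) : (y : AddCircle N) ≠ 0 := fun h => by
  have := add_le_of_coe_eq (N := N) h2 (by simpa using h)
  linarith

theorem pairState_carrier (i : Fin 2) (x : AddCircle N) {y : ℝ} (hy : -N < y) :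
    (pairState i (-1) 1 x y).carrier = if y < 0 then i else i + 1 := by
  by_cases hE : Encounter (fun l => if l = i then x else x + (y : AddCircle N))
      (fun l => if l = i then (-1 : ℤˣ) else 1)
  · rw [pairState, mkState_carrier_of_encounter _ hE, clockwiseWalker_pair, if_neg]
    intro hneg
    have := (eq_iff_of_add_one
      (fun l => if l = i then x else x + (y : AddCircle N)) i).1 hE.1
    simp only [if_true, add_eq_left, Fin.isValue, one_ne_zero, if_false] at this
    exact coe_ne_zero_of_mem hy hneg this
  · exact mkState_carrier_of_not _ hE

theorem fin_two_cases {P : Fin 2 → Prop} (i : Fin 2) (h1 : P i) (h2 : P (i + 1)) : ∀ l, P l := by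
  intro l
  by_cases h : l = i
  · rwa [h]
  · rwa [Fin.eq_add_one_of_ne h]

theorem add_one_ne (i : Fin 2) : i + 1 ≠ i := by fin_cases i <;> simp

theorem add_one_add_one (i : Fin 2) : i + 1 + 1 = i := by fin_cases i <;> rfl

theorem flip_pairState (i : Fin 2) (x : AddCircle N) {y : ℝ} (hy : -N < y) :
    flip i (pairState i (-1) 1 x y) = pairState i 1 1 x y ∧
      flip (i + 1) (pairState i (-1) 1 x y) = pairState i (-1) (-1) x y := by
  have hne := add_one_ne i
  constructor
  · refine State.ext' rfl (funext (fin_two_cases i ?_ ?_)) ?_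
    · simp [flip, pairState]
    · simp [flip, pairState]
    · rw [pairState_carrier_of_eq, ← pairState_carrier i x hy]
      refine mkState_carrier_of_not _ fun h => h.2 ?_
      revert i; intro i; fin_cases i <;> simp [pairState]
  · refine State.ext' rfl (funext (fin_two_cases i ?_ ?_)) ?_
    · simp [flip, pairState]
    · simp [flip, pairState]
    · rw [pairState_carrier_of_eq, ← pairState_carrier i x hy]
      refine mkState_carrier_of_not _ fun h => h.2 ?_
      revert i; intro i; fin_cases i <;> simp [pairState]

theorem mkState_eq_pairState (i : Fin 2) (x : AddCircle N) (y : ℝ) :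
    mkState (fun l => if l = i then x else x + (y : AddCircle N))
      (fun l => if l = i then (1 : ℤˣ) else -1) (if y < 0 then i else i + 1) =
    pairState (i + 1) (-1) 1 (x + (y : AddCircle N)) (-y) := by
  have hne := add_one_ne i
  have hx : (fun l => if l = i then x else x + (y : AddCircle N)) = fun l =>
      if l = i + 1 then x + (y : AddCircle N) else x + (y : AddCircle N) + ((-y : ℝ) : AddCircle N) :=
    funext (fin_two_cases i (by simp [hne.symm]) (by simp [hne]))
  have hd : (fun l => if l = i then (1 : ℤˣ) else -1) = fun l => if l = i + 1 then (-1 : ℤˣ) else 1 :=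
    funext (fin_two_cases i (by simp [hne.symm]) (by simp [hne]))
  rw [pairState, ← hx, ← hd, add_one_add_one]
  refine mkState_congr fun hE => ?_
  rcases lt_trichotomy y 0 with h | h | h
  · simp [h, h.le]
  · exact absurd ⟨by subst h; simp, pair_dir_ne i (by decide)⟩ hE
  · simp [h, h.le]

theorem sum_flip_pairState_of_eq (i : Fin 2) (e : ℤˣ) (x : AddCircle N) (y : ℝ) (f : State N → ℝ) :
    ∑ j, f (flip j (pairState i e e x y)) = f (pairState i (-1) 1 x y) +
      f (pairState (i + 1) (-1) 1 (x + (y : AddCircle N)) (-y)) := by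
  have hne := add_one_ne i
  have h0 : ∀ j, flip j (pairState i e e x y) =
      mkState (fun l => if l = i then x else x + (y : AddCircle N))
        (Function.update (fun l => if l = i then e else e) j (-e)) (if y < 0 then i else i + 1) := by
    intro j
    rw [flip, pairState_carrier_of_eq]
    simp [pairState]
  have h1 : ∀ e : ℤˣ, Function.update (fun l => if l = i then e else e) i (-e) =
      fun l => if l = i then -e else e := fun e =>
    funext (fin_two_cases i (by simp) (by simp [hne]))
  have h2 : ∀ e : ℤˣ, Function.update (fun l => if l = i then e else e) (i + 1) (-e) =
      fun l => if l = i then e else -e := fun e =>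
    funext (fin_two_cases i (by simp [hne.symm]) (by simp [hne]))
  rw [sum_fin_two_add_one _ i, h0, h0, h1, h2, ← mkState_eq_pairState]
  rcases Int.units_eq_one_or e with rfl | rfl
  · rfl
  · rw [neg_neg, add_comm]; rfl

theorem flow_pairState_of_eq (i : Fin 2) (e : ℤˣ) (x : AddCircle N) (y u : ℝ) :
    flow v u (pairState i e e x y) =
      pairState i e e (x + ((u * (v * sgn e) : ℝ) : AddCircle N)) y := by
  refine State.ext' (funext (fin_two_cases i ?_ ?_)) rfl ?_
  · simp [pairState, moved]
  · simp [pairState, moved, add_right_comm]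
  · rw [pairState_carrier_of_eq, flow, step, mkState_carrier_of_not, if_neg,
      pairState_carrier_of_eq]
    · exact fun h => h.1 (by simp [pairState])
    · exact not_encounter_pair i e _

theorem flow_pairState (hv : 0 < v) (i : Fin 2) (x : AddCircle N) {y u : ℝ} (hy : -N < y)
    (hu : 0 ≤ u) : flow v u (pairState i (-1) 1 x y) =
      pairState i (-1) 1 (x + ((-(v * u) : ℝ) : AddCircle N)) (y + 2 * v * u) := by
  have hne := add_one_ne i
  have hvu : 0 ≤ v * u := mul_nonneg hv.le hu
  refine State.ext' (funext (fin_two_cases i ?_ ?_)) rfl ?_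
  · simp [pairState, moved, mul_comm]
  · simp only [pairState, flow_pos, mkState_pos, mkState_dir, moved, if_neg hne, sgn_one, add_assoc,
      ← AddCircle.coe_add]
    congr 2; ring
  · rw [pairState_carrier i _ (by linarith), flow_carrier hv hu, pairState_carrier i x hy]
    have hd : (pairState i (-1) 1 x y).dir 0 ≠ (pairState i (-1) 1 x y).dir 1 :=
      pair_dir_ne i (by decide)
    have hc : clockwiseWalker (pairState i (-1) 1 x y).dir = i + 1 := clockwiseWalker_pair i
    rw [hc, if_congr (and_iff_right hd) rfl rfl]
    by_cases h0 : y < 0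
    · have hhit : hit v (pairState i (-1) 1 x y).pos (pairState i (-1) 1 x y).dir = -y / (2 * v) := by
        rw [hit, hc, add_one_add_one]
        simp only [pairState, mkState_pos, if_true, if_neg hne, sub_add_cancel_left]
        rw [← AddCircle.coe_neg, rep_coe (by linarith) (by linarith)]
      rw [hhit, if_pos h0]
      by_cases h1 : y + 2 * v * u < 0
      · rw [if_pos h1, if_neg (by rw [div_le_iff₀ (by positivity)]; linarith)]
      · rw [if_neg h1, if_pos (by rw [div_le_iff₀ (by positivity)]; linarith)]
    · rw [if_neg h0, if_neg (by nlinarith : ¬ y + 2 * v * u < 0), ite_self]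

theorem pairState_add_period (i : Fin 2) (x : AddCircle N) {y : ℝ} (hy : 0 ≤ y) :
    pairState i (-1) 1 x (y + N) = pairState i (-1) 1 x y := by
  have hN := hN.out
  rw [pairState, pairState, AddCircle.coe_add_period, if_neg (by linarith), if_neg (by linarith)]

end Stationary

section Stationary

variable {N v r : ℝ} [hN : Fact (0 < N)] [hr : Fact (0 < r)]

/-- The integral of `f` over the states `pairState i (-1) 1 x y` with given `y`. -/
def oppositeMean (f : State N → ℝ) (y : ℝ) : ℝ := ∑ i, ∫ x, f (pairState i (-1) 1 x y)

/-- The integral of `f` over the states `pairState i e e x y` with given `y`. -/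
def parallelMean (f : State N → ℝ) (y : ℝ) : ℝ :=
  ∑ i, ((∫ x, f (pairState i 1 1 x y)) + ∫ x, f (pairState i (-1) (-1) x y))

section Means

variable {f g : State N → ℝ}

theorem measurable_integral_pairState (hf : Measurable f) (i : Fin 2) (a b : ℤˣ) :
    Measurable fun y => ∫ x, f (pairState i a b x y) := by
  have h : Measurable fun q : ℝ × AddCircle N => f (pairState i a b q.2 q.1) :=
    hf.comp (measurable_pairState i a b measurable_snd measurable_fst)
  exact h.stronglyMeasurable.integral_prod_right'.measurable

theorem abs_integral_pairState_le {C : ℝ} (hC : ∀ φ, |f φ| ≤ C) (i : Fin 2) (a b : ℤˣ) (y : ℝ) :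
    |∫ x, f (pairState i a b x y)| ≤ C * N := by
  have := norm_integral_le_of_norm_le_const (μ := (volume : Measure (AddCircle N)))
    (f := fun x => f (pairState i a b x y)) (C := C) (Eventually.of_forall fun x => hC _)
  simpa [Measure.real, AddCircle.measure_univ, ENNReal.toReal_ofReal hN.out.le] using this

theorem integrable_pairState (hf : Measurable f) {C : ℝ} (hC : ∀ φ, |f φ| ≤ C) (i : Fin 2)
    (a b : ℤˣ) (y : ℝ) : Integrable fun x => f (pairState i a b x y) :=
  integrable_of_bounded (hf.comp (measurable_pairState i a b measurable_id measurable_const))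
    fun _ => hC _

theorem measurable_oppositeMean (hf : Measurable f) : Measurable (oppositeMean f) :=
  Finset.measurable_sum _ fun i _ => measurable_integral_pairState hf i _ _

theorem measurable_parallelMean (hf : Measurable f) : Measurable (parallelMean f) :=
  Finset.measurable_sum _ fun i _ =>
    (measurable_integral_pairState hf i _ _).add (measurable_integral_pairState hf i _ _)

theorem abs_oppositeMean_le {C : ℝ} (hC : ∀ φ, |f φ| ≤ C) (y : ℝ) :
    |oppositeMean f y| ≤ 2 * (C * N) := by
  rw [oppositeMean, Fin.sum_univ_two]
  exact (abs_add_le _ _).trans (by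
    linarith [abs_integral_pairState_le hC 0 (-1) 1 y, abs_integral_pairState_le hC 1 (-1) 1 y])

theorem abs_parallelMean_le {C : ℝ} (hC : ∀ φ, |f φ| ≤ C) (y : ℝ) :
    |parallelMean f y| ≤ 4 * (C * N) := by
  rw [parallelMean, Fin.sum_univ_two]
  have h := abs_integral_pairState_le hC
  exact (abs_add_le _ _).trans ((add_le_add (abs_add_le _ _) (abs_add_le _ _)).trans (by
    linarith [h 0 1 1 y, h 0 (-1) (-1) y, h 1 1 1 y, h 1 (-1) (-1) y]))

theorem oppositeMean_sub (hf : Measurable f) (hg : Measurable g) {C : ℝ} (hC : ∀ φ, |f φ| ≤ C)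
    (hC' : ∀ φ, |g φ| ≤ C) (y : ℝ) :
    oppositeMean (fun φ => f φ - g φ) y = oppositeMean f y - oppositeMean g y := by
  simp only [oppositeMean, ← Finset.sum_sub_distrib]
  exact Finset.sum_congr rfl fun i _ =>
    integral_sub (integrable_pairState hf hC i _ _ y) (integrable_pairState hg hC' i _ _ y)

theorem parallelMean_sub (hf : Measurable f) (hg : Measurable g) {C : ℝ} (hC : ∀ φ, |f φ| ≤ C)
    (hC' : ∀ φ, |g φ| ≤ C) (y : ℝ) :
    parallelMean (fun φ => f φ - g φ) y = parallelMean f y - parallelMean g y := by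
  simp only [parallelMean, ← Finset.sum_sub_distrib]
  refine Finset.sum_congr rfl fun i _ => ?_
  rw [integral_sub (integrable_pairState hf hC i _ _ y) (integrable_pairState hg hC' i _ _ y),
    integral_sub (integrable_pairState hf hC i _ _ y) (integrable_pairState hg hC' i _ _ y)]
  ring

theorem sum_oppositeMean_flip (f : State N → ℝ) {y : ℝ} (hy : -N < y) :
    ∑ j, oppositeMean (fun φ => f (flip j φ)) y = parallelMean f y := by
  simp only [oppositeMean, parallelMean]
  rw [Finset.sum_comm]
  refine Finset.sum_congr rfl fun i _ => ?_
  rw [sum_fin_two_add_one _ i]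
  simp only [(flip_pairState i _ hy).1, (flip_pairState i _ hy).2]

theorem sum_parallelMean_flip (hf : Measurable f) {C : ℝ} (hC : ∀ φ, |f φ| ≤ C) (y : ℝ) :
    ∑ j, parallelMean (fun φ => f (flip j φ)) y =
      2 * (oppositeMean f y + oppositeMean f (-y)) := by
  have hfl : ∀ j, Measurable fun φ => f (flip j φ) := fun j => hf.comp (measurable_flip j)
  have key : ∀ (i : Fin 2) (e : ℤˣ), ∑ j, ∫ x, f (flip j (pairState i e e x y)) =
      (∫ x, f (pairState i (-1) 1 x y)) + ∫ x, f (pairState (i + 1) (-1) 1 x (-y)) := fun i e => by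
    rw [← integral_finsetSum _ fun j _ =>
      integrable_pairState (f := fun φ => f (flip j φ)) (hfl j) (fun _ => hC _) i e e y]
    simp_rw [sum_flip_pairState_of_eq]
    rw [integral_add (integrable_pairState hf hC i _ _ y)
      ((integrable_pairState hf hC (i + 1) (-1) 1 (-y)).comp_add_right (y : AddCircle N)),
      integral_add_right_eq_self (fun x => f (pairState (i + 1) (-1) 1 x (-y))) (y : AddCircle N)]
  simp only [parallelMean]
  rw [Finset.sum_comm]
  simp_rw [Finset.sum_add_distrib, key]
  simp only [oppositeMean, Fin.sum_univ_two]
  have e1 : (1 : Fin 2) + 1 = 0 := rfl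
  rw [zero_add, e1]
  ring

theorem oppositeMean_flow (hv : 0 < v) (f : State N → ℝ) {y u : ℝ} (hy : -N < y) (hu : 0 ≤ u) :
    oppositeMean (fun φ => f (flow v u φ)) y = oppositeMean f (y + 2 * v * u) := by
  refine Finset.sum_congr rfl fun i _ => ?_
  simp only [flow_pairState hv i _ hy hu]
  exact integral_add_right_eq_self (fun x => f (pairState i (-1) 1 x (y + 2 * v * u))) _

theorem parallelMean_flow (f : State N → ℝ) (y u : ℝ) :
    parallelMean (fun φ => f (flow v u φ)) y = parallelMean f y := by
  refine Finset.sum_congr rfl fun i _ => ?_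
  simp only [flow_pairState_of_eq]
  exact congrArg₂ _ (integral_add_right_eq_self (fun x => f (pairState i 1 1 x y)) _)
    (integral_add_right_eq_self (fun x => f (pairState i (-1) (-1) x y)) _)

theorem oppositeMean_add_period (f : State N → ℝ) {y : ℝ} (hy : 0 ≤ y) :
    oppositeMean f (y + N) = oppositeMean f y := by
  simp only [oppositeMean, pairState_add_period _ _ hy]

end Means

/-- The stationary weight of the relative coordinate `y` of `pairState`: a uniform part on `(0, N]`,
and a part with the triangular density `N - |y|` on `(-N, N)`, written as the law of a difference of
uniform variables. -/
def relativeLaw (N v r : ℝ) : Measure ℝ :=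
  volume.restrict (Set.Ioc 0 N) + ENNReal.ofReal (r / (2 * v)) •
    ((volume.restrict (Set.Ioc 0 N)).prod (volume.restrict (Set.Ioc 0 N))).map fun p => p.1 - p.2

instance : IsFiniteMeasure (relativeLaw N v r) := by
  unfold relativeLaw
  have : IsFiniteMeasure (((volume.restrict (Set.Ioc 0 N)).prod
    (volume.restrict (Set.Ioc 0 N))).map fun p : ℝ × ℝ => p.1 - p.2) := inferInstance
  have := Measure.smul_finite (((volume.restrict (Set.Ioc 0 N)).prod
    (volume.restrict (Set.Ioc 0 N))).map fun p : ℝ × ℝ => p.1 - p.2)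
    (ENNReal.ofReal_ne_top (r := r / (2 * v)))
  infer_instance

theorem measurable_sub_prod : Measurable fun p : ℝ × ℝ => p.1 - p.2 :=
  measurable_fst.sub measurable_snd

theorem ae_relativeLaw : ∀ᵐ y ∂(relativeLaw N v r), -N < y := by
  have hN := hN.out
  rw [relativeLaw, ae_add_measure_iff]
  constructor
  · filter_upwards [ae_restrict_mem measurableSet_Ioc] with y hy
    linarith [hy.1]
  · refine Measure.ae_smul_measure ?_ _
    rw [ae_map_iff measurable_sub_prod.aemeasurable measurableSet_Ioi, Measure.prod_restrict]
    filter_upwards [ae_restrict_mem (measurableSet_Ioc.prod measurableSet_Ioc)] with p hp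
    linarith [hp.1.1, hp.2.2]

theorem integral_relativeLaw (hv : 0 < v) {f : ℝ → ℝ} (hf : Measurable f) {C : ℝ}
    (hC : ∀ y, |f y| ≤ C) : ∫ y, f y ∂(relativeLaw N v r) =
      (∫ y in (0 : ℝ)..N, f y) +
        r / (2 * v) * ∫ w in (0 : ℝ)..N, ∫ x in (0 : ℝ)..N, f (w - x) := by
  have hN := hN.out
  have hr := hr.out
  have := Measure.smul_finite (((volume.restrict (Set.Ioc 0 N)).prod
    (volume.restrict (Set.Ioc 0 N))).map fun p : ℝ × ℝ => p.1 - p.2)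
    (ENNReal.ofReal_ne_top (r := r / (2 * v)))
  rw [relativeLaw, integral_add_measure (integrable_of_bounded hf hC) (integrable_of_bounded hf hC),
    integral_smul_measure, integral_map measurable_sub_prod.aemeasurable hf.aestronglyMeasurable,
    ENNReal.toReal_ofReal (by positivity), smul_eq_mul,
    integral_prod (fun p : ℝ × ℝ => f (p.1 - p.2))
      (integrable_of_bounded (hf.comp measurable_sub_prod) fun _ => hC _)]
  simp only [intervalIntegral.integral_of_le hN.le]

/-- The asymmetry of `relativeLaw` is that of its uniform part. -/
theorem integral_relativeLaw_neg_sub (hv : 0 < v) {f : ℝ → ℝ} (hf : Measurable f) {C : ℝ}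
    (hC : ∀ y, |f y| ≤ C) : ∫ y, (f (-y) - f y) ∂(relativeLaw N v r) =
      ∫ y in (0 : ℝ)..N, (f (-y) - f y) := by
  have hN := hN.out
  rw [integral_relativeLaw hv (f := fun y => f (-y) - f y) ((hf.comp measurable_neg).sub hf)
    (C := C + C) fun y => (abs_sub _ _).trans (add_le_add (hC _) (hC _))]
  have h1 : ∫ w in (0 : ℝ)..N, ∫ x in (0 : ℝ)..N, (f (-(w - x)) - f (w - x)) = 0 := by
    simp only [intervalIntegral.integral_of_le hN.le]
    have hm := hf.comp measurable_sub_prod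
    have hm' : Measurable fun p : ℝ × ℝ => f (-(p.1 - p.2)) := hf.comp measurable_sub_prod.neg
    rw [← integral_prod (fun p : ℝ × ℝ => f (-(p.1 - p.2)) - f (p.1 - p.2))
      ((integrable_of_bounded hm' fun _ => hC _).sub (integrable_of_bounded hm fun _ => hC _)),
      integral_sub (f := fun p : ℝ × ℝ => f (-(p.1 - p.2))) (g := fun p : ℝ × ℝ => f (p.1 - p.2))
        (integrable_of_bounded hm' fun _ => hC _) (integrable_of_bounded hm fun _ => hC _),
      ← integral_prod_swap (fun p : ℝ × ℝ => f (p.1 - p.2)), sub_eq_zero]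
    simp
  rw [h1, mul_zero, add_zero]

/-- An invariant measure of the process, not normalised: the position `x` is uniform, and the relative
coordinate `y` has law `relativeLaw`, for all choices of directions. A pair of walkers with equal
directions occurs for both values of `i`, with the roles of the walkers and the sign of `y`
exchanged, while opposite directions fix `i`; hence the factor `2` for opposite directions. -/
def stationaryMeasure (N v r : ℝ) [Fact (0 < N)] : Measure (State N) :=
  ∑ i : Fin 2,
    let m := (volume : Measure (AddCircle N)).prod (relativeLaw N v r)
    (m.map (fun q => pairState i (-1) 1 q.1 q.2) + m.map (fun q => pairState i (-1) 1 q.1 q.2) +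
      (m.map (fun q => pairState i 1 1 q.1 q.2) + m.map (fun q => pairState i (-1) (-1) q.1 q.2)))

theorem measurable_pairState_prod (i : Fin 2) (a b : ℤˣ) :
    Measurable fun q : AddCircle N × ℝ => pairState i a b q.1 q.2 :=
  measurable_pairState i a b measurable_fst measurable_snd

instance : IsFiniteMeasure (stationaryMeasure N v r) := by
  unfold stationaryMeasure
  infer_instance

theorem integral_stationaryMeasure {f : State N → ℝ} (hf : Measurable f) {C : ℝ}
    (hC : ∀ φ, |f φ| ≤ C) : ∫ φ, f φ ∂(stationaryMeasure N v r) =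
      ∫ y, (2 * oppositeMean f y + parallelMean f y) ∂(relativeLaw N v r) := by
  have hint : ∀ (m : Measure (State N)) [IsFiniteMeasure m], Integrable f m := fun m _ =>
    integrable_of_bounded hf hC
  have hmap : ∀ i a b, ∫ φ, f φ ∂(((volume : Measure (AddCircle N)).prod (relativeLaw N v r)).map
      fun q => pairState i a b q.1 q.2) =
      ∫ y, (∫ x : AddCircle N, f (pairState i a b x y)) ∂(relativeLaw N v r) := fun i a b => by
    rw [integral_map (measurable_pairState_prod i a b).aemeasurable hf.aestronglyMeasurable,
      integral_prod_symm (fun q : AddCircle N × ℝ => f (pairState i a b q.1 q.2))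
        (integrable_of_bounded (hf.comp (measurable_pairState_prod i a b)) fun _ => hC _)]
  have hi : ∀ i a b, Integrable (fun y => ∫ x, f (pairState i a b x y)) (relativeLaw N v r) :=
    fun i a b => integrable_of_bounded (measurable_integral_pairState hf i a b)
      (abs_integral_pairState_le hC i a b)
  have hsum : ∀ y, 2 * oppositeMean f y + parallelMean f y =
      ∑ i, (((∫ x, f (pairState i (-1) 1 x y)) + ∫ x, f (pairState i (-1) 1 x y)) +
        ((∫ x, f (pairState i 1 1 x y)) + ∫ x, f (pairState i (-1) (-1) x y))) := fun y => by
    simp only [oppositeMean, parallelMean, Fin.sum_univ_two]; ring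
  simp_rw [hsum]
  rw [integral_finsetSum (f := fun i y =>
      ((∫ x, f (pairState i (-1) 1 x y)) + ∫ x, f (pairState i (-1) 1 x y)) +
        ((∫ x, f (pairState i 1 1 x y)) + ∫ x, f (pairState i (-1) (-1) x y)))
      _ fun i _ => ((hi i _ _).add (hi i _ _)).add ((hi i _ _).add (hi i _ _)),
    stationaryMeasure, integral_finsetSum_measure fun i _ => hint _]
  refine Finset.sum_congr rfl fun i _ => ?_
  rw [integral_add_measure (hint _) (hint _), integral_add_measure (hint _) (hint _),
    integral_add_measure (hint _) (hint _), hmap, hmap, hmap, integral_add, integral_add,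
    integral_add]
  exacts [hi i _ _, hi i _ _, hi i _ _, hi i _ _, (hi i _ _).add (hi i _ _),
    (hi i _ _).add (hi i _ _)]

end Stationary

section Stationary

variable {N v r : ℝ} [hN : Fact (0 < N)] [hr : Fact (0 < r)]

/-- The net effect of reversals on `stationaryMeasure`: it would vanish if `relativeLaw` were
symmetric. -/
theorem integral_flip_sub (hv : 0 < v) {m : State N → ℝ} (hm : Measurable m) {C : ℝ}
    (hC : ∀ φ, |m φ| ≤ C) : ∫ φ, (∑ j, (m (flip j φ) - m φ)) ∂(stationaryMeasure N v r) =
      2 * ∫ y in (0 : ℝ)..N, (oppositeMean m (-y) - oppositeMean m y) := by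
  have hfl : ∀ j, Measurable fun φ : State N => m (flip j φ) := fun j =>
    hm.comp (measurable_flip j)
  have h1 : ∀ j : Fin 2, ∫ φ, (m (flip j φ) - m φ) ∂(stationaryMeasure N v r) =
      ∫ y, (2 * (oppositeMean (fun φ => m (flip j φ)) y - oppositeMean m y) +
        (parallelMean (fun φ => m (flip j φ)) y - parallelMean m y)) ∂(relativeLaw N v r) :=
    fun j => by
      rw [integral_stationaryMeasure (f := fun φ => m (flip j φ) - m φ) ((hfl j).sub hm)
        (C := C + C) fun φ => (abs_sub _ _).trans (add_le_add (hC _) (hC _))]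
      simp only [oppositeMean_sub (hfl j) hm (fun _ => hC _) hC,
        parallelMean_sub (hfl j) hm (fun _ => hC _) hC]
  have hi : ∀ j : Fin 2, Integrable (fun y =>
      2 * (oppositeMean (fun φ => m (flip j φ)) y - oppositeMean m y) +
        (parallelMean (fun φ => m (flip j φ)) y - parallelMean m y)) (relativeLaw N v r) :=
    fun j => (((integrable_of_bounded (measurable_oppositeMean (hfl j))
      (abs_oppositeMean_le fun _ => hC _)).sub (integrable_of_bounded (measurable_oppositeMean hm)
      (abs_oppositeMean_le hC))).const_mul 2).add
      ((integrable_of_bounded (measurable_parallelMean (hfl j))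
      (abs_parallelMean_le fun _ => hC _)).sub (integrable_of_bounded (measurable_parallelMean hm)
      (abs_parallelMean_le hC)))
  rw [integral_finsetSum (f := fun (j : Fin 2) (φ : State N) => m (flip j φ) - m φ) _ fun j _ =>
    (integrable_of_bounded (hfl j) fun _ => hC _).sub (integrable_of_bounded hm hC)]
  simp_rw [h1]
  rw [← integral_finsetSum _ fun j _ => hi j, ← integral_relativeLaw_neg_sub (r := r) hv
    (measurable_oppositeMean hm) (abs_oppositeMean_le hC), ← integral_const_mul]
  refine integral_congr_ae ?_
  filter_upwards [ae_relativeLaw] with y hy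
  have e1 := sum_oppositeMean_flip m hy
  have e2 := sum_parallelMean_flip hm hC y
  rw [Fin.sum_univ_two] at e1 e2 ⊢
  linear_combination 2 * e1 + e2

/-- The free motion shifts `y` to the right, which compensates the effect of the reversals. -/
theorem forward_stationaryMeasure (hv : 0 < v) {k : State N → ℝ} (hk : Measurable k) {C : ℝ}
    (hC : ∀ φ, |k φ| ≤ C) {t : ℝ} (ht : 0 ≤ t) : ∫ φ, k φ ∂(stationaryMeasure N v r) =
      ∫ φ, k (flow v t φ) ∂(stationaryMeasure N v r) +
        r * ∫ s in (0 : ℝ)..t, ∫ φ, totalEffect v k t (s, φ) ∂(stationaryMeasure N v r) := by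
  have hN := hN.out
  have hfl : ∀ u, Measurable fun φ : State N => k (flow v u φ) := fun u =>
    hk.comp (measurable_flow measurable_const measurable_id)
  have hE : ∀ s ∈ Set.uIcc 0 t, ∫ φ, totalEffect v k t (s, φ) ∂(stationaryMeasure N v r) =
      2 * ∫ y in (0 : ℝ)..N, (oppositeMean k (-y + 2 * v * (t - s)) -
        oppositeMean k (y + 2 * v * (t - s))) := fun s hs => by
    rw [Set.uIcc_of_le ht] at hs
    have hts : 0 ≤ t - s := by linarith [hs.2]
    refine (integral_flip_sub hv (hfl (t - s)) fun _ => hC _).trans ?_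
    congr 1
    refine intervalIntegral.integral_congr_ae ?_
    have : ∀ᵐ y : ℝ, y ≠ N := by simp [ae_iff]
    filter_upwards [this] with y hyN hy
    rw [Set.uIoc_of_le hN.le] at hy
    rw [oppositeMean_flow hv k (by linarith [lt_of_le_of_ne hy.2 hyN]) hts,
      oppositeMean_flow hv k (by linarith [hy.1]) hts]
  have hψ := measurable_oppositeMean hk
  have hψC := abs_oppositeMean_le hC
  have hp := measurable_parallelMean hk
  have hpC := abs_parallelMean_le hC
  have hsh : Measurable fun y => oppositeMean k (y + 2 * v * t) :=
    hψ.comp (measurable_id.add_const _)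
  have hflow : ∫ φ, k (flow v t φ) ∂(stationaryMeasure N v r) =
      ∫ y, (2 * oppositeMean k (y + 2 * v * t) + parallelMean k y) ∂(relativeLaw N v r) := by
    rw [integral_stationaryMeasure (hfl t) fun _ => hC _]
    refine integral_congr_ae ?_
    filter_upwards [ae_relativeLaw] with y hy
    rw [oppositeMean_flow hv k hy ht, parallelMean_flow]
  rw [intervalIntegral.integral_congr hE, hflow, integral_stationaryMeasure hk hC,
    integral_add ((integrable_of_bounded hψ hψC).const_mul 2) (integrable_of_bounded hp hpC),
    integral_add ((integrable_of_bounded hsh fun _ => hψC _).const_mul 2)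
      (integrable_of_bounded hp hpC), integral_const_mul, integral_const_mul,
    integral_relativeLaw hv hψ hψC, integral_relativeLaw hv hsh fun _ => hψC _,
    intervalIntegral.integral_const_mul]
  linear_combination 2 * triangle_average_eq (r := r) hψ hψC
    (fun y hy => oppositeMean_add_period k hy) hv ht

theorem stationaryMeasure_univ_ne_zero (hv : 0 < v) : stationaryMeasure N v r Set.univ ≠ 0 := by
  have hN := hN.out
  have hr := hr.out
  intro h
  have h1 : ∫ _, (1 : ℝ) ∂(stationaryMeasure N v r) = 0 := by
    simp [Measure.measure_univ_eq_zero.1 h]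
  rw [integral_stationaryMeasure measurable_const (C := 1) (fun _ => by simp)] at h1
  simp only [oppositeMean, parallelMean, integral_const, Measure.real, AddCircle.measure_univ,
    ENNReal.toReal_ofReal hN.le, smul_eq_mul, mul_one, Fin.sum_univ_two] at h1
  have h2 := integral_relativeLaw (N := N) (r := r) hv
    (measurable_const : Measurable fun _ : ℝ => 2 * (N + N) + (N + N + (N + N))) (fun _ => le_rfl)
  rw [integral_const, Measure.real, smul_eq_mul, h1] at h2
  simp only [intervalIntegral.integral_const, smul_eq_mul] at h2
  have : 0 < (N - 0) * (2 * (N + N) + (N + N + (N + N))) + r / (2 * v) * ((N - 0) *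
    ((N - 0) * (2 * (N + N) + (N + N + (N + N))))) := by rw [sub_zero]; positivity
  linarith

theorem ae_coe_ne_zero : ∀ᵐ y : ℝ, (y : AddCircle N) ≠ 0 := by
  have : {y : ℝ | (y : AddCircle N) = 0} ⊆ Set.range fun n : ℤ => n • N := fun y hy =>
    (AddCircle.coe_eq_zero_iff N).1 hy
  rw [ae_iff]
  simpa using ((Set.countable_range _).mono this).measure_zero volume

theorem stationaryMeasure_together (hv : 0 < v) : stationaryMeasure N v r (together N) = 0 := by
  have hm : Measurable ((together N).indicator (1 : State N → ℝ)) :=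
    measurable_one.indicator measurableSet_together
  have hC : ∀ φ, |(together N).indicator (1 : State N → ℝ) φ| ≤ 1 := fun φ => by
    by_cases h : φ ∈ together N <;> simp [h]
  have h := integral_stationaryMeasure (v := v) (r := r) hm hC
  rw [integral_indicator_one measurableSet_together] at h
  have hzero : ∀ y : ℝ, (y : AddCircle N) ≠ 0 →
      2 * oppositeMean ((together N).indicator (1 : State N → ℝ)) y +
        parallelMean ((together N).indicator (1 : State N → ℝ)) y = 0 := fun y hy => by
    have : ∀ i a b x, (together N).indicator (1 : State N → ℝ) (pairState i a b x y) = 0 :=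
      fun i a b x => Set.indicator_of_notMem (fun hmem => hy (by
        have := (eq_iff_of_add_one
          (fun l => if l = i then x else x + (y : AddCircle N)) i).1 hmem.1
        simpa using this)) _
    simp [oppositeMean, parallelMean, this]
  rw [integral_relativeLaw hv (f := fun y =>
    2 * oppositeMean ((together N).indicator (1 : State N → ℝ)) y +
      parallelMean ((together N).indicator (1 : State N → ℝ)) y) (((measurable_oppositeMean hm).const_mul 2).add
    (measurable_parallelMean hm)) (C := 2 * (2 * (1 * N)) + 4 * (1 * N)) fun y =>
      (abs_add_le _ _).trans (add_le_add (by
        rw [abs_mul, abs_two]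
        linarith [abs_oppositeMean_le hC y]) (abs_parallelMean_le hC y)),
    intervalIntegral.integral_congr_ae (g := fun _ => 0) (by
      filter_upwards [ae_coe_ne_zero (N := N)] with y hy _ using hzero y hy)] at h
  have h2 : ∀ w, ∫ x in (0 : ℝ)..N,
      (2 * oppositeMean ((together N).indicator (1 : State N → ℝ)) (w - x) +
        parallelMean ((together N).indicator (1 : State N → ℝ)) (w - x)) = 0 := fun w => by
    rw [intervalIntegral.integral_congr_ae (g := fun _ => 0), intervalIntegral.integral_zero]
    have := (Measure.measurePreserving_sub_left volume w).quasiMeasurePreserving.ae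
      (ae_coe_ne_zero (N := N))
    filter_upwards [this] with x hx _ using hzero _ hx
  simp only [h2, intervalIntegral.integral_zero, mul_zero, add_zero] at h
  exact (measureReal_eq_zero_iff).1 h

/-- The process has an invariant probability measure. -/
theorem exists_map_jumpProcess_eq (hv : 0 < v) : ∃ π : Measure (State N), IsProbabilityMeasure π ∧
    ∀ t : ℝ, 0 ≤ t → (π.prod (waitingLaw r)).map (fun q => jumpProcess v q.2 q.1 t) = π := by
  have hne := stationaryMeasure_univ_ne_zero (N := N) (r := r) hv
  have : NeZero (stationaryMeasure N v r) := ⟨fun h => hne (by simp [h])⟩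
  refine ⟨(stationaryMeasure N v r Set.univ)⁻¹ • stationaryMeasure N v r,
    isProbabilityMeasureSMul, fun t ht => ?_⟩
  have hP : IsProbabilityMeasure
    ((stationaryMeasure N v r Set.univ)⁻¹ • stationaryMeasure N v r) := isProbabilityMeasureSMul
  refine map_jumpProcess_of_isStationary hv (fun k C t hk hC ht => ?_) ?_ ht
  · simp only [integral_smul_measure, smul_eq_mul, forward_stationaryMeasure (r := r) hv hk hC ht,
      intervalIntegral.integral_const_mul]
    ring
  · simp [stationaryMeasure_together hv]

end Stationary

/-! ### A potential for the message direction -/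

section Primitive

variable {N : ℝ} [hN : Fact (0 < N)]

/-- The product of the lengths of the two arcs between `0` and a point of the circle. -/
def arcProduct (y : AddCircle N) : ℝ := rep y * (N - rep y)

theorem continuous_arcProduct : Continuous (arcProduct : AddCircle N → ℝ) := by
  have : Continuous (AddCircle.liftIco N 0 fun x : ℝ => x * (N - x)) :=
    AddCircle.liftIco_zero_continuous (by simp) (by fun_prop)
  exact this

theorem hasDerivWithinAt_rep_coe (s : ℝ) :
    HasDerivWithinAt (fun s : ℝ => rep (s : AddCircle N)) 1 (Set.Ioi s) s := by
  have h1 : HasDerivWithinAt (fun u : ℝ => rep (s : AddCircle N) + (u - s)) 1 (Set.Ioi s) s :=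
    (((hasDerivAt_id s).sub_const s).const_add _).hasDerivWithinAt
  refine h1.congr_of_eventuallyEq ?_ (by simp)
  have hlt := rep_lt (s : AddCircle N)
  filter_upwards [Ioo_mem_nhdsGT (show s < s + (N - rep (s : AddCircle N)) by linarith)] with u hu
  have : (u : AddCircle N) = ((rep (s : AddCircle N) + (u - s) : ℝ) : AddCircle N) := by
    rw [AddCircle.coe_add, coe_rep, ← AddCircle.coe_add]; congr 1; ring
  rw [this, rep_coe (by linarith [rep_nonneg (s : AddCircle N), hu.1]) (by linarith [hu.2])]

theorem measurable_rep_coe : Measurable fun s : ℝ => rep (s : AddCircle N) :=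
  measurable_rep.comp AddCircle.measurable_mk'

theorem abs_rep_le (y : AddCircle N) : |rep y| ≤ N := by
  rw [abs_of_nonneg (rep_nonneg y)]; exact (rep_lt y).le

/-- `arcProduct` changes along the circle at the rate `N - 2 * rep`. -/
theorem integral_rep_coe (v a : ℝ) (u : ℝ) (hv : 0 < v) :
    ∫ w in (0 : ℝ)..u, (N - 2 * rep ((a + 2 * v * w : ℝ) : AddCircle N)) * (2 * v) =
      arcProduct ((a + 2 * v * u : ℝ) : AddCircle N) - arcProduct (a : AddCircle N) := by
  have hc : Continuous fun w : ℝ => arcProduct ((a + 2 * v * w : ℝ) : AddCircle N) :=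
    continuous_arcProduct.comp ((AddCircle.continuous_mk' N).comp (by fun_prop))
  have h := intervalIntegral.integral_eq_sub_of_hasDeriv_right (a := 0) (b := u)
    (f := fun w : ℝ => arcProduct ((a + 2 * v * w : ℝ) : AddCircle N))
    (f' := fun w => (N - 2 * rep ((a + 2 * v * w : ℝ) : AddCircle N)) * (2 * v))
    hc.continuousOn (fun w _ => ?_) ?_
  · simpa using h
  · have h1 : HasDerivWithinAt (fun w : ℝ => a + 2 * v * w) (2 * v) (Set.Ioi w) w := by
      simpa using (((hasDerivAt_id w).const_mul (2 * v)).const_add a).hasDerivWithinAt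
    have h2 := (hasDerivWithinAt_rep_coe (N := N) (a + 2 * v * w)).comp w h1
      (fun x (hx : w < x) => by
        have := mul_lt_mul_of_pos_left hx (by positivity : 0 < 2 * v)
        simpa using this)
    refine (h2.mul (h2.const_sub N)).congr_deriv ?_
    simp only [Function.comp]
    ring
  · exact intervalIntegrable_of_bounded (C := (N + 2 * N) * (2 * v))
      ((measurable_const.sub ((measurable_rep_coe.comp (by fun_prop)).const_mul 2)).mul_const _)
      (fun w => by
        rw [abs_mul, abs_of_pos (by positivity : 0 < 2 * v)]
        refine mul_le_mul_of_nonneg_right ((abs_sub _ _).trans (add_le_add ?_ ?_)) (by positivity)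
        · rw [abs_of_pos hN.out]
        · rw [abs_mul, abs_two]
          exact mul_le_mul_of_nonneg_left (abs_rep_le _) zero_le_two) _ _

theorem arcProduct_zero : arcProduct (0 : AddCircle N) = 0 := by simp [arcProduct]

theorem arcProduct_coe {a : ℝ} (h0 : 0 ≤ a) (h1 : a < N) :
    arcProduct (a : AddCircle N) = a * (N - a) := by rw [arcProduct, rep_coe h0 h1]

end Primitive

section Potential

variable {N v r : ℝ} [hN : Fact (0 < N)] [hr : Fact (0 < r)]

/-- The average of the message direction. -/
def meanDir (N v r : ℝ) : ℝ := v / (2 * v + r * N)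

/-- The potential as a function of the difference `y` of the positions of the carrier and the other
walker and of their directions `s` and `s'`. For opposite directions the first term is
the potential while the message moves clockwise; the second one is added while it moves
counter-clockwise, and it is used up when the message is passed. For equal directions half of the
second term is present, and the third one, which vanishes for opposite directions. -/
def rawPotential (N v r : ℝ) [Fact (0 < N)] (y : AddCircle N) (s s' : ℝ) : ℝ :=
  r * meanDir N v r / (2 * v ^ 2) * arcProduct y +
    2 * meanDir N v r / v * rep y * ((2 - s + s') / 4) +
    (1 + s * s') * (meanDir N v r - s) / (4 * r)

/-- A solution of the Poisson equation for the message direction: along the process, `potential`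
compensates the deviation of the time integral of the message direction from its mean. -/
def potential (v r : ℝ) (φ : State N) : ℝ :=
  rawPotential N v r (φ.pos φ.carrier - φ.pos (φ.carrier + 1)) (sgn (φ.dir φ.carrier))
    (sgn (φ.dir (φ.carrier + 1)))

theorem sgn_mul_self (e : ℤˣ) : sgn e * sgn e = 1 := by
  rcases Int.units_eq_one_or e with rfl | rfl <;> simp

theorem sgn_add_one {d : Fin 2 → ℤˣ} (hd : d 0 ≠ d 1) (i : Fin 2) : sgn (d (i + 1)) = -sgn (d i) := by
  rw [← sgn_neg]
  congr 1
  have := apply_clockwiseWalker hd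
  have h' := apply_clockwiseWalker_add_one hd
  generalize clockwiseWalker d = c at *
  by_cases h : i = c
  · subst h; rw [this, h']
  · rw [Fin.eq_add_one_of_ne h, add_one_add_one, this, h', neg_neg]

/-- The potential takes the same value for both carriers at an encounter. -/
theorem potential_mkState (x : Fin 2 → AddCircle N) (d : Fin 2 → ℤˣ) (i : Fin 2) :
    potential v r (mkState x d i) =
      rawPotential N v r (x i - x (i + 1)) (sgn (d i)) (sgn (d (i + 1))) := by
  by_cases h : Encounter x d
  · have h0 : ∀ i : Fin 2, x i - x (i + 1) = 0 := fun i => by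
      rw [sub_eq_zero, eq_comm, ← eq_iff_of_add_one]; exact h.1
    rw [potential, mkState_carrier_of_encounter _ h]
    simp only [mkState_pos, mkState_dir, h0, rawPotential, sgn_add_one h.2, rep_zero,
      arcProduct_zero]
    have h1 := sgn_mul_self (d i)
    have h2 := sgn_mul_self (d (clockwiseWalker d))
    simp only [mul_neg, h1, h2]
    ring
  · rw [potential, mkState_carrier_of_not _ h]; rfl

theorem measurable_potential : Measurable (potential v r : State N → ℝ) := by
  have hc := measurable_carrier (N := N)
  have hc' : Measurable fun φ : State N => φ.carrier + 1 :=
    (measurable_of_countable fun c : Fin 2 => c + 1).comp hc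
  have hy : Measurable fun φ : State N => φ.pos φ.carrier - φ.pos (φ.carrier + 1) :=
    (measurable_apply_index measurable_pos hc).sub (measurable_apply_index measurable_pos hc')
  have hs := measurable_sgn.comp (measurable_apply_index (measurable_dir (N := N)) hc)
  have hs' := measurable_sgn.comp (measurable_apply_index (measurable_dir (N := N)) hc')
  exact (((continuous_arcProduct.measurable.comp hy).const_mul _).add
    (((measurable_rep.comp hy).const_mul _).mul (((hs.const_sub 2).add hs').div_const 4))).add
    (((hs.mul hs').const_add 1).mul (hs.const_sub _) |>.div_const _)

theorem exists_abs_potential_le : ∃ C : ℝ, ∀ φ : State N, |potential v r φ| ≤ C := by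
  set A := r * meanDir N v r / (2 * v ^ 2)
  set B := 2 * meanDir N v r / v
  set c := meanDir N v r
  have hN := hN.out
  refine ⟨|A| * (N * N) + |B| * N * 1 + 2 * (|c| + 1) / |4 * r|, fun φ => ?_⟩
  unfold potential
  generalize φ.pos φ.carrier - φ.pos (φ.carrier + 1) = y
  have hs := abs_sgn (φ.dir φ.carrier)
  have hs' := abs_sgn (φ.dir (φ.carrier + 1))
  generalize sgn (φ.dir φ.carrier) = s at *
  generalize sgn (φ.dir (φ.carrier + 1)) = s' at *
  have h0 := rep_nonneg y
  have h1 := rep_lt y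
  refine (abs_add_three _ _ _).trans (add_le_add (add_le_add ?_ ?_) ?_)
  · rw [abs_mul, arcProduct, abs_mul, abs_of_nonneg h0, abs_of_nonneg (sub_nonneg.2 h1.le)]
    gcongr
    linarith
  · rw [abs_mul, abs_mul]
    gcongr
    · exact abs_rep_le y
    · have := abs_le.1 hs.le
      have := abs_le.1 hs'.le
      rw [abs_le]
      constructor <;> linarith
  · rw [abs_div, abs_mul]
    gcongr
    · refine (abs_add_le _ _).trans ?_
      rw [abs_mul, hs, hs']; norm_num
    · exact (abs_sub _ _).trans (by rw [hs])

/-- The change of the potential at a reversal of walker `j`. -/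
def potentialJump (v r : ℝ) (j : Fin 2) (φ : State N) : ℝ :=
  potential v r (flip j φ) - potential v r φ

/-- The deviation of the message direction from its mean, minus the compensator of the jumps of the
potential. -/
def potentialDrift (v r : ℝ) (φ : State N) : ℝ :=
  φ.messageDir - meanDir N v r - r * ∑ j, potentialJump v r j φ

theorem potentialDrift_eq (φ : State N) : potentialDrift v r φ =
    (sgn (φ.dir φ.carrier) - sgn (φ.dir (φ.carrier + 1))) / 2 -
      meanDir N v r * (1 - sgn (φ.dir φ.carrier) * sgn (φ.dir (φ.carrier + 1))) -
      r * (2 * meanDir N v r / v) * rep (φ.pos φ.carrier - φ.pos (φ.carrier + 1)) *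
        ((sgn (φ.dir φ.carrier) - sgn (φ.dir (φ.carrier + 1))) / 2) := by
  have hne := add_one_ne φ.carrier
  rw [potentialDrift, sum_fin_two_add_one _ φ.carrier]
  simp only [potentialJump, flip, potential_mkState, Function.update_self,
    Function.update_of_ne hne, Function.update_of_ne hne.symm, sgn_neg]
  rw [potential, State.messageDir_eq]
  have hr : r ≠ 0 := hr.out.ne'
  rcases Int.units_eq_one_or (φ.dir φ.carrier) with h | h <;>
    rcases Int.units_eq_one_or (φ.dir (φ.carrier + 1)) with h' | h' <;>
    simp only [h, h', rawPotential, sgn_one, sgn_neg_one] <;>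
    generalize 2 * meanDir N v r / v = β <;> field_simp <;> ring

theorem measurable_potentialJump (j : Fin 2) : Measurable (potentialJump v r j : State N → ℝ) :=
  (measurable_potential.comp (measurable_flip j)).sub measurable_potential

theorem exists_abs_potentialJump_le :
    ∃ C : ℝ, ∀ (j : Fin 2) (φ : State N), |potentialJump v r j φ| ≤ C := by
  obtain ⟨C, hC⟩ := exists_abs_potential_le (N := N) (v := v) (r := r)
  exact ⟨C + C, fun j φ => (abs_sub _ _).trans (add_le_add (hC _) (hC _))⟩

theorem abs_messageDir (φ : State N) : |φ.messageDir| = 1 := abs_sgn _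

theorem measurable_potentialDrift : Measurable (potentialDrift v r : State N → ℝ) :=
  (measurable_messageDir.sub_const _).sub
    ((Finset.measurable_sum _ fun j _ => measurable_potentialJump j).const_mul r)

theorem exists_abs_potentialDrift_le : ∃ C : ℝ, ∀ φ : State N, |potentialDrift v r φ| ≤ C := by
  obtain ⟨C, hC⟩ := exists_abs_potentialJump_le (N := N) (v := v) (r := r)
  refine ⟨1 + |meanDir N v r| + |r| * (C + C), fun φ => ?_⟩
  refine (abs_sub _ _).trans (add_le_add ((abs_sub _ _).trans ?_) ?_)
  · rw [abs_messageDir]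
  · rw [abs_mul, Fin.sum_univ_two]
    exact mul_le_mul_of_nonneg_left ((abs_add_le _ _).trans (add_le_add (hC _ _) (hC _ _)))
      (abs_nonneg _)

theorem carrierFree_potential : CarrierFree (potential v r : State N → ℝ) := by
  intro φ ψ h1 h2 h3
  rw [← mkState_self φ, ← mkState_self ψ, potential_mkState, potential_mkState, ← h1, ← h2]
  have h0 : ∀ i : Fin 2, φ.pos i - φ.pos (i + 1) = 0 := fun i => by
    rw [sub_eq_zero, eq_comm, ← eq_iff_of_add_one]; exact h3
  rw [h0, h0]
  by_cases hd : φ.dir 0 = φ.dir 1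
  · have : ∀ i, φ.dir i = φ.dir 0 := by
      intro i; fin_cases i
      · rfl
      · exact hd.symm
    simp only [this]
  · simp only [sgn_add_one hd, rawPotential, rep_zero, mul_neg, sgn_mul_self]
    ring

/-- `potentialDrift` is the derivative of the potential under free motion, where the message moves
clockwise at the beginning. -/
theorem integral_potentialDrift_flow_of_clockwise (hv : 0 < v) {φ : State N}
    (hd : φ.dir 0 ≠ φ.dir 1) (hφ : φ.carrier = clockwiseWalker φ.dir) {u : ℝ} (hu : 0 ≤ u) :
    ∫ w in (0 : ℝ)..u, potentialDrift v r (flow v w φ) =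
      potential v r (flow v u φ) - potential v r φ := by
  have hN := hN.out
  have hr := hr.out
  have hcar : ∀ w, 0 ≤ w → (flow v w φ).carrier = clockwiseWalker φ.dir := fun w hw => by
    rw [flow_carrier hv hw, hφ, ite_self]
  have h1 := apply_clockwiseWalker hd
  have h2 := apply_clockwiseWalker_add_one hd
  set i := clockwiseWalker φ.dir
  set a := rep (φ.pos i - φ.pos (i + 1)) with ha
  have hpos : ∀ w, moved v φ.pos φ.dir w i - moved v φ.pos φ.dir w (i + 1) =
      ((a + 2 * v * w : ℝ) : AddCircle N) := fun w => by
    rw [AddCircle.coe_add, ha, coe_rep, moved, moved, h1, h2, sgn_one, sgn_neg_one]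
    have : 2 * v * w = w * (v * 1) - w * (v * -1) := by ring
    rw [this, AddCircle.coe_sub]
    abel
  have hpot : ∀ w, 0 ≤ w → potential v r (flow v w φ) =
      r * meanDir N v r / (2 * v ^ 2) * arcProduct ((a + 2 * v * w : ℝ) : AddCircle N) :=
    fun w hw => by
      rw [potential, hcar w hw, flow_pos, flow_dir, hpos, h1, h2, sgn_one, sgn_neg_one,
        rawPotential]
      ring
  have hdrift : ∀ w ∈ Set.uIcc 0 u, potentialDrift v r (flow v w φ) =
      r * meanDir N v r / (2 * v ^ 2) *
        ((N - 2 * rep ((a + 2 * v * w : ℝ) : AddCircle N)) * (2 * v)) := fun w hw => by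
    rw [Set.uIcc_of_le hu] at hw
    -- the constant terms agree because `meanDir N v r * (2 + r * N / v) = 1`
    rw [potentialDrift_eq, hcar w hw.1, flow_pos, flow_dir, hpos, h1, h2, sgn_one, sgn_neg_one,
      meanDir]
    field_simp
    ring
  have h0 := hpot 0 le_rfl
  rw [flow_zero hv, mul_zero, add_zero] at h0
  rw [intervalIntegral.integral_congr hdrift, intervalIntegral.integral_const_mul,
    integral_rep_coe v a u hv, hpot u hu, h0]
  ring

/-- `potentialDrift` is the derivative of the potential under free motion, where the message moves
counter-clockwise and is not passed. -/
theorem integral_potentialDrift_flow_of_le_hit (hv : 0 < v) {φ : State N}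
    (hd : φ.dir 0 ≠ φ.dir 1) (hφ : φ.carrier = clockwiseWalker φ.dir + 1) {u : ℝ} (hu : 0 ≤ u)
    (huh : u ≤ hit v φ.pos φ.dir) :
    ∫ w in (0 : ℝ)..u, potentialDrift v r (flow v w φ) =
      potential v r (flow v u φ) - potential v r φ := by
  have hN := hN.out
  have hr := hr.out
  have h1 := apply_clockwiseWalker hd
  have h2 := apply_clockwiseWalker_add_one hd
  have hcar : ∀ w, 0 ≤ w → w < hit v φ.pos φ.dir →
      (flow v w φ).carrier = clockwiseWalker φ.dir + 1 := fun w hw hw' => by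
    rw [flow_carrier hv hw, if_neg fun h => hw'.not_ge h.2, hφ]
  have hraw : ∀ w, 0 ≤ w → w ≤ hit v φ.pos φ.dir → flow v w φ =
      mkState (moved v φ.pos φ.dir w) φ.dir (clockwiseWalker φ.dir + 1) := fun w hw hw' => by
    rw [flow, step, if_neg fun h => hw'.not_gt h.2, hφ]
  set i := clockwiseWalker φ.dir
  set a := rep (φ.pos (i + 1) - φ.pos i) with ha
  have hh : hit v φ.pos φ.dir = a / (2 * v) := rfl
  have hrange : ∀ w, 0 ≤ w → w ≤ hit v φ.pos φ.dir → 0 ≤ a - 2 * v * w ∧ a - 2 * v * w < N :=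
    fun w hw hw' => by
      rw [hh, le_div_iff₀ (by positivity)] at hw'
      have := rep_lt (φ.pos (i + 1) - φ.pos i)
      have : 0 ≤ 2 * v * w := by positivity
      constructor <;> linarith
  have hpos : ∀ w, moved v φ.pos φ.dir w (i + 1) - moved v φ.pos φ.dir w i =
      ((a - 2 * v * w : ℝ) : AddCircle N) := fun w => by
    rw [AddCircle.coe_sub, ha, coe_rep, moved, moved, h1, h2, sgn_one, sgn_neg_one]
    have : 2 * v * w = w * (v * 1) - w * (v * -1) := by ring
    rw [this, AddCircle.coe_sub]
    abel
  have hpot : ∀ w, 0 ≤ w → w ≤ hit v φ.pos φ.dir → potential v r (flow v w φ) =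
      r * meanDir N v r / (2 * v ^ 2) * ((a - 2 * v * w) * (N - (a - 2 * v * w))) +
        2 * meanDir N v r / v * (a - 2 * v * w) := fun w hw hw' => by
    obtain ⟨b1, b2⟩ := hrange w hw hw'
    rw [hraw w hw hw', potential_mkState, add_one_add_one, hpos, h1, h2, sgn_one, sgn_neg_one,
      rawPotential, arcProduct_coe b1 b2, rep_coe b1 b2]
    ring
  have hdrift : ∀ w, 0 ≤ w → w < hit v φ.pos φ.dir → potentialDrift v r (flow v w φ) =
      r * meanDir N v r / (2 * v ^ 2) *
        ((2 * (a - 2 * v * w) - N) * (2 * v)) - 4 * meanDir N v r := fun w hw hw' => by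
    obtain ⟨b1, b2⟩ := hrange w hw hw'.le
    rw [potentialDrift_eq, hcar w hw hw', flow_pos, flow_dir, add_one_add_one, hpos, h1, h2,
      sgn_one, sgn_neg_one, rep_coe b1 b2, meanDir]
    field_simp
    ring
  have hae : ∀ᵐ w : ℝ, w ≠ u := by simp [ae_iff]
  rw [intervalIntegral.integral_congr_ae (g := fun w => r * meanDir N v r / (2 * v ^ 2) *
        ((2 * (a - 2 * v * w) - N) * (2 * v)) - 4 * meanDir N v r) (by
      filter_upwards [hae] with w hw hw'
      rw [Set.uIoc_of_le hu] at hw'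
      exact hdrift w hw'.1.le ((lt_of_le_of_ne hw'.2 hw).trans_le huh))]
  have h0 := hpot 0 le_rfl (hit_nonneg hv _ _)
  rw [flow_zero hv, mul_zero, sub_zero] at h0
  rw [hpot u hu huh, h0]
  have hderiv : ∀ w : ℝ, HasDerivAt (fun w : ℝ => r * meanDir N v r / (2 * v ^ 2) *
      ((a - 2 * v * w) * (N - (a - 2 * v * w))) + 2 * meanDir N v r / v * (a - 2 * v * w))
      (r * meanDir N v r / (2 * v ^ 2) *
        ((2 * (a - 2 * v * w) - N) * (2 * v)) - 4 * meanDir N v r) w := fun w => by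
    have e1 : HasDerivAt (fun w : ℝ => a - 2 * v * w) (-(2 * v)) w := by
      simpa using ((hasDerivAt_id w).const_mul (2 * v)).const_sub a
    refine ((e1.mul (e1.const_sub N)).const_mul _ |>.add (e1.const_mul _)).congr_deriv ?_
    field_simp
    ring
  rw [intervalIntegral.integral_eq_sub_of_hasDerivAt (fun w _ => hderiv w)
    (Continuous.intervalIntegrable (by fun_prop) _ _)]
  simp

theorem intervalIntegrable_potentialDrift_flow (φ : State N) (a b : ℝ) :
    IntervalIntegrable (fun w => potentialDrift v r (flow v w φ)) volume a b := by
  obtain ⟨C, hC⟩ := exists_abs_potentialDrift_le (N := N) (v := v) (r := r)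
  exact intervalIntegrable_of_bounded
    (measurable_potentialDrift.comp (measurable_flow measurable_id measurable_const))
    (fun _ => hC _) _ _

/-- `potentialDrift` is the derivative of the potential under free motion, also across encounters. -/
theorem integral_potentialDrift_flow (hv : 0 < v) (φ : State N) {u : ℝ} (hu : 0 ≤ u) :
    ∫ w in (0 : ℝ)..u, potentialDrift v r (flow v w φ) =
      potential v r (flow v u φ) - potential v r φ := by
  by_cases hd : φ.dir 0 = φ.dir 1
  · have hdir : ∀ i, φ.dir i = φ.dir 0 := by
      intro i; fin_cases i
      · rfl
      · exact hd.symm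
    have hcar : ∀ w, 0 ≤ w → (flow v w φ).carrier = φ.carrier := fun w hw => by
      rw [flow_carrier hv hw, if_neg fun h => h.1 hd]
    have hdrift : ∀ w, potentialDrift v r (flow v w φ) = 0 := fun w => by
      simp only [potentialDrift_eq, flow_dir, hdir, sgn_mul_self]
      ring
    have hpot : potential v r (flow v u φ) = potential v r φ := by
      rw [potential, potential, hcar u hu]
      simp [moved, hdir]
    simp [hdrift, hpot]
  · by_cases hφ : φ.carrier = clockwiseWalker φ.dir
    · exact integral_potentialDrift_flow_of_clockwise hv hd hφ hu
    · have hφ' := Fin.eq_add_one_of_ne hφ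
      rcases le_total u (hit v φ.pos φ.dir) with h | h
      · exact integral_potentialDrift_flow_of_le_hit hv hd hφ' hu h
      · -- after the encounter the message moves clockwise
        have hh := hit_nonneg hv φ.pos φ.dir
        set s := hit v φ.pos φ.dir with hs
        have e1 := integral_potentialDrift_flow_of_le_hit (r := r) hv hd hφ' hh le_rfl
        have e2 := integral_potentialDrift_flow_of_clockwise (r := r) hv (φ := flow v s φ) hd
          (by rw [flow_carrier hv hh, if_pos ⟨hd, le_rfl⟩]; rfl) (sub_nonneg.2 h)
        rw [flow_flow hv hh (sub_nonneg.2 h), add_sub_cancel] at e2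
        rw [← intervalIntegral.integral_add_adjacent_intervals
          (intervalIntegrable_potentialDrift_flow φ 0 s)
          (intervalIntegrable_potentialDrift_flow φ s u), e1]
        have e3 : ∫ w in s..u, potentialDrift v r (flow v w φ) =
            ∫ w in (0 : ℝ)..(u - s), potentialDrift v r (flow v w (flow v s φ)) := by
          have : ∀ w ∈ Set.uIcc 0 (u - s), potentialDrift v r (flow v w (flow v s φ)) =
              potentialDrift v r (flow v (s + w) φ) := fun w hw => by
            rw [Set.uIcc_of_le (sub_nonneg.2 h)] at hw
            rw [flow_flow hv hh hw.1]
          rw [intervalIntegral.integral_congr this, intervalIntegral.integral_comp_add_left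
            (fun w => potentialDrift v r (flow v w φ))]
          simp
        rw [e3, e2]
        ring

end Potential

section Decomposition

variable {N v r : ℝ} [hN : Fact (0 < N)] [hr : Fact (0 < r)] {τ : Fin 2 × ℕ → ℝ} {φ : State N}

theorem intervalIntegrable_along {f : State N → ℝ} (hf : Measurable f) {C : ℝ}
    (hC : ∀ φ, |f φ| ≤ C) (a b : ℝ) :
    IntervalIntegrable (fun s => f (jumpProcess v τ φ s)) volume a b :=
  intervalIntegrable_of_bounded
    (hf.comp (measurable_jumpProcess measurable_const measurable_const measurable_id))
    (fun _ => hC _) _ _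

theorem integral_potentialDrift_of_free (hv : 0 < v) (h : Good τ) {a b : ℝ} (ha : 0 ≤ a)
    (hab : a ≤ b) (hfree : ∀ s, a ≤ s → s < b →
      process v τ φ s = flow v (s - a) (process v τ φ a)) :
    ∫ s in a..b, potentialDrift v r (jumpProcess v τ φ s) =
      potential v r (flow v (b - a) (process v τ φ a)) - potential v r (process v τ φ a) := by
  rw [← integral_potentialDrift_flow hv _ (sub_nonneg.2 hab)]
  have hsub := intervalIntegral.integral_comp_sub_right (a := a) (b := b)
    (fun w => potentialDrift v r (flow v w (process v τ φ a))) a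
  rw [sub_self] at hsub
  rw [← hsub]
  refine intervalIntegral.integral_congr_ae ?_
  have hae : ∀ᵐ s : ℝ, s ≠ b := by simp [ae_iff]
  filter_upwards [hae] with s hs hs'
  rw [Set.uIoc_of_le hab] at hs'
  rw [← process_eq_jumpProcess hv h (ha.trans hs'.1.le),
    hfree s hs'.1.le (lt_of_le_of_ne hs'.2 hs)]

/-- The deviation of the time integral of the message direction from its mean is a bounded term plus
compensated sums of jumps. -/
theorem integral_messageDir_sub (hv : 0 < v) (h : Good τ)
    (hne : ∀ k l, arrival τ 0 (k + 1) ≠ arrival τ 1 (l + 1)) (φ : State N) {t : ℝ} (ht : 0 ≤ t) :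
    (∫ s in (0 : ℝ)..t, (jumpProcess v τ φ s).messageDir) - meanDir N v r * t =
      potential v r (jumpProcess v τ φ t) - potential v r φ -
        ∑ j, (jumpSum v (fun p => potentialJump v r j p.2) φ j t τ -
          r * timeIntegral v (fun p => potentialJump v r j p.2) φ t τ) := by
  obtain ⟨C, hC⟩ := exists_abs_potentialDrift_le (N := N) (v := v) (r := r)
  obtain ⟨C', hC'⟩ := exists_abs_potentialJump_le (N := N) (v := v) (r := r)
  have hi : ∀ a b, IntervalIntegrable (fun s => potentialDrift v r (jumpProcess v τ φ s))
    volume a b := intervalIntegrable_along measurable_potentialDrift hC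
  have hadd : ∀ a b, (∫ s in (0 : ℝ)..b, potentialDrift v r (jumpProcess v τ φ s)) -
      ∫ s in (0 : ℝ)..a, potentialDrift v r (jumpProcess v τ φ s) =
      ∫ s in a..b, potentialDrift v r (jumpProcess v τ φ s) := fun a b =>
    intervalIntegral.integral_interval_sub_left (hi 0 b) (hi 0 a)
  have key := sub_eq_sum_jumps (T := t) h hne
    (y := fun s => potential v r (process v τ φ s) -
      ∫ s in (0 : ℝ)..s, potentialDrift v r (jumpProcess v τ φ s))
    (J := fun j n => potentialJump v r j (preJump v τ φ j n (τ (j, n)))) ?_ ?_ ht le_rfl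
  · have hD : ∫ s in (0 : ℝ)..t, potentialDrift v r (jumpProcess v τ φ s) =
        (∫ s in (0 : ℝ)..t, (jumpProcess v τ φ s).messageDir) - meanDir N v r * t -
          ∑ j, r * timeIntegral v (fun p => potentialJump v r j p.2) φ t τ := by
      have i1 := intervalIntegrable_along (v := v) (τ := τ) (φ := φ) measurable_messageDir
        (C := 1) (fun ψ => (abs_messageDir ψ).le) 0 t
      have i2 := fun j => intervalIntegrable_along (v := v) (τ := τ) (φ := φ)
        (measurable_potentialJump (v := v) (r := r) j) (hC' j) 0 t
      simp only [potentialDrift]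
      rw [intervalIntegral.integral_sub (i1.sub intervalIntegrable_const)
        (IntervalIntegrable.const_mul (by
          simpa only [Fin.sum_univ_two] using (i2 0).add (i2 1)) r),
        intervalIntegral.integral_sub i1 intervalIntegrable_const,
        intervalIntegral.integral_const_mul, intervalIntegral.integral_finsetSum fun j _ => i2 j,
        intervalIntegral.integral_const, ← Finset.mul_sum]
      simp only [timeIntegral, smul_eq_mul, sub_zero, mul_comm]
    have h0 : process v τ φ 0 = φ := process_zero h
    simp only [h0, intervalIntegral.integral_same, sub_zero, process_eq_jumpProcess hv h ht,
      hD] at key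
    simp only [Finset.sum_sub_distrib, jumpSum]
    linear_combination -key
  · intro a b ha hab hb hc
    have e := integral_potentialDrift_of_free (r := r) (φ := φ) hv h ha hab fun s h1 h2 =>
      process_eq_flow_of_count hv h ha h1 fun i => (h.count_const ha h1 h2.le (hc i)).symm
    rw [← hadd a b, ← process_eq_flow_of_count hv h ha hab hc] at e
    linarith
  · intro j n a ha haT hT hj hi'
    obtain ⟨e1, e2⟩ := process_jump (φ := φ) hv h ha haT hj hi'
    have e := integral_potentialDrift_of_free (r := r) (φ := φ) hv h ha haT.le fun s h1 h2 =>
      process_eq_flow_of_count hv h ha h1 fun i => by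
        by_cases hij : i = j
        · subst hij
          rw [hj]
          refine (h.count_eq ?_ h2).symm
          exact (hj ▸ (h.count_spec i ha).1).trans h1
        · exact (h.count_const ha h1 h2.le (hi' i hij)).symm
    rw [← hadd] at e
    simp only [potentialJump]
    rw [e1, e2, carrierFree_potential.step]
    linarith

end Decomposition

/-! ### A law of large numbers for compensated sums -/

section LawOfLargeNumbers

variable {Ω : Type*} [MeasurableSpace Ω] {P : Measure Ω} {Y Z : ℕ → Ω → ℝ}

theorem integral_sq_sum_le (hY : ∀ k, MemLp (Y k) 2 P) {K : ℝ} (hK : ∀ k, ∫ ω, Y k ω ^ 2 ∂P ≤ K)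
    (horth : ∀ k l, k < l → ∫ ω, Y k ω * Y l ω ∂P = 0) (n : ℕ) :
    ∫ ω, (∑ k ∈ Finset.range n, Y k ω) ^ 2 ∂P ≤ K * n := by
  induction n with
  | zero => simp
  | succ n ih =>
    have hS : MemLp (fun ω => ∑ k ∈ Finset.range n, Y k ω) 2 P :=
      memLp_finsetSum _ fun k _ => hY k
    have h1 : ∀ k, Integrable (fun ω => Y k ω * Y n ω) P := fun k => (hY k).integrable_mul (hY n)
    have h2 : ∫ ω, (∑ k ∈ Finset.range n, Y k ω) * Y n ω ∂P = 0 := by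
      simp_rw [Finset.sum_mul]
      rw [integral_finsetSum _ fun k _ => h1 k]
      exact Finset.sum_eq_zero fun k hk => horth k n (Finset.mem_range.1 hk)
    have h3 : ∀ ω, (∑ k ∈ Finset.range (n + 1), Y k ω) ^ 2 = (∑ k ∈ Finset.range n, Y k ω) ^ 2 +
        (2 * ((∑ k ∈ Finset.range n, Y k ω) * Y n ω) + Y n ω ^ 2) := fun ω => by
      rw [Finset.sum_range_succ]; ring
    simp_rw [h3]
    have h4 : Integrable (fun ω => 2 * ((∑ k ∈ Finset.range n, Y k ω) * Y n ω)) P :=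
      (hS.integrable_mul (hY n)).const_mul 2
    have h5 : Integrable (fun ω => 2 * ((∑ k ∈ Finset.range n, Y k ω) * Y n ω) + Y n ω ^ 2) P :=
      h4.add (hY n).integrable_sq
    rw [integral_add hS.integrable_sq h5, integral_add h4 (hY n).integrable_sq, integral_const_mul,
      h2]
    push_cast
    linarith [hK n]

theorem ae_tendsto_zero_of_integral_sq_le {T : ℕ → Ω → ℝ} (hT : ∀ n, MemLp (T n) 2 P) {b : ℕ → ℝ}
    (hb : Summable b) (hTb : ∀ n, ∫ ω, T n ω ^ 2 ∂P ≤ b n) :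
    ∀ᵐ ω ∂P, Tendsto (fun n => T n ω) atTop (𝓝 0) := by
  have h1 : ∫⁻ ω, ∑' n, ENNReal.ofReal (T n ω ^ 2) ∂P ≠ ⊤ := by
    rw [lintegral_tsum fun n =>
      ((hT n).integrable_sq.aestronglyMeasurable.aemeasurable).ennreal_ofReal]
    have : ∀ n, ∫⁻ ω, ENNReal.ofReal (T n ω ^ 2) ∂P ≤ ENNReal.ofReal (b n) := fun n => by
      rw [← ofReal_integral_eq_lintegral_ofReal (hT n).integrable_sq
        (Eventually.of_forall fun ω => sq_nonneg _)]
      exact ENNReal.ofReal_le_ofReal (hTb n)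
    refine ne_top_of_le_ne_top ?_ (ENNReal.tsum_le_tsum this)
    exact hb.tsum_ofReal_ne_top
  have h2 := ae_lt_top' (AEMeasurable.tsum fun n =>
    ((hT n).integrable_sq.aestronglyMeasurable.aemeasurable).ennreal_ofReal) h1
  filter_upwards [h2] with ω hω
  have h3 := ENNReal.tendsto_atTop_zero_of_tsum_ne_top hω.ne
  have h4 := (ENNReal.tendsto_toReal ENNReal.zero_ne_top).comp h3
  have h5 : Tendsto (fun n => T n ω ^ 2) atTop (𝓝 0) := by
    refine h4.congr fun n => ?_
    simp [ENNReal.toReal_ofReal (sq_nonneg (T n ω))]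
  have h6 := h5.sqrt
  simp only [Real.sqrt_sq_eq_abs, Real.sqrt_zero] at h6
  exact (tendsto_zero_iff_abs_tendsto_zero _).2 h6

/-- A law of large numbers for orthogonal variables with bounded second moments that are dominated
by variables whose averages converge. Second moments give convergence along the squares; the
domination makes the sums of `Y k + Z k` monotone, which fills the gaps. -/
theorem ae_tendsto_sum_div_zero (hY : ∀ k, MemLp (Y k) 2 P) {K : ℝ}
    (hK : ∀ k, ∫ ω, Y k ω ^ 2 ∂P ≤ K) (horth : ∀ k l, k < l → ∫ ω, Y k ω * Y l ω ∂P = 0)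
    (hZ : ∀ᵐ ω ∂P, ∀ k, |Y k ω| ≤ Z k ω) {ζ : ℝ}
    (hζ : ∀ᵐ ω ∂P, Tendsto (fun n : ℕ => (∑ k ∈ Finset.range n, Z k ω) / n) atTop (𝓝 ζ)) :
    ∀ᵐ ω ∂P, Tendsto (fun n : ℕ => (∑ k ∈ Finset.range n, Y k ω) / n) atTop (𝓝 0) := by
  set c : ℕ → ℕ := fun n => (n + 1) ^ 2 with hc
  have hsq : ∀ᵐ ω ∂P, Tendsto (fun n : ℕ => (∑ k ∈ Finset.range (c n), Y k ω) / (c n : ℕ))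
      atTop (𝓝 0) := by
    refine ae_tendsto_zero_of_integral_sq_le (b := fun n : ℕ => K * (1 / ((n : ℝ) + 1) ^ 2))
      (fun n => ?_) ?_ fun n => ?_
    · simpa only [div_eq_mul_inv, mul_comm] using
        (memLp_finsetSum (Finset.range (c n)) fun k _ => hY k).const_mul ((c n : ℝ)⁻¹)
    · have := (summable_nat_add_iff 1).2 (Real.summable_one_div_nat_pow.2 one_lt_two)
      exact (by simpa using this : Summable fun n : ℕ => 1 / ((n : ℝ) + 1) ^ 2).mul_left K
    · simp_rw [div_pow]
      rw [integral_div, div_le_iff₀ (by simp only [hc]; positivity)]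
      refine (integral_sq_sum_le hY hK horth (c n)).trans_eq ?_
      simp only [hc]
      push_cast
      field_simp
  have hct : Tendsto c atTop atTop :=
    tendsto_atTop_mono (fun n => by simp only [hc, id]; nlinarith) tendsto_id
  filter_upwards [hsq, hZ, hζ] with ω h1 h2 h3
  have h4 := tendsto_div_of_monotone_of_exists_subseq_tendsto_div
    (fun n => ∑ k ∈ Finset.range n, (Y k ω + Z k ω)) ζ
    (monotone_nat_of_le_succ fun n => by
      rw [Finset.sum_range_succ]; linarith [(abs_le.1 (h2 n)).1]) fun a ha => by
    refine ⟨c, ?_, hct, ?_⟩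
    · have e1 : Tendsto (fun n : ℕ => (1 + 1 / ((n : ℝ) + 1)) ^ 2) atTop (𝓝 ((1 + 0) ^ 2)) :=
        (tendsto_one_div_add_atTop_nhds_zero_nat.const_add 1).pow 2
      filter_upwards [e1.eventually_le_const (by simpa using ha : (1 + 0 : ℝ) ^ 2 < a)] with n hn
      simp only [hc]
      push_cast
      have : ((n : ℝ) + 1 + 1) ^ 2 = (1 + 1 / ((n : ℝ) + 1)) ^ 2 * ((n : ℝ) + 1) ^ 2 := by
        field_simp
      rw [this]
      gcongr
    · simpa only [Finset.sum_add_distrib, add_div, zero_add, Function.comp_def] using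
        h1.add (h3.comp hct)
  simpa only [Finset.sum_add_distrib, add_div, add_sub_cancel_right, sub_self] using h4.sub h3

end LawOfLargeNumbers

section Compensated

variable {N v r : ℝ} [hN : Fact (0 < N)] [hr : Fact (0 < r)] {τ : Fin 2 × ℕ → ℝ} {φ : State N}
  {j : Fin 2} {k l : ℕ} {f : State N → ℝ} {C : ℝ}

/-- The value of `f` before the `(k+1)`-st reversal of walker `j`, minus its compensator. -/
def compensated (v r : ℝ) (f : State N → ℝ) (φ : State N) (j : Fin 2) (k : ℕ)
    (τ : Fin 2 × ℕ → ℝ) : ℝ :=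
  f (preJump v τ φ j k (τ (j, k))) - r * ∫ u in (0 : ℝ)..τ (j, k), f (preJump v τ φ j k u)

theorem measurable_comp_preJump (hf : Measurable f) (τ : Fin 2 × ℕ → ℝ) (φ : State N) (j : Fin 2)
    (k : ℕ) : Measurable fun u => f (preJump v τ φ j k u) :=
  hf.comp (measurable_preJump measurable_const measurable_const measurable_id)

theorem compensated_update (w : ℝ) : compensated v r f φ j k (Function.update τ (j, k) w) =
    f (preJump v τ φ j k w) - r * ∫ u in (0 : ℝ)..w, f (preJump v τ φ j k u) := by
  simp only [compensated, preJump_update, Function.update_self]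

theorem measurable_compensated (hf : Measurable f) (φ : State N) (j : Fin 2) (k : ℕ) :
    Measurable (compensated v r f φ j k) := by
  have hev : Measurable fun τ : Fin 2 × ℕ → ℝ => τ (j, k) := measurable_pi_apply _
  have hF : Measurable fun p : (Fin 2 × ℕ → ℝ) × ℝ => f (preJump v p.1 φ j k p.2) :=
    hf.comp (measurable_preJump measurable_fst measurable_const measurable_snd)
  have hI : ∀ s : (Fin 2 × ℕ → ℝ) × ℝ → Set ℝ,
      MeasurableSet {p : (Fin 2 × ℕ → ℝ) × ℝ | p.2 ∈ s p} →
      Measurable fun τ => ∫ u, {p : (Fin 2 × ℕ → ℝ) × ℝ | p.2 ∈ s p}.indicator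
        (fun p => f (preJump v p.1 φ j k p.2)) (τ, u) := fun s hs =>
    (hF.indicator hs).stronglyMeasurable.integral_prod_right'.measurable
  refine (hf.comp (measurable_preJump measurable_id measurable_const hev)).sub
    (Measurable.const_mul ?_ r)
  simp only [intervalIntegral]
  refine Measurable.sub ?_ ?_
  · simp_rw [← integral_indicator measurableSet_Ioc]
    exact hI (fun p => Set.Ioc 0 (p.1 (j, k))) ((measurableSet_lt measurable_const
      measurable_snd).inter (measurableSet_le measurable_snd (hev.comp measurable_fst)))
  · simp_rw [← integral_indicator measurableSet_Ioc]
    exact hI (fun p => Set.Ioc (p.1 (j, k)) 0) ((measurableSet_lt (hev.comp measurable_fst)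
      measurable_snd).inter (measurableSet_le measurable_snd measurable_const))

theorem abs_compensated_le (hC : ∀ φ, |f φ| ≤ C) (h : 0 ≤ τ (j, k)) :
    |compensated v r f φ j k τ| ≤ C + C * r * τ (j, k) := by
  refine (abs_sub _ _).trans (add_le_add (hC _) ?_)
  rw [abs_mul, abs_of_pos hr.out, mul_comm C, mul_assoc]
  exact mul_le_mul_of_nonneg_left (abs_integral_Ioc_le (fun _ => hC _) h) hr.out.le

/-- Waiting times after the `k`-th one do not matter before the next reversal. -/
theorem preJump_update_of_lt (hv : 0 < v) (h : Good τ) (hkl : k < l) {w : ℝ} (hw : 0 < w) {u : ℝ}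
    (hu : 0 ≤ u) : preJump v (Function.update τ (j, l) w) φ j k u = preJump v τ φ j k u := by
  have hne : (j, l) ≠ (j, k) := by simpa using hkl.ne'
  have hu1 : 0 < u + 1 := by linarith
  have hg : Good (Function.update τ (j, k) (u + 1)) := h.update hu1
  have h0 : 0 ≤ arrival τ j k + u := add_nonneg (h.arrival_nonneg j k) hu
  have hA : arrival (Function.update τ (j, k) (u + 1)) j (k + 1) = arrival τ j k + (u + 1) := by
    rw [arrival_succ, arrival_update_self _ _ le_rfl, Function.update_self]
  have hAl := (hg.strictMono j).monotone hkl
  have hAl' := (hg.strictMono j).monotone (Nat.le_succ l)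
  rw [preJump, preJump, arrival_update_self _ _ hkl.le, Function.update_comm hne,
    ← process_eq_jumpProcess hv (hg.update hw) h0, ← process_eq_jumpProcess hv hg h0]
  refine process_congr h0 fun s hs hs' => direction_congr fun i => hg.count_update hw hs ?_ ?_ i
  · simp only [Nat.succ_eq_add_one] at hAl hAl'; linarith
  · simp only [Nat.succ_eq_add_one] at hAl; linarith

theorem compensated_update_of_lt (hv : 0 < v) (h : Good τ) (hkl : k < l) {w : ℝ} (hw : 0 < w) :
    compensated v r f φ j k (Function.update τ (j, l) w) = compensated v r f φ j k τ := by
  have hne : (j, k) ≠ (j, l) := by simpa using hkl.ne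
  have hpos := h.pos (j, k)
  simp only [compensated, Function.update_of_ne hne]
  rw [preJump_update_of_lt hv h hkl hw hpos.le]
  congr 2
  refine intervalIntegral.integral_congr fun u hu => ?_
  rw [Set.uIcc_of_le hpos.le] at hu
  simp only [preJump_update_of_lt hv h hkl hw hu.1]

theorem memLp_waitingLaw_apply (p : Fin 2 × ℕ) :
    MemLp (fun τ : Fin 2 × ℕ → ℝ => τ p) 2 (waitingLaw r) :=
  (memLp_two_iff_integrable_sq (measurable_pi_apply p).aestronglyMeasurable).2
    ((measurePreserving_eval_infinitePi (fun _ : Fin 2 × ℕ => expMeasure r)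
      p).integrable_comp_of_integrable (integrable_sq_expMeasure hr.out))

theorem memLp_bound (C : ℝ) (p : Fin 2 × ℕ) :
    MemLp (fun τ : Fin 2 × ℕ → ℝ => C + C * r * τ p) 2 (waitingLaw r) :=
  (memLp_const C).add ((memLp_waitingLaw_apply p).const_mul (C * r))

theorem ae_abs_compensated_le (hC : ∀ φ, |f φ| ≤ C) : ∀ᵐ τ ∂(waitingLaw r), ∀ k,
    |compensated v r f φ j k τ| ≤ C + C * r * τ (j, k) := by
  filter_upwards [ae_good] with τ h k using abs_compensated_le hC (h.pos _).le

theorem memLp_compensated (hf : Measurable f) (hC : ∀ φ, |f φ| ≤ C) :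
    MemLp (compensated v r f φ j k) 2 (waitingLaw r) := by
  refine (memLp_bound C (j, k)).mono (measurable_compensated hf φ j k).aestronglyMeasurable ?_
  filter_upwards [ae_abs_compensated_le hC] with τ h
  exact (h k).trans (le_abs_self _)

theorem integral_compensated_mul (hv : 0 < v) (hf : Measurable f) (hC : ∀ φ, |f φ| ≤ C)
    (hkl : k < l) :
    ∫ τ, compensated v r f φ j k τ * compensated v r f φ j l τ ∂(waitingLaw r) = 0 := by
  rw [integral_waitingLaw_update (j, l) (f := fun τ =>
    compensated v r f φ j k τ * compensated v r f φ j l τ)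
    ((measurable_compensated hf φ j k).mul (measurable_compensated hf φ j l))
    ((memLp_compensated hf hC).integrable_mul (memLp_compensated hf hC))]
  refine integral_eq_zero_of_ae ?_
  filter_upwards [ae_good] with τ h
  have : ∫ w, compensated v r f φ j k (Function.update τ (j, l) w) *
      compensated v r f φ j l (Function.update τ (j, l) w) ∂(expMeasure r) =
      ∫ w, compensated v r f φ j k τ * (f (preJump v τ φ j l w) -
        r * ∫ u in (0 : ℝ)..w, f (preJump v τ φ j l u)) ∂(expMeasure r) := by
    refine integral_congr_ae ?_
    filter_upwards [ae_pos_expMeasure hr.out] with w hw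
    rw [compensated_update_of_lt hv h hkl hw, compensated_update]
  rw [this, integral_const_mul,
    integral_expMeasure_compensator hr.out (measurable_comp_preJump hf τ φ j l) fun _ => hC _]
  simp

theorem integral_compensated_sq_le (hf : Measurable f) (hC : ∀ φ, |f φ| ≤ C) :
    ∫ τ, compensated v r f φ j k τ ^ 2 ∂(waitingLaw r) ≤ ∫ w, (C + C * r * w) ^ 2 ∂(expMeasure r) := by
  have hmp := measurePreserving_eval_infinitePi (fun _ : Fin 2 × ℕ => expMeasure r) (j, k)
  have h1 : ∫ τ : Fin 2 × ℕ → ℝ, (C + C * r * τ (j, k)) ^ 2 ∂(waitingLaw r) =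
      ∫ w, (C + C * r * w) ^ 2 ∂(expMeasure r) := by
    have h2 := integral_map (μ := waitingLaw r) (φ := fun τ => τ (j, k))
      (f := fun w : ℝ => (C + C * r * w) ^ 2) (measurable_pi_apply _).aemeasurable
      (Continuous.aestronglyMeasurable (by fun_prop))
    rw [← h2]
    exact congrArg (fun m => ∫ w, (C + C * r * w) ^ 2 ∂m) hmp.map_eq
  rw [← h1]
  refine integral_mono_ae (memLp_compensated hf hC).integrable_sq
    (memLp_bound C (j, k)).integrable_sq ?_
  filter_upwards [ae_abs_compensated_le hC] with τ h
  exact sq_le_sq.2 ((h k).trans (le_abs_self _))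

/-- The variables `compensated` are orthogonal, since each has mean `0` given the waiting times of the
other walker and the earlier ones of the same walker. -/
theorem ae_tendsto_sum_compensated_div (hv : 0 < v) (hf : Measurable f) (hC : ∀ φ, |f φ| ≤ C)
    (φ : State N) (j : Fin 2) : ∀ᵐ τ ∂(waitingLaw r), Tendsto
      (fun n : ℕ => (∑ k ∈ Finset.range n, compensated v r f φ j k τ) / n) atTop (𝓝 0) := by
  refine ae_tendsto_sum_div_zero (Z := fun k τ => C + C * r * τ (j, k)) (ζ := C + C * r * r⁻¹)
    (fun k => memLp_compensated hf hC) (fun k => integral_compensated_sq_le hf hC)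
    (fun k l hkl => integral_compensated_mul hv hf hC hkl) (ae_abs_compensated_le hC) ?_
  filter_upwards [ae_tendsto_arrival_div j] with τ h
  refine ((h.const_mul (C * r)).const_add C).congr' ?_
  filter_upwards [eventually_gt_atTop 0] with n hn
  have : (n : ℝ) ≠ 0 := by positivity
  rw [Finset.sum_add_distrib, ← Finset.mul_sum, ← arrival]
  simp only [Finset.sum_const, Finset.card_range, nsmul_eq_mul]
  field_simp

theorem sum_compensated_eq (hv : 0 < v) (h : Good τ) (hf : Measurable f) (hC : ∀ φ, |f φ| ≤ C)
    (n : ℕ) : ∑ k ∈ Finset.range n, compensated v r f φ j k τ =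
      (∑ k ∈ Finset.range n, f (preJump v τ φ j k (τ (j, k)))) -
        r * ∫ s in (0 : ℝ)..arrival τ j n, f (jumpProcess v τ φ s) := by
  have h1 : ∀ k, ∫ u in (0 : ℝ)..τ (j, k), f (preJump v τ φ j k u) =
      ∫ s in arrival τ j k..arrival τ j (k + 1), f (jumpProcess v τ φ s) := fun k => by
    have hpos := h.pos (j, k)
    have hadd := intervalIntegral.integral_comp_add_left (a := 0) (b := τ (j, k))
      (fun s => f (jumpProcess v τ φ s)) (arrival τ j k)
    rw [add_zero, ← arrival_succ] at hadd
    rw [← hadd]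
    refine intervalIntegral.integral_congr_ae ?_
    have hae : ∀ᵐ u : ℝ, u ≠ τ (j, k) := by simp [ae_iff]
    filter_upwards [hae] with u hu hu'
    rw [Set.uIoc_of_le hpos.le] at hu'
    rw [preJump_eq hv h hu'.1.le (lt_of_le_of_ne hu'.2 hu)]
  simp only [compensated, Finset.sum_sub_distrib, ← Finset.mul_sum, h1]
  rw [intervalIntegral.sum_integral_adjacent_intervals fun k _ => intervalIntegrable_along hf hC _ _,
    arrival_zero]

theorem tendsto_reversalCount (h : Good τ) (j : Fin 2) : Tendsto (reversalCount τ j) atTop atTop :=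
  tendsto_atTop.2 fun n => by
    filter_upwards [eventually_ge_atTop (arrival τ j n)] with t ht
    exact (h.le_count_iff ((h.arrival_nonneg j n).trans ht)).2 ht

/-- The compensated sum over the reversals of a walker is negligible in the long run. -/
theorem ae_tendsto_jumpSum_sub_div (hv : 0 < v) (hf : Measurable f) (hC : ∀ φ, |f φ| ≤ C)
    (φ : State N) (j : Fin 2) : ∀ᵐ τ ∂(waitingLaw r), Tendsto (fun t : ℝ =>
      (jumpSum v (fun p => f p.2) φ j t τ - r * timeIntegral v (fun p => f p.2) φ t τ) / t)
        atTop (𝓝 0) := by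
  have hr := hr.out
  filter_upwards [ae_good, ae_tendsto_sum_compensated_div hv hf hC φ j, ae_tendsto_arrival_div j]
    with τ h h1 h2
  have hC0 : 0 ≤ C := (abs_nonneg _).trans (hC φ)
  set S : ℕ → ℝ := fun n => ∑ k ∈ Finset.range n, compensated v r f φ j k τ
  -- a bound at times between the `n`-th and the `(n+1)`-st reversal
  set b : ℕ → ℝ := fun n => (|S n| + r * C * (arrival τ j (n + 1) - arrival τ j n)) / arrival τ j n
  have hb : Tendsto b atTop (𝓝 0) := by
    have h3 : Tendsto (fun n : ℕ => arrival τ j (n + 1) / n) atTop (𝓝 r⁻¹) := by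
      have e1 := (h2.comp (tendsto_add_atTop_nat 1)).mul
        (tendsto_one_div_atTop_nhds_zero_nat.const_add (1 : ℝ))
      rw [add_zero, mul_one] at e1
      refine e1.congr' ?_
      filter_upwards [eventually_gt_atTop 0] with n hn
      have : (n : ℝ) ≠ 0 := by positivity
      simp only [Function.comp]
      push_cast
      field_simp
    have h4 := (h1.abs.add ((h3.sub h2).const_mul (r * C))).div h2 (inv_ne_zero hr.ne')
    simp only [sub_self, mul_zero, abs_zero, add_zero, zero_div] at h4
    refine h4.congr' ?_
    filter_upwards [eventually_gt_atTop 0] with n hn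
    have : (0 : ℝ) < n := by exact_mod_cast hn
    simp only [Pi.div_apply, b, S, abs_div, abs_of_pos this]
    have h5 : arrival τ j n ≠ 0 := by simpa using (h.strictMono j hn).ne'
    field_simp
  refine squeeze_zero_norm' ?_ (hb.comp (tendsto_reversalCount h j))
  filter_upwards [(tendsto_reversalCount h j).eventually_gt_atTop 0, eventually_gt_atTop 0]
    with t hn ht
  obtain ⟨s1, s2⟩ := h.count_spec j ht.le
  set n := reversalCount τ j t with hn'
  have hA : 0 < arrival τ j n := by simpa using h.strictMono j hn
  have hM : jumpSum v (fun p => f p.2) φ j t τ - r * timeIntegral v (fun p => f p.2) φ t τ =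
      S n - r * ∫ s in arrival τ j n..t, f (jumpProcess v τ φ s) := by
    simp only [S, sum_compensated_eq hv h hf hC, jumpSum, timeIntegral, ← hn']
    rw [← intervalIntegral.integral_add_adjacent_intervals
      (intervalIntegrable_along (v := v) (τ := τ) (φ := φ) hf hC 0 (arrival τ j n))
      (intervalIntegrable_along hf hC (arrival τ j n) t)]
    ring
  have hR : |∫ s in arrival τ j n..t, f (jumpProcess v τ φ s)| ≤ C * (t - arrival τ j n) := by
    have := intervalIntegral.norm_integral_le_of_norm_le_const (a := arrival τ j n) (b := t)
      (f := fun s => f (jumpProcess v τ φ s)) (C := C) fun u _ => hC _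
    rwa [abs_of_nonneg (sub_nonneg.2 s1)] at this
  rw [hM, Real.norm_eq_abs, abs_div, abs_of_pos ht]
  simp only [Function.comp, b, ← hn']
  refine div_le_div₀ (add_nonneg (abs_nonneg _) (mul_nonneg (mul_nonneg hr.le hC0)
    (sub_nonneg.2 (s1.trans s2.le)))) ((abs_sub _ _).trans (add_le_add_right ?_ _)) hA s1
  rw [abs_mul, abs_of_pos hr, mul_assoc]
  refine mul_le_mul_of_nonneg_left (hR.trans (mul_le_mul_of_nonneg_left ?_ hC0)) hr.le
  linarith

/-- The long-term average of the message direction. -/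
theorem ae_tendsto_average_messageDir (hv : 0 < v) (φ : State N) : ∀ᵐ τ ∂(waitingLaw r),
    Tendsto (fun t : ℝ => (∫ s in (0 : ℝ)..t, (jumpProcess v τ φ s).messageDir) / t) atTop
      (𝓝 (meanDir N v r)) := by
  obtain ⟨C, hC⟩ := exists_abs_potential_le (N := N) (v := v) (r := r)
  obtain ⟨C', hC'⟩ := exists_abs_potentialJump_le (N := N) (v := v) (r := r)
  have hM := ae_all_iff.2 fun j => ae_tendsto_jumpSum_sub_div (r := r) hv
    (measurable_potentialJump (v := v) (r := r) j) (hC' j) φ j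
  filter_upwards [ae_good, ae_ne_arrival, hM] with τ h hne hM
  have hg : Tendsto (fun t : ℝ => (potential v r (jumpProcess v τ φ t) - potential v r φ) / t) atTop
      (𝓝 0) := by
    refine squeeze_zero_norm' (a := fun t : ℝ => (C + C) / t) ?_
      (tendsto_const_nhds.div_atTop tendsto_id)
    filter_upwards [eventually_gt_atTop 0] with t ht
    rw [Real.norm_eq_abs, abs_div, abs_of_pos ht]
    gcongr
    exact (abs_sub _ _).trans (add_le_add (hC _) (hC _))
  have key := ((hg.sub (tendsto_finsetSum Finset.univ fun j _ => hM j)).add_const (meanDir N v r))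
  simp only [Finset.sum_const_zero, sub_zero, zero_add] at key
  refine key.congr' ?_
  filter_upwards [eventually_gt_atTop 0] with t ht
  have := integral_messageDir_sub (r := r) hv h hne φ ht.le
  rw [← Finset.sum_div, ← sub_div, ← this]
  field_simp
  ring

end Compensated

/-! ### Invariant measures and long-term averages for given random waiting times -/

section Transfer

variable {N v r : ℝ} [hN : Fact (0 < N)] [hr : Fact (0 < r)]

/-- Every invariant measure gives the message the direction `meanDir` on average, because the time
averages started from it have a constant expectation and converge to `meanDir`. -/
theorem integral_messageDir_of_map_eq (hv : 0 < v) {π : Measure (State N)} [IsProbabilityMeasure π]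
    (hπ : ∀ t : ℝ, 0 ≤ t → (π.prod (waitingLaw r)).map (fun q => jumpProcess v q.2 q.1 t) = π) :
    ∫ φ, φ.messageDir ∂π = meanDir N v r := by
  set m := π.prod (waitingLaw r)
  have hH : Measurable fun p : ℝ × State N => p.2.messageDir :=
    measurable_messageDir.comp measurable_snd
  have hC : ∀ p : ℝ × State N, |p.2.messageDir| ≤ 1 := fun p => (abs_messageDir p.2).le
  set F : ℕ → State N × (Fin 2 × ℕ → ℝ) → ℝ := fun n q =>
    timeIntegral v (fun p => p.2.messageDir) q.1 n q.2 / n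
  have hF : ∀ n, Measurable (F n) := fun n =>
    (measurable_timeIntegral hH n.cast_nonneg measurable_snd measurable_fst).div_const _
  have hFb : ∀ n q, |F n q| ≤ 1 := fun n q => by
    have := abs_timeIntegral_le (v := v) hC (Nat.cast_nonneg n : (0 : ℝ) ≤ n) q.1 q.2
    rw [one_mul] at this
    simp only [F, abs_div, Nat.abs_cast]
    exact div_le_one_of_le₀ this n.cast_nonneg
  -- by invariance the time averages have a constant expectation
  have hmean : ∀ n : ℕ, 0 < n → ∫ q, F n q ∂m = ∫ φ, φ.messageDir ∂π := fun n hn => by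
    have hn0 : (0 : ℝ) ≤ n := n.cast_nonneg
    have hn1 : (n : ℝ) ≠ 0 := by positivity
    simp only [F, timeIntegral]
    rw [integral_div, integral_integral_swap_of_bounded (m := m) (C := 1)
      (f := fun (q : State N × (Fin 2 × ℕ → ℝ)) s => (jumpProcess v q.2 q.1 s).messageDir)
      (measurable_messageDir.comp (measurable_jumpProcess (measurable_snd.comp measurable_fst)
        (measurable_fst.comp measurable_fst) measurable_snd))
      (fun q s => (abs_messageDir _).le) hn0]
    have : ∀ s ∈ Set.uIcc (0 : ℝ) n, ∫ q, (jumpProcess v q.2 q.1 s).messageDir ∂m =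
        ∫ φ, φ.messageDir ∂π := fun s hs => by
      rw [Set.uIcc_of_le hn0] at hs
      conv_rhs => rw [← hπ s hs.1]
      rw [integral_map (measurable_jumpProcess_prod s).aemeasurable
        measurable_messageDir.aestronglyMeasurable]
    rw [intervalIntegral.integral_congr this, intervalIntegral.integral_const, smul_eq_mul, sub_zero,
      mul_div_cancel_left₀ _ hn1]
  have hlim : ∀ᵐ q ∂m, Tendsto (fun n => F n q) atTop (𝓝 (meanDir N v r)) := by
    refine (Measure.ae_prod_iff_ae_ae (measurableSet_tendsto_fun hF measurable_const)).2
      (Eventually.of_forall fun φ => ?_)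
    filter_upwards [ae_tendsto_average_messageDir (r := r) hv φ] with τ h
    exact h.comp tendsto_natCast_atTop_atTop
  have h1 := tendsto_integral_of_dominated_convergence (fun _ => (1 : ℝ))
    (fun n => (hF n).aestronglyMeasurable) (integrable_const 1)
    (fun n => Eventually.of_forall fun q => hFb n q) hlim
  rw [integral_const, probReal_univ, one_smul] at h1
  refine tendsto_nhds_unique (tendsto_const_nhds.congr' ?_) h1
  filter_upwards [eventually_gt_atTop 0] with n hn using (hmean n hn).symm

variable {Ω : Type*} [MeasurableSpace Ω] {P : Measure Ω} {τ : Fin 2 × ℕ → Ω → ℝ}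

theorem lintegral_process_eq (hv : 0 < v)
    (hτ : HasLaw (fun ω p => τ p ω) (waitingLaw r) P) (π : Measure (State N))
    [IsProbabilityMeasure π] {t : ℝ} (ht : 0 ≤ t) {A : Set (State N)} (hA : MeasurableSet A) :
    ∫⁻ φ, P {ω | process v (fun p => τ p ω) φ t ∈ A} ∂π =
      (π.prod (waitingLaw r)).map (fun q => jumpProcess v q.2 q.1 t) A := by
  rw [Measure.map_apply (measurable_jumpProcess_prod t) hA,
    Measure.prod_apply (measurable_jumpProcess_prod t hA)]
  refine lintegral_congr fun φ => ?_
  have hm : MeasurableSet {τ | jumpProcess v τ φ t ∈ A} :=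
    (measurable_jumpProcess measurable_id measurable_const measurable_const) hA
  have h1 : P {ω | process v (fun p => τ p ω) φ t ∈ A} =
      P ((fun ω p => τ p ω) ⁻¹' {τ | jumpProcess v τ φ t ∈ A}) := by
    refine measure_congr ?_
    have hgood : ∀ᵐ ω ∂P, Good fun p => τ p ω :=
      ae_of_ae_map hτ.aemeasurable (by rw [hτ.map_eq]; exact ae_good)
    filter_upwards [hgood] with ω hω
    exact propext (by
      change process v (fun p => τ p ω) φ t ∈ A ↔ jumpProcess v (fun p => τ p ω) φ t ∈ A
      rw [process_eq_jumpProcess hv hω ht])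
  rw [h1, ← Measure.map_apply_of_aemeasurable hτ.aemeasurable hm, hτ.map_eq]
  rfl

theorem isInvariantLaw_iff (hv : 0 < v) (hτ : HasLaw (fun ω p => τ p ω) (waitingLaw r) P)
    (π : Measure (State N)) [IsProbabilityMeasure π] : IsInvariantLaw P τ v π ↔
      ∀ t : ℝ, 0 ≤ t → (π.prod (waitingLaw r)).map (fun q => jumpProcess v q.2 q.1 t) = π := by
  refine ⟨fun h t ht => Measure.ext fun A hA => ?_, fun h => ⟨inferInstance, fun t ht A hA => ?_⟩⟩
  · rw [← lintegral_process_eq hv hτ π ht hA, h.invariant t ht A hA]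
  · rw [lintegral_process_eq hv hτ π ht hA, h t ht]

theorem ae_tendsto_average_process (hv : 0 < v)
    (hτ : HasLaw (fun ω p => τ p ω) (waitingLaw r) P) (φ : State N) : ∀ᵐ ω ∂P,
    Tendsto (fun t : ℝ => (1 / t) * ∫ s in (0 : ℝ)..t,
      v * (process v (fun p => τ p ω) φ s).messageDir) atTop (𝓝 (v * meanDir N v r)) := by
  have h : ∀ᵐ τ ∂(waitingLaw r), Good τ ∧
      Tendsto (fun t : ℝ => (∫ s in (0 : ℝ)..t, (jumpProcess v τ φ s).messageDir) / t) atTop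
        (𝓝 (meanDir N v r)) := ae_good.and (ae_tendsto_average_messageDir hv φ)
  rw [← hτ.map_eq] at h
  filter_upwards [ae_of_ae_map hτ.aemeasurable h] with ω hω
  refine (hω.2.const_mul v).congr' ?_
  filter_upwards [eventually_ge_atTop 0] with t ht
  have : ∀ s ∈ Set.uIcc 0 t, v * (process v (fun p => τ p ω) φ s).messageDir =
      v * (jumpProcess v (fun p => τ p ω) φ s).messageDir := fun s hs => by
    rw [Set.uIcc_of_le ht] at hs
    rw [process_eq_jumpProcess hv hω.1 hs.1]
  rw [intervalIntegral.integral_congr this, intervalIntegral.integral_const_mul]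
  ring

end Transfer

end TwoWalkers

theorem theorem3p4 (N v r : ℝ) (hN : 0 < N) (hv : 0 < v) (hr : 0 < r)
    {Ω : Type*} [MeasurableSpace Ω] (P : Measure Ω) [IsProbabilityMeasure P]
    (τ : Fin 2 × ℕ → Ω → ℝ) (hτ_indep : iIndepFun τ P)
    (hτ_law : ∀ p, HasLaw (τ p) (expMeasure r) P) :
    (∃ π : Measure (TwoWalkers.State N), TwoWalkers.IsInvariantLaw P τ v π) ∧
    (∀ π : Measure (TwoWalkers.State N), TwoWalkers.IsInvariantLaw P τ v π →
      v * ∫ φ, φ.messageDir ∂π = v ^ 2 / (2 * v + r * N)) ∧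
    (∀ φ : TwoWalkers.State N, ∀ᵐ ω ∂P,
      Tendsto
        (fun t : ℝ => (1 / t) * ∫ s in (0 : ℝ)..t,
          v * (TwoWalkers.process v (fun p => τ p ω) φ s).messageDir)
        atTop (𝓝 (v ^ 2 / (2 * v + r * N)))) := by
  have := Fact.mk hN
  have := Fact.mk hr
  have hτ : HasLaw (fun ω p => τ p ω) (TwoWalkers.waitingLaw r) P :=
    hτ_indep.hasLaw_infinitePi hτ_law (aemeasurable_pi_iff.2 fun p => (hτ_law p).aemeasurable)
  have hmean : v ^ 2 / (2 * v + r * N) = v * TwoWalkers.meanDir N v r := by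
    rw [TwoWalkers.meanDir]; ring
  rw [hmean]
  refine ⟨?_, fun π hπ => ?_, TwoWalkers.ae_tendsto_average_process hv hτ⟩
  · obtain ⟨π, hπ, h⟩ := TwoWalkers.exists_map_jumpProcess_eq (N := N) (v := v) (r := r) hv
    exact ⟨π, (TwoWalkers.isInvariantLaw_iff hv hτ π).2 h⟩
  · have := hπ.isProbabilityMeasure
    rw [TwoWalkers.integral_messageDir_of_map_eq hv ((TwoWalkers.isInvariantLaw_iff hv hτ π).1 hπ)]

end
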